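/- Let $\alpha\neq\beta$ be complex numbers and consider the homogeneous discrete potential KdV equation $$(v_{m+1,n+1}-v_{m,n})(v_{m+1,n}-v_{m,n+1})=\alpha-\beta,\qquad m,n\in\mathbb Z,$$ on the square lattice; horizontal edges carry the parameter $\alpha$, vertical edges the parameter $\beta$. Replace a rectangle $R$ of $M\times N$ cells ($M,N\ge 1$) by a finite simply connected planar quad-graph $D$ (all of whose bounded faces are quadrilaterals) having the same boundary cycle as $R$. A strip of $D$ is an equivalence class of edges under the relation generated by being opposite edges of a face. Assume that the defect $D$ is weak: every strip which enters $D$ through an edge of one side of the rectangle leaves it through an edge of the opposite side (the order of the strips may be permuted). Let the edges of $D$ carry parameters that are constant along strips and equal to $\alpha$, $\beta$ on the horizontal, respectively vertical, boundary edges (on closed strips inside $D$ they are arbitrary). A solution on the lattice with the defect is a complex-valued function on its vertices that satisfies the above equation on each lattice cell outside $R$, and $(v_{12}-v)(v_1-v_2)=\alpha_1-\alpha_2$ on each face of $D$ with consecutive vertices $v,v_1,v_{12},v_2$, where $\alpha_1,\alpha_2$ are the parameters of the edges $(v,v_1)$, $(v,v_2)$. Let $P$ be a connected subgraph of the square lattice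 that lies outside the defect (it contains no vertex and no edge lying strictly inside $R$) and meets each horizontal and each vertical strip of the square lattice at exactly one edge (for example, a staircase). Then for generic initial data $w:P\to\mathbb C$ (all data outside the union of the zero sets of countably many non-zero polynomials, each in finitely many of the values of $w$) the following holds. The equation on the square lattice without defect has exactly one solution $u$ with $u|_P=w$; the equation on the lattice with the defect has a solution $v$ with $v|_P=w$; and every such solution $v$ coincides with $u$ at all vertices that are not strictly inside $R$. In other words, weak defects are transparent. -/

import Mathlib

/-- A rectangle `[a, a + M] × [b, b + N]` of the square lattice, with `M, N ≥ 1`. -/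
structure Rect where
  a : ℤ
  b : ℤ
  M : ℕ
  N : ℕ
  M_pos : 0 < M
  N_pos : 0 < N

namespace Rect

/-- The lattice cell with lower left corner `(m, n)` is one of the cells of the rectangle. -/
def HasCell (R : Rect) (m n : ℤ) : Prop :=
  R.a ≤ m ∧ m < R.a + R.M ∧ R.b ≤ n ∧ n < R.b + R.N

/-- The lattice point `p` lies strictly inside the rectangle. -/
def Inside (R : Rect) (p : ℤ × ℤ) : Prop :=
  R.a < p.1 ∧ p.1 < R.a + R.M ∧ R.b < p.2 ∧ p.2 < R.b + R.N

/-- The part of the square lattice graph that survives when everything strictly inside the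
rectangle is removed: the lattice edges which are a side of at least one cell outside the
rectangle (the edges on the boundary of the rectangle are kept). -/
def outerGraph (R : Rect) : SimpleGraph (ℤ × ℤ) :=
  SimpleGraph.fromRel fun p q =>
    (q = (p.1 + 1, p.2) ∧ (¬ R.HasCell p.1 p.2 ∨ ¬ R.HasCell p.1 (p.2 - 1))) ∨
    (q = (p.1, p.2 + 1) ∧ (¬ R.HasCell p.1 p.2 ∨ ¬ R.HasCell (p.1 - 1) p.2))

/-- The unit edges on the boundary of the rectangle. They are listed as directed edges, the
boundary being traversed counterclockwise. -/
inductive Side (R : Rect) : Type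
  | bottom (i : Fin R.M) : Side R
  | right (j : Fin R.N) : Side R
  | top (i : Fin R.M) : Side R
  | left (j : Fin R.N) : Side R

/-- The starting point of a counterclockwise boundary edge. -/
def Side.src {R : Rect} : R.Side → ℤ × ℤ
  | .bottom i => (R.a + (i : ℕ), R.b)
  | .right j => (R.a + R.M, R.b + (j : ℕ))
  | .top i => (R.a + (i : ℕ) + 1, R.b + R.N)
  | .left j => (R.a, R.b + (j : ℕ) + 1)

/-- The end point of a counterclockwise boundary edge. -/
def Side.tgt {R : Rect} : R.Side → ℤ × ℤ
  | .bottom i => (R.a + (i : ℕ) + 1, R.b)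
  | .right j => (R.a + R.M, R.b + (j : ℕ) + 1)
  | .top i => (R.a + (i : ℕ), R.b + R.N)
  | .left j => (R.a, R.b + (j : ℕ))

/-- Two boundary edges lie on opposite sides of the rectangle. -/
def Side.Opposite {R : Rect} : R.Side → R.Side → Prop
  | .bottom _, .top _ => True
  | .top _, .bottom _ => True
  | .left _, .right _ => True
  | .right _, .left _ => True
  | _, _ => False

end Rect

/-- A finite oriented surface glued from quadrilaterals, with boundary edges labelled by the
boundary edges of the rectangle `R`.

The directed edges ("darts") are of two kinds. `Sum.inl (f, k)` is the `k`-th side of the face `f`,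
the four sides of a face being traversed counterclockwise, so it leads from the `k`-th to the
`(k + 1)`-st corner of `f`. `Sum.inr s` is the boundary edge `s`, traversed clockwise, that is, with
the outer region on its left. `glue` sends a directed edge to the same edge traversed in the opposite
direction; thus each side of a face is glued either to one other side of a face or to one edge of
the boundary. -/
structure QuadSurface (R : Rect) where
  Face : Type
  finite_face : Finite Face
  glue : (Face × Fin 4) ⊕ R.Side → (Face × Fin 4) ⊕ R.Side
  glue_glue : ∀ d, glue (glue d) = d
  glue_ne : ∀ d, glue d ≠ d

namespace QuadSurface

variable {R : Rect} (G : QuadSurface R)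

/-- Directed edges. -/
abbrev Dart : Type := (G.Face × Fin 4) ⊕ R.Side

/-- The relation generating "the darts `d` and `d'` start at the same vertex": the `k`-th side of a
face ends where its `(k + 1)`-st side starts. -/
def CornerRel (d d' : G.Dart) : Prop :=
  ∃ (f : G.Face) (k : Fin 4), d = G.glue (Sum.inl (f, k)) ∧ d' = Sum.inl (f, k + 1)

/-- The vertices of the surface. -/
def Vertex : Type := Quot G.CornerRel

/-- The vertex at which a dart starts. -/
def start (d : G.Dart) : G.Vertex := Quot.mk _ d

/-- The vertex at which a dart ends. -/
def finish (d : G.Dart) : G.Vertex := G.start (G.glue d)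

/-- The `k`-th corner of a face (counterclockwise). -/
def corner (f : G.Face) (k : Fin 4) : G.Vertex := G.start (Sum.inl (f, k))

/-- The list of darts `l` is an edge path from `x` to `y`. -/
def IsPath (x y : G.Vertex) : List G.Dart → Prop
  | [] => x = y
  | d :: l => G.start d = x ∧ IsPath (G.finish d) y l

/-- Elementary homotopies of edge paths: deleting a backtracking, deleting the boundary of a
face. -/
inductive Move : List G.Dart → List G.Dart → Prop
  | backtrack (p q : List G.Dart) (d : G.Dart) : Move (p ++ [d, G.glue d] ++ q) (p ++ q)
  | face (p q : List G.Dart) (f : G.Face) :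
      Move (p ++ [Sum.inl (f, 0), Sum.inl (f, 1), Sum.inl (f, 2), Sum.inl (f, 3)] ++ q) (p ++ q)

/-- Homotopy of edge paths from `x` to `y`. -/
def Homotopic (x y : G.Vertex) : List G.Dart → List G.Dart → Prop :=
  Relation.EqvGen fun l l' => G.IsPath x y l ∧ G.IsPath x y l' ∧ G.Move l l'

/-- The surface is connected and each closed edge path in it is null-homotopic. -/
def SimplyConnected : Prop :=
  (∀ x y, ∃ l, G.IsPath x y l) ∧ ∀ x l, G.IsPath x x l → G.Homotopic x x l []

/-- Two darts belong to edges crossed by the same strip (characteristic): the equivalence relation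
generated by passing to the same edge with the other direction, and to the opposite side of a
face. A strip is an equivalence class. -/
def SameStrip : G.Dart → G.Dart → Prop :=
  Relation.EqvGen fun d d' =>
    d' = G.glue d ∨ ∃ (f : G.Face) (k : Fin 4), d = Sum.inl (f, k) ∧ d' = Sum.inl (f, k + 2)

end QuadSurface

/-- A localized defect replacing the rectangle `R` of the square lattice: a finite simply connected
quad-graph whose boundary is the boundary cycle of `R`. (A connected and simply connected
compact surface with non-empty boundary is a disk, so the quad-graph is planar.) -/
structure Defect (R : Rect) extends QuadSurface R where
  /-- The clockwise boundary dart of the edge `s` starts at the lattice point `s.tgt`, the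
  counterclockwise boundary dart of the edge `t` starts at the lattice point `t.src`. -/
  boundary : ∀ s t : R.Side,
    toQuadSurface.start (Sum.inr s) = toQuadSurface.finish (Sum.inr t) ↔ s.tgt = t.src
  simplyConnected : toQuadSurface.SimplyConnected

namespace Defect

variable {R : Rect} (D : Defect R)

/-- A defect is weak if each strip that enters it through some side of the rectangle leaves it
through the opposite side. -/
def IsWeak : Prop :=
  ∀ s : R.Side, ∃ t : R.Side, s.Opposite t ∧ D.SameStrip (Sum.inr s) (Sum.inr t)

/-- An assignment of parameters to the edges of the defect that extends the homogeneous one of the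
lattice outside: it is constant along the strips, equal to `α` on the horizontal and to `β` on the
vertical edges of the boundary of the rectangle. (On closed strips it is arbitrary.) -/
structure IsParameter (α β : ℂ) (c : D.Dart → ℂ) : Prop where
  glue : ∀ d, c (D.glue d) = c d
  opposite : ∀ (f : D.Face) (k : Fin 4), c (Sum.inl (f, k + 2)) = c (Sum.inl (f, k))
  bottom : ∀ i, c (Sum.inr (.bottom i)) = α
  top : ∀ i, c (Sum.inr (.top i)) = α
  left : ∀ j, c (Sum.inr (.left j)) = β
  right : ∀ j, c (Sum.inr (.right j)) = β

end Defect

/-- The dKdV equation on the cell of the square lattice with lower left corner `(m, n)`. -/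
def LatticeEq (α β : ℂ) (u : ℤ × ℤ → ℂ) (m n : ℤ) : Prop :=
  (u (m + 1, n + 1) - u (m, n)) * (u (m + 1, n) - u (m, n + 1)) = α - β

/-- Solutions of the homogeneous dKdV equation on the square lattice. -/
def IsLatticeSolution (α β : ℂ) (u : ℤ × ℤ → ℂ) : Prop :=
  ∀ m n, LatticeEq α β u m n

/-- Solutions of the homogeneous dKdV equation on the square lattice in which the rectangle `R` is
replaced by the defect `D` with parameters `c`. A field on this lattice consists of a field `v` on
the lattice points that are not strictly inside `R` (the values of `v` strictly inside `R` play no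
role) and of a field `h` on the vertices of `D`, which coincide on the boundary of `R`. The equation
holds on each lattice cell outside `R` and on each face of `D`. -/
structure Defect.IsSolution {R : Rect} (D : Defect R) (α β : ℂ) (c : D.Dart → ℂ)
    (v : ℤ × ℤ → ℂ) (h : D.Vertex → ℂ) : Prop where
  outside : ∀ m n, ¬ R.HasCell m n → LatticeEq α β v m n
  face : ∀ f : D.Face,
    (h (D.corner f 2) - h (D.corner f 0)) * (h (D.corner f 1) - h (D.corner f 3)) =
      c (Sum.inl (f, 0)) - c (Sum.inl (f, 1))
  boundary : ∀ s : R.Side, h (D.start (Sum.inr s)) = v s.tgt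

/-- A Cauchy subgraph of the square lattice lying outside the rectangle `R`: a connected subgraph
that meets each vertical and each horizontal strip of the lattice at exactly one edge. -/
structure IsCauchySubgraph (R : Rect) (P : R.outerGraph.Subgraph) : Prop where
  connected : P.Connected
  vertical_strip : ∀ m : ℤ, ∃! n : ℤ, P.Adj (m, n) (m + 1, n)
  horizontal_strip : ∀ n : ℤ, ∃! m : ℤ, P.Adj (m, n) (m, n + 1)

/-- A property holds for generic data `w` on `S` if it holds outside the union of the zero sets of
countably many non-zero polynomials, each in finitely many of the values of `w`. -/
def Generically {S : Type} (p : (S → ℂ) → Prop) : Prop :=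
  ∃ Q : ℕ → MvPolynomial S ℂ, (∀ k, Q k ≠ 0) ∧
    ∀ w : S → ℂ, (∀ k, MvPolynomial.eval w (Q k) ≠ 0) → p w

/-! Existence and genericity are treated over the field of rational functions in the initial data.
Denominators are seen to be nonzero by evaluation at one special point: the data of the linear
solution `r α * m + r β * n`, where `r γ ^ 2 - r δ ^ 2 = γ - δ`. `RegularAt` records such
evaluations, and `generically_regularAt` transfers identities between countably many rational
functions to generic complex data.

Existence on the defect. By three-dimensional consistency (`cube_consistency`) the lattice solution
extends to a lattice with one direction for each parameter occurring in the defect, every new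
direction being a Bäcklund transformation (`IsMultiSolution.exists_of_finite`). As the defect is
simply connected, counting crossings with each strip modulo 2 labels its vertices by sets of strips.
Summing the unit steps of the strips in such a set places the vertex in the large lattice, and faces
become lattice squares or degenerate. Weakness makes the boundary land on the boundary of the flat
rectangle in the `α`-`β` plane, so the pulled back solution has the right boundary values
(`Defect.IsWeak.exists_field`).

Uniqueness outside. The equation has a zero curvature representation, so for every solution the
product of the transition matrices around the boundary is proportional to the identity, whatever
happens inside (`Defect.hasTrivialMonodromy`). Hence two adjacent sides determine the product over
the other two up to a scalar. At the spectral parameter of an edge its matrix has rank one. This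
makes the factorization unique as soon as second neighbours along the sides carry different values
of the undisturbed solution (`chainLax_mul_unique`); for the linear solution they differ by `2 * r
α` or `2 * r β`, so this is a generic condition. Thus two adjacent sides of the rectangle determine
the others, just as without the defect. Finally, a connected graph meeting each strip once avoids a
quadrant that contains the interior of the rectangle; the data determine the solution off this
quadrant, then on the two remaining sides, then beyond (`StripTree.outside`). -/

/-! ### Values of rational functions at a point. -/

open MvPolynomial in
/-- The rational function `x` is regular at the point `w` and takes the value `y` there. -/
def RegularAt {S : Type} (w : S → ℂ) (x : FractionRing (MvPolynomial S ℂ)) (y : ℂ) : Prop :=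
  ∃ f s : MvPolynomial S ℂ, eval w s ≠ 0 ∧
    x = algebraMap _ (FractionRing (MvPolynomial S ℂ)) f / algebraMap _ _ s ∧
    y = eval w f / eval w s

namespace RegularAt

open MvPolynomial

variable {S : Type} {w : S → ℂ} {x x' : FractionRing (MvPolynomial S ℂ)} {y y' : ℂ}

theorem algebraMap_ne_zero {s : MvPolynomial S ℂ} (hs : eval w s ≠ 0) :
    algebraMap (MvPolynomial S ℂ) (FractionRing (MvPolynomial S ℂ)) s ≠ 0 := by
  intro h
  have : s = 0 := by simpa using h
  simp [this] at hs

theorem unique (h : RegularAt w x y) (h' : RegularAt w x y') : y = y' := by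
  obtain ⟨f, s, hs, rfl, rfl⟩ := h
  obtain ⟨f', s', hs', hx, rfl⟩ := h'
  rw [div_eq_div_iff (algebraMap_ne_zero hs) (algebraMap_ne_zero hs'), ← map_mul, ← map_mul] at hx
  have := IsFractionRing.injective (MvPolynomial S ℂ) (FractionRing (MvPolynomial S ℂ)) hx
  rw [div_eq_div_iff hs hs', ← map_mul, ← map_mul, this]

theorem of_poly (f : MvPolynomial S ℂ) : RegularAt w (algebraMap _ _ f) (eval w f) :=
  ⟨f, 1, by simp, by simp, by simp⟩

theorem const (z : ℂ) : RegularAt w (algebraMap ℂ _ z) z := by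
  have := of_poly (w := w) (C z)
  rwa [eval_C, ← MvPolynomial.algebraMap_eq, ← IsScalarTower.algebraMap_apply] at this

theorem add (h : RegularAt w x y) (h' : RegularAt w x' y') : RegularAt w (x + x') (y + y') := by
  obtain ⟨f, s, hs, rfl, rfl⟩ := h
  obtain ⟨f', s', hs', rfl, rfl⟩ := h'
  refine ⟨f * s' + s * f', s * s', by simp [hs, hs'], ?_, ?_⟩
  · rw [div_add_div _ _ (algebraMap_ne_zero hs) (algebraMap_ne_zero hs')]; simp
  · rw [div_add_div _ _ hs hs']; simp

theorem mul (h : RegularAt w x y) (h' : RegularAt w x' y') : RegularAt w (x * x') (y * y') := by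
  obtain ⟨f, s, hs, rfl, rfl⟩ := h
  obtain ⟨f', s', hs', rfl, rfl⟩ := h'
  exact ⟨f * f', s * s', by simp [hs, hs'], by simp [div_mul_div_comm],
    by simp [div_mul_div_comm]⟩

theorem neg (h : RegularAt w x y) : RegularAt w (-x) (-y) := by
  simpa using (const (-1)).mul h

theorem sub (h : RegularAt w x y) (h' : RegularAt w x' y') : RegularAt w (x - x') (y - y') := by
  simpa [sub_eq_add_neg] using h.add h'.neg

theorem inv (h : RegularAt w x y) (hy : y ≠ 0) : RegularAt w x⁻¹ y⁻¹ := by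
  obtain ⟨f, s, hs, rfl, rfl⟩ := h
  refine ⟨s, f, fun h => hy (by simp [h]), by simp, by simp⟩

theorem div (h : RegularAt w x y) (h' : RegularAt w x' y') (hy : y' ≠ 0) :
    RegularAt w (x / x') (y / y') := by
  simpa [div_eq_mul_inv] using h.mul (h'.inv hy)

theorem ne_zero (h : RegularAt w x y) (hy : y ≠ 0) : x ≠ 0 := by
  rintro rfl
  exact hy (h.unique (by simpa using const (w := w) 0))

end RegularAt

/-- Countably many rational functions take values at a generic point. -/
theorem generically_regularAt {S ι : Type} [Countable ι]
    (x : ι → FractionRing (MvPolynomial S ℂ)) :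
    Generically fun w : S → ℂ => ∃ y : ι → ℂ, ∀ i, RegularAt w (x i) (y i) := by
  have h : ∀ i, ∃ f s : MvPolynomial S ℂ, s ≠ 0 ∧ x i = algebraMap _ _ f / algebraMap _ _ s := by
    intro i
    obtain ⟨f, s, hs, h⟩ := IsFractionRing.div_surjective (A := MvPolynomial S ℂ) (x i)
    exact ⟨f, s, nonZeroDivisors.ne_zero hs, h.symm⟩
  choose f s hs hx using h
  rcases isEmpty_or_nonempty ι with hι | hι
  · exact ⟨fun _ => 1, fun _ => one_ne_zero, fun w _ => ⟨fun _ => 0, fun i => hι.elim i⟩⟩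
  obtain ⟨e, he⟩ := exists_surjective_nat ι
  refine ⟨fun k => s (e k), fun k => hs _, fun w hw =>
    ⟨fun i => MvPolynomial.eval w (f i) / MvPolynomial.eval w (s i), fun i =>
      ⟨f i, s i, ?_, hx i, rfl⟩⟩⟩
  obtain ⟨k, rfl⟩ := he i
  exact hw k

theorem Generically.mono {S : Type} {p q : (S → ℂ) → Prop} (h : Generically p)
    (hpq : ∀ w, p w → q w) : Generically q := by
  obtain ⟨Q, hQ, hw⟩ := h
  exact ⟨Q, hQ, fun w h => hpq w (hw w h)⟩

/-! ### Three-dimensional consistency and Bäcklund chains. -/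

/-- Three-dimensional consistency of the dKdV equation: the equations on the three faces at the
vertex `u` and on one further face imply the equations on the remaining two faces. -/
theorem cube_consistency {K : Type*} [Field K] {a b d u u1 u2 u12 y y1 y2 y12 : K}
    (hab : a ≠ b) (had : a ≠ d) (hbd : b ≠ d)
    (hu : (u12 - u) * (u1 - u2) = a - b)
    (h1 : (y1 - u) * (u1 - y) = a - d)
    (h2 : (y2 - u) * (u2 - y) = b - d)
    (h12 : (y12 - u2) * (u12 - y2) = a - d) :
    (y12 - u1) * (u12 - y1) = b - d ∧ (y12 - y) * (y1 - y2) = a - b := by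
  have n12 : u1 - u2 ≠ 0 := right_ne_zero_of_mul (hu ▸ sub_ne_zero.2 hab)
  have n1 : u1 - y ≠ 0 := right_ne_zero_of_mul (h1 ▸ sub_ne_zero.2 had)
  have n2 : u2 - y ≠ 0 := right_ne_zero_of_mul (h2 ▸ sub_ne_zero.2 hbd)
  have n3 : u12 - y2 ≠ 0 := right_ne_zero_of_mul (h12 ▸ sub_ne_zero.2 had)
  have e12 : u12 = u + (a - b) / (u1 - u2) := by field_simp; linear_combination hu
  have e1 : y1 = u + (a - d) / (u1 - y) := by field_simp; linear_combination h1
  have e2 : y2 = u + (b - d) / (u2 - y) := by field_simp; linear_combination h2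
  -- Both `u12 - y1` and `u12 - y2` equal `W` up to nonzero factors. The fourth equation forces `W ≠
  -- 0`, and `y12` can then be solved for.
  set W := a * (u2 - y) - b * (u1 - y) + d * (u1 - u2) with hW
  have eW : u12 - y2 = W / ((u1 - u2) * (u2 - y)) := by
    rw [e12, e2, hW]; field_simp; ring
  have eW' : u12 - y1 = W / ((u1 - u2) * (u1 - y)) := by
    rw [e12, e1, hW]; field_simp; ring
  have nW : W ≠ 0 := by
    rintro h
    rw [h, zero_div] at eW
    exact n3 eW
  have e3 : y12 = u2 + (a - d) * ((u1 - u2) * (u2 - y)) / W := by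
    rw [eW] at h12
    field_simp at h12 ⊢
    linear_combination h12
  constructor
  · rw [eW', e3]
    field_simp
    rw [hW]; ring
  · rw [e3, e1, e2]
    field_simp
    rw [hW]; ring

/-- Dependent choice in both directions from `k₀`. The predicate `good` is the invariant, in
practice regularity with a prescribed value, that makes the next step possible. -/
theorem exists_int_seq {T : Type*} (good : ℤ → T → Prop) (r : ℤ → T → T → Prop)
    (fwd : ∀ k t, good k t → ∃ t', good (k + 1) t' ∧ r k t t')
    (bwd : ∀ k t, good (k + 1) t → ∃ t', good k t' ∧ r k t' t) (k₀ : ℤ) (t₀ : T)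
    (h₀ : good k₀ t₀) :
    ∃ y : ℤ → T, y k₀ = t₀ ∧ ∀ k, good k (y k) ∧ r k (y k) (y (k + 1)) := by
  choose! f hf hfr using fwd
  choose! g hg hgr using bwd
  let F : ℕ → T := fun n => Nat.rec t₀ (fun n t => f (k₀ + n) t) n
  let G : ℕ → T := fun n => Nat.rec t₀ (fun n t => g (k₀ - n - 1) t) n
  have hF : ∀ n : ℕ, good (k₀ + n) (F n) := by
    intro n
    induction n with
    | zero => simpa [F] using h₀
    | succ n ih => simpa [add_assoc] using hf _ _ ih
  have hG : ∀ n : ℕ, good (k₀ - n) (G n) := by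
    intro n
    induction n with
    | zero => simpa [G] using h₀
    | succ n ih =>
      have := hg (k₀ - n - 1) (G n) (by simpa using ih)
      rw [show k₀ - (n + 1 : ℕ) = k₀ - n - 1 by push_cast; ring]
      exact this
  refine ⟨fun k => if k₀ ≤ k then F (k - k₀).toNat else G (k₀ - k).toNat, by simp [F], fun k => ?_⟩
  rcases le_or_gt k₀ k with h | h
  · obtain ⟨n, rfl⟩ : ∃ n : ℕ, k = k₀ + n := ⟨(k - k₀).toNat, by omega⟩
    have e1 : (k₀ + (n : ℤ) - k₀).toNat = n := by omega
    have e2 : (k₀ + (n : ℤ) + 1 - k₀).toNat = n + 1 := by omega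
    simp only [h, if_true, show k₀ ≤ k₀ + (n : ℤ) + 1 by omega, e1, e2]
    exact ⟨hF n, hfr _ _ (hF n)⟩
  · obtain ⟨n, rfl⟩ : ∃ n : ℕ, k = k₀ - n - 1 := ⟨(k₀ - k - 1).toNat, by omega⟩
    have e1 : (k₀ - (k₀ - (n : ℤ) - 1)).toNat = n + 1 := by omega
    -- The two branches meet at `k₀`, where `F 0 = G 0 = t₀`.
    have e2 : (if k₀ ≤ k₀ - (n : ℤ) - 1 + 1 then F (k₀ - (n : ℤ) - 1 + 1 - k₀).toNat
        else G (k₀ - (k₀ - (n : ℤ) - 1 + 1)).toNat) = G n := by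
      rcases n with _ | n
      · simp [F, G]
      · rw [if_neg (by push_cast; omega)]
        have : (k₀ - (k₀ - ((n + 1 : ℕ) : ℤ) - 1 + 1)).toNat = n + 1 := by omega
        rw [this]
    simp only [e2, if_neg (not_le.2 h), e1]
    have hGn : good (k₀ - n - 1 + 1) (G n) := by simpa using hG n
    exact ⟨hg _ _ hGn, hgr _ _ hGn⟩

/-- Bäcklund transformation of a sequence: a solution on a neighbouring row of the lattice is
determined by one value. -/
theorem exists_chain {S : Type} {w : S → ℂ} {u : ℤ → FractionRing (MvPolynomial S ℂ)}
    {u₀ y₀ : ℤ → ℂ} {κ : ℂ} (hκ : κ ≠ 0) (hu : ∀ k, RegularAt w (u k) (u₀ k))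
    (h₀ : ∀ k, (y₀ (k + 1) - u₀ k) * (u₀ (k + 1) - y₀ k) = κ) (k₀ : ℤ)
    {t : FractionRing (MvPolynomial S ℂ)} (ht : RegularAt w t (y₀ k₀)) :
    ∃ y : ℤ → FractionRing (MvPolynomial S ℂ), y k₀ = t ∧
      (∀ k, (y (k + 1) - u k) * (u (k + 1) - y k) = algebraMap ℂ _ κ) ∧
      ∀ k, RegularAt w (y k) (y₀ k) := by
  have fwd : ∀ k x, RegularAt w x (y₀ k) → ∃ x', RegularAt w x' (y₀ (k + 1)) ∧
      (x' - u k) * (u (k + 1) - x) = algebraMap ℂ _ κ := by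
    intro k x hx
    -- The prescribed values have a nonzero product `κ`, so the denominator does not vanish at `w`,
    -- and hence not in the field.
    have n : u₀ (k + 1) - y₀ k ≠ 0 := right_ne_zero_of_mul ((h₀ k).symm ▸ hκ)
    have r := (hu (k + 1)).sub hx
    refine ⟨u k + algebraMap ℂ _ κ / (u (k + 1) - x), ?_, ?_⟩
    · have := (hu k).add ((RegularAt.const κ).div r n)
      convert this using 1
      rw [← h₀ k]; field_simp; ring
    · have := r.ne_zero n
      field_simp; ring
  have bwd : ∀ k x, RegularAt w x (y₀ (k + 1)) → ∃ x', RegularAt w x' (y₀ k) ∧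
      (x - u k) * (u (k + 1) - x') = algebraMap ℂ _ κ := by
    intro k x hx
    have n : y₀ (k + 1) - u₀ k ≠ 0 := left_ne_zero_of_mul ((h₀ k).symm ▸ hκ)
    have r := hx.sub (hu k)
    refine ⟨u (k + 1) - algebraMap ℂ _ κ / (x - u k), ?_, ?_⟩
    · have := (hu (k + 1)).sub ((RegularAt.const κ).div r n)
      convert this using 1
      rw [← h₀ k]; field_simp; ring
    · have := r.ne_zero n
      field_simp; ring
  obtain ⟨y, hy, h⟩ := exists_int_seq _ _ fwd bwd k₀ t ht
  exact ⟨y, hy, fun k => (h k).2, fun k => (h k).1⟩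

/-! ### Connected graphs meeting every strip once. -/

/-- A connected graph of unit edges on a set `V` of lattice points that meets each strip of the
square lattice at exactly one edge. -/
structure StripTree (V : Set (ℤ × ℤ)) (Adj : ℤ × ℤ → ℤ × ℤ → Prop) : Prop where
  symm : ∀ {p q}, Adj p q → Adj q p
  mem : ∀ {p q}, Adj p q → p ∈ V
  unit : ∀ {p q}, Adj p q →
    q = (p.1 + 1, p.2) ∨ q = (p.1 - 1, p.2) ∨ q = (p.1, p.2 + 1) ∨ q = (p.1, p.2 - 1)
  conn : ∀ {p q}, p ∈ V → q ∈ V → Relation.ReflTransGen Adj p q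
  horiz : ∀ m, ∃! n, Adj (m, n) (m + 1, n)
  vert : ∀ n, ∃! m, Adj (m, n) (m, n + 1)

/-- A rectangle of lattice points. -/
structure LatticeBox where
  x₀ : ℤ
  x₁ : ℤ
  y₀ : ℤ
  y₁ : ℤ

/-- The points of a rectangle. -/
def LatticeBox.Has (B : LatticeBox) (p : ℤ × ℤ) : Prop :=
  B.x₀ ≤ p.1 ∧ p.1 ≤ B.x₁ ∧ B.y₀ ≤ p.2 ∧ p.2 ≤ B.y₁

namespace StripTree

variable {V : Set (ℤ × ℤ)} {Adj : ℤ × ℤ → ℤ × ℤ → Prop}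

theorem trapped (T : StripTree V Adj) {Z : ℤ × ℤ → Prop} (hZ : ∀ p q, Z p → Adj p q → Z q)
    {p q : ℤ × ℤ} (hp : Z p) (hpV : p ∈ V) (hq : q ∈ V) : Z q := by
  have h := T.conn hpV hq
  induction h with
  | refl => exact hp
  | tail _ hbc ih => exact hZ _ _ (ih (T.mem hbc)) hbc

theorem horiz_unique (T : StripTree V Adj) {m n n' : ℤ} (h : Adj (m, n) (m + 1, n))
    (h' : Adj (m, n') (m + 1, n')) : n = n' := (T.horiz m).unique h h'

theorem vert_unique (T : StripTree V Adj) {m m' n : ℤ} (h : Adj (m, n) (m, n + 1))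
    (h' : Adj (m', n) (m', n + 1)) : m = m' := (T.vert n).unique h h'

/-- The sides of a quadrant with corner at this cell are crossed only by edges of the strips `m` and
`n`. The only graph edges in these strips are `h` and `v`, and both are positioned so that they do
not cross. A connected graph with a vertex in the quadrant would therefore stay there, but `h` has
an endpoint outside. The next three lemmas are the other quadrants. -/
theorem not_mem_ne (T : StripTree V Adj) {m n x y : ℤ} (h : Adj (m, y) (m + 1, y))
    (v : Adj (x, n) (x, n + 1)) (hy : y ≤ n) (hx : x ≤ m) {p : ℤ × ℤ} (hp : p ∈ V) :
    ¬ (m < p.1 ∧ n < p.2) := by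
  intro hc
  have := T.trapped (Z := fun p => m < p.1 ∧ n < p.2) ?_ hc hp (T.mem h)
  · exact lt_irrefl _ this.1
  rintro ⟨a, b⟩ q ⟨h1, h2⟩ hq
  rcases T.unit hq with rfl | rfl | rfl | rfl <;> simp only at h1 h2 hq ⊢
  · omega
  · refine ⟨lt_of_le_of_ne (by omega) fun e => ?_, h2⟩
    obtain rfl : a = m + 1 := by omega
    rw [add_sub_cancel_right] at hq
    have := T.horiz_unique h (T.symm hq); omega
  · omega
  · refine ⟨h1, lt_of_le_of_ne (by omega) fun e => ?_⟩
    obtain rfl : b = n + 1 := by omega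
    rw [add_sub_cancel_right] at hq
    have := T.vert_unique v (T.symm hq); omega

theorem not_mem_se (T : StripTree V Adj) {m n x y : ℤ} (h : Adj (m, y) (m + 1, y))
    (v : Adj (x, n) (x, n + 1)) (hy : n < y) (hx : x ≤ m) {p : ℤ × ℤ} (hp : p ∈ V) :
    ¬ (m < p.1 ∧ p.2 ≤ n) := by
  intro hc
  have := T.trapped (Z := fun p => m < p.1 ∧ p.2 ≤ n) ?_ hc hp (T.mem h)
  · exact lt_irrefl _ this.1
  rintro ⟨a, b⟩ q ⟨h1, h2⟩ hq
  rcases T.unit hq with rfl | rfl | rfl | rfl <;> simp only at h1 h2 hq ⊢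
  · omega
  · refine ⟨lt_of_le_of_ne (by omega) fun e => ?_, h2⟩
    obtain rfl : a = m + 1 := by omega
    rw [add_sub_cancel_right] at hq
    have := T.horiz_unique h (T.symm hq); omega
  · refine ⟨h1, not_lt.1 fun e => ?_⟩
    obtain rfl : b = n := by omega
    have := T.vert_unique v hq; omega
  · omega

theorem not_mem_nw (T : StripTree V Adj) {m n x y : ℤ} (h : Adj (m, y) (m + 1, y))
    (v : Adj (x, n) (x, n + 1)) (hy : y ≤ n) (hx : m < x) {p : ℤ × ℤ} (hp : p ∈ V) :
    ¬ (p.1 ≤ m ∧ n < p.2) := by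
  intro hc
  have := T.trapped (Z := fun p => p.1 ≤ m ∧ n < p.2) ?_ hc hp (T.mem h)
  · simp only at this; omega
  rintro ⟨a, b⟩ q ⟨h1, h2⟩ hq
  rcases T.unit hq with rfl | rfl | rfl | rfl <;> simp only at h1 h2 hq ⊢
  · refine ⟨not_lt.1 fun e => ?_, h2⟩
    obtain rfl : a = m := by omega
    have := T.horiz_unique h hq; omega
  · omega
  · omega
  · refine ⟨h1, lt_of_le_of_ne (by omega) fun e => ?_⟩
    obtain rfl : b = n + 1 := by omega
    rw [add_sub_cancel_right] at hq
    have := T.vert_unique v (T.symm hq); omega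

theorem not_mem_sw (T : StripTree V Adj) {m n x y : ℤ} (h : Adj (m, y) (m + 1, y))
    (v : Adj (x, n) (x, n + 1)) (hy : n < y) (hx : m < x) {p : ℤ × ℤ} (hp : p ∈ V) :
    ¬ (p.1 ≤ m ∧ p.2 ≤ n) := by
  intro hc
  have := T.trapped (Z := fun p => p.1 ≤ m ∧ p.2 ≤ n) ?_ hc hp (T.mem h)
  · simp only at this; omega
  rintro ⟨a, b⟩ q ⟨h1, h2⟩ hq
  rcases T.unit hq with rfl | rfl | rfl | rfl <;> simp only at h1 h2 hq ⊢
  · refine ⟨not_lt.1 fun e => ?_, h2⟩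
    obtain rfl : a = m := by omega
    have := T.horiz_unique h hq; omega
  · omega
  · refine ⟨h1, not_lt.1 fun e => ?_⟩
    obtain rfl : b = n := by omega
    have := T.vert_unique v hq; omega
  · omega

/-- Growing boxes along the edges of the graph exhausts the lattice. -/
theorem exhaust (T : StripTree V Adj) {σ : Type*} (box : σ → LatticeBox) (le : σ → σ → Prop)
    (hrefl : ∀ s, le s s) (htrans : ∀ s s' s'', le s s' → le s' s'' → le s s'')
    (hmono : ∀ s s', le s s' → ∀ p, (box s).Has p → (box s').Has p)
    (step : ∀ s p q, Adj p q → (box s).Has p → ¬ (box s).Has q →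
      ∃ s', le s s' ∧ (box s').Has q)
    (s : σ) {p₀ : ℤ × ℤ} (h₀ : p₀ ∈ V) (hs : (box s).Has p₀) (N : ℤ) :
    ∃ s', le s s' ∧ ∀ p : ℤ × ℤ, (p.1.natAbs : ℤ) ≤ N → (p.2.natAbs : ℤ) ≤ N → (box s').Has p := by
  have key : ∀ s, (box s).Has p₀ → ∀ q ∈ V, ∃ s', le s s' ∧ (box s').Has q := by
    intro s hs q hq
    have h := T.conn h₀ hq
    induction h with
    | refl => exact ⟨s, hrefl s, hs⟩
    | tail _ hbc ih =>
      obtain ⟨s', h1, h2⟩ := ih (T.mem hbc)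
      rename_i c _
      by_cases hc : (box s').Has c
      · exact ⟨s', h1, hc⟩
      · obtain ⟨s'', h3, h4⟩ := step s' _ _ hbc h2 hc
        exact ⟨s'', htrans _ _ _ h1 h3, h4⟩
  -- The graph has vertices with each coordinate equal to `N` and to `-N`. A box containing these
  -- four vertices contains the whole square.
  obtain ⟨y1, hy1, -⟩ := T.horiz N
  obtain ⟨y2, hy2, -⟩ := T.horiz (-N)
  obtain ⟨x1, hx1, -⟩ := T.vert N
  obtain ⟨x2, hx2, -⟩ := T.vert (-N)
  obtain ⟨s1, l1, b1⟩ := key s hs _ (T.mem hy1)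
  have hs1 := hmono _ _ l1 _ hs
  obtain ⟨s2, l2, b2⟩ := key s1 hs1 _ (T.mem hy2)
  have hs2 := hmono _ _ l2 _ hs1
  obtain ⟨s3, l3, b3⟩ := key s2 hs2 _ (T.mem hx1)
  have hs3 := hmono _ _ l3 _ hs2
  obtain ⟨s4, l4, b4⟩ := key s3 hs3 _ (T.mem hx2)
  have c3 := hmono _ _ l4 _ b3
  have c2 := hmono _ _ l4 _ (hmono _ _ l3 _ b2)
  have c1 := hmono _ _ l4 _ (hmono _ _ l3 _ (hmono _ _ l2 _ b1))
  refine ⟨s4, htrans _ _ _ (htrans _ _ _ (htrans _ _ _ l1 l2) l3) l4, fun p hp1 hp2 => ?_⟩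
  simp only [LatticeBox.Has] at *
  omega

/-- The edges of the graph which cross the strips of the box lie in the box. -/
structure Saturated (Adj : ℤ × ℤ → ℤ × ℤ → Prop) (B : LatticeBox) : Prop where
  horiz : ∀ m, B.x₀ ≤ m → m < B.x₁ → ∃ n, B.y₀ ≤ n ∧ n ≤ B.y₁ ∧ Adj (m, n) (m + 1, n)
  vert : ∀ n, B.y₀ ≤ n → n < B.y₁ → ∃ m, B.x₀ ≤ m ∧ m ≤ B.x₁ ∧ Adj (m, n) (m, n + 1)

/-- By saturation the graph edge in each horizontal strip of the box lies to the left of the new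
column. A second graph vertex of that column within the height of the box would then lie in a
forbidden quadrant. So the data prescribe exactly one value on the new column, which matches the one
free value in `exists_chain`. -/
theorem Saturated.right {B : LatticeBox} (h : Saturated Adj B) (T : StripTree V Adj) {y : ℤ}
    (hy : Adj (B.x₁, y) (B.x₁ + 1, y)) (h0 : B.y₀ ≤ y) (h1 : y ≤ B.y₁) :
    Saturated Adj { B with x₁ := B.x₁ + 1 } ∧
      ∀ y', (B.x₁ + 1, y') ∈ V → B.y₀ ≤ y' → y' ≤ B.y₁ → y' = y := by
  refine ⟨⟨fun m hm hm' => ?_, fun n hn hn' => ?_⟩, fun y' hV h2 h3 => ?_⟩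
  · rcases eq_or_ne m B.x₁ with rfl | hne
    · exact ⟨y, h0, h1, hy⟩
    · exact h.horiz m hm (by simp only at hm'; omega)
  · obtain ⟨m, hm, hm', e⟩ := h.vert n hn hn'
    exact ⟨m, hm, by simp only; omega, e⟩
  · by_contra hne
    rcases lt_or_gt_of_ne hne with hlt | hlt
    · obtain ⟨m, hm, hm', e⟩ := h.vert y' (by omega) (by omega)
      exact T.not_mem_se hy e hlt hm' hV ⟨by simp, le_rfl⟩
    · obtain ⟨m, hm, hm', e⟩ := h.vert (y' - 1) (by omega) (by omega)
      exact T.not_mem_ne hy e (by omega) hm' hV ⟨by simp, by simp⟩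

theorem Saturated.left {B : LatticeBox} (h : Saturated Adj B) (T : StripTree V Adj) {y : ℤ}
    (hy : Adj (B.x₀, y) (B.x₀ - 1, y)) (h0 : B.y₀ ≤ y) (h1 : y ≤ B.y₁) :
    Saturated Adj { B with x₀ := B.x₀ - 1 } ∧
      ∀ y', (B.x₀ - 1, y') ∈ V → B.y₀ ≤ y' → y' ≤ B.y₁ → y' = y := by
  replace hy : Adj (B.x₀ - 1, y) (B.x₀ - 1 + 1, y) := by
    rw [sub_add_cancel]; exact T.symm hy
  refine ⟨⟨fun m hm hm' => ?_, fun n hn hn' => ?_⟩, fun y' hV h2 h3 => ?_⟩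
  · rcases eq_or_ne m (B.x₀ - 1) with rfl | hne
    · exact ⟨y, h0, h1, hy⟩
    · exact h.horiz m (by simp only at hm; omega) hm'
  · obtain ⟨m, hm, hm', e⟩ := h.vert n hn hn'
    exact ⟨m, by simp only; omega, hm', e⟩
  · by_contra hne
    rcases lt_or_gt_of_ne hne with hlt | hlt
    · obtain ⟨m, hm, hm', e⟩ := h.vert y' (by omega) (by omega)
      exact T.not_mem_sw hy e hlt (by omega) hV ⟨le_rfl, le_rfl⟩
    · obtain ⟨m, hm, hm', e⟩ := h.vert (y' - 1) (by omega) (by omega)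
      exact T.not_mem_nw hy e (by omega) (by omega) hV ⟨le_rfl, by simp⟩

theorem Saturated.up {B : LatticeBox} (h : Saturated Adj B) (T : StripTree V Adj) {x : ℤ}
    (hx : Adj (x, B.y₁) (x, B.y₁ + 1)) (h0 : B.x₀ ≤ x) (h1 : x ≤ B.x₁) :
    Saturated Adj { B with y₁ := B.y₁ + 1 } ∧
      ∀ x', (x', B.y₁ + 1) ∈ V → B.x₀ ≤ x' → x' ≤ B.x₁ → x' = x := by
  refine ⟨⟨fun m hm hm' => ?_, fun n hn hn' => ?_⟩, fun x' hV h2 h3 => ?_⟩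
  · obtain ⟨m, hm, hm', e⟩ := h.horiz m hm hm'
    exact ⟨m, hm, by simp only; omega, e⟩
  · rcases eq_or_ne n B.y₁ with rfl | hne
    · exact ⟨x, h0, h1, hx⟩
    · exact h.vert n hn (by simp only at hn'; omega)
  · by_contra hne
    rcases lt_or_gt_of_ne hne with hlt | hlt
    · obtain ⟨m, hm, hm', e⟩ := h.horiz x' (by omega) (by omega)
      exact T.not_mem_nw e hx hm' hlt hV ⟨le_rfl, by simp⟩
    · obtain ⟨m, hm, hm', e⟩ := h.horiz (x' - 1) (by omega) (by omega)
      exact T.not_mem_ne e hx hm' (by omega) hV ⟨by simp, by simp⟩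

theorem Saturated.down {B : LatticeBox} (h : Saturated Adj B) (T : StripTree V Adj) {x : ℤ}
    (hx : Adj (x, B.y₀) (x, B.y₀ - 1)) (h0 : B.x₀ ≤ x) (h1 : x ≤ B.x₁) :
    Saturated Adj { B with y₀ := B.y₀ - 1 } ∧
      ∀ x', (x', B.y₀ - 1) ∈ V → B.x₀ ≤ x' → x' ≤ B.x₁ → x' = x := by
  replace hx : Adj (x, B.y₀ - 1) (x, B.y₀ - 1 + 1) := by
    rw [sub_add_cancel]; exact T.symm hx
  refine ⟨⟨fun m hm hm' => ?_, fun n hn hn' => ?_⟩, fun x' hV h2 h3 => ?_⟩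
  · obtain ⟨m, hm, hm', e⟩ := h.horiz m hm hm'
    exact ⟨m, by simp only; omega, hm', e⟩
  · rcases eq_or_ne n (B.y₀ - 1) with rfl | hne
    · exact ⟨x, h0, h1, hx⟩
    · exact h.vert n (by simp only at hn; omega) hn'
  · by_contra hne
    rcases lt_or_gt_of_ne hne with hlt | hlt
    · obtain ⟨m, hm, hm', e⟩ := h.horiz x' (by omega) (by omega)
      exact T.not_mem_sw e hx (by omega) hlt hV ⟨le_rfl, le_rfl⟩
    · obtain ⟨m, hm, hm', e⟩ := h.horiz (x' - 1) (by omega) (by omega)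
      exact T.not_mem_se e hx (by omega) (by omega) hV ⟨by simp, le_rfl⟩

/-- An edge leaving a box enlarges it by one row or column. -/
theorem leave (T : StripTree V Adj) {B : LatticeBox} {p q : ℤ × ℤ} (h : Adj p q) (hp : B.Has p)
    (hq : ¬ B.Has q) :
    (∃ y, B.y₀ ≤ y ∧ y ≤ B.y₁ ∧ Adj (B.x₁, y) (B.x₁ + 1, y) ∧ q = (B.x₁ + 1, y)) ∨
    (∃ y, B.y₀ ≤ y ∧ y ≤ B.y₁ ∧ Adj (B.x₀, y) (B.x₀ - 1, y) ∧ q = (B.x₀ - 1, y)) ∨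
    (∃ x, B.x₀ ≤ x ∧ x ≤ B.x₁ ∧ Adj (x, B.y₁) (x, B.y₁ + 1) ∧ q = (x, B.y₁ + 1)) ∨
    (∃ x, B.x₀ ≤ x ∧ x ≤ B.x₁ ∧ Adj (x, B.y₀) (x, B.y₀ - 1) ∧ q = (x, B.y₀ - 1)) := by
  obtain ⟨a, b⟩ := p
  simp only [LatticeBox.Has] at hp
  rcases T.unit h with rfl | rfl | rfl | rfl <;> simp only [LatticeBox.Has] at hq h
  · obtain rfl : a = B.x₁ := by omega
    exact .inl ⟨b, by omega, by omega, h, rfl⟩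
  · obtain rfl : a = B.x₀ := by omega
    exact .inr (.inl ⟨b, by omega, by omega, h, rfl⟩)
  · obtain rfl : b = B.y₁ := by omega
    exact .inr (.inr (.inl ⟨a, by omega, by omega, h, rfl⟩))
  · obtain rfl : b = B.y₀ := by omega
    exact .inr (.inr (.inr ⟨a, by omega, by omega, h, rfl⟩))

end StripTree

/-! ### Extending data from the graph to the lattice. -/

/-- The dKdV equation with right hand side `κ` on the lattice cell with lower left corner
`(m, n)`. -/
def CellEq {F : Type*} [Field F] (κ : F) (u : ℤ × ℤ → F) (m n : ℤ) : Prop :=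
  (u (m + 1, n + 1) - u (m, n)) * (u (m + 1, n) - u (m, n + 1)) = κ

namespace StripTree

variable {V : Set (ℤ × ℤ)} {Adj : ℤ × ℤ → ℤ × ℤ → Prop}

/-- A field of rational functions, regular at `w` with prescribed values there, which solves the
dKdV equation in a box. -/
structure PartialSolution {S : Type} (V : Set (ℤ × ℤ)) (Adj : ℤ × ℤ → ℤ × ℤ → Prop) (w : S → ℂ)
    (κ : ℂ) (L : ℤ × ℤ → ℂ) (d : ℤ × ℤ → FractionRing (MvPolynomial S ℂ)) where
  box : LatticeBox
  field : ℤ × ℤ → FractionRing (MvPolynomial S ℂ)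
  saturated : Saturated Adj box
  regular : ∀ p, RegularAt w (field p) (L p)
  data : ∀ p ∈ V, box.Has p → field p = d p
  eq : ∀ m n, box.Has (m, n) → box.Has (m + 1, n + 1) → CellEq (algebraMap ℂ _ κ) field m n

variable {S : Type} {w : S → ℂ} {κ : ℂ} {L : ℤ × ℤ → ℂ}
  {d : ℤ × ℤ → FractionRing (MvPolynomial S ℂ)}

/-- Extension of partial solutions. -/
def PartialSolution.Le (s s' : PartialSolution V Adj w κ L d) : Prop :=
  ∀ p, s.box.Has p → s'.box.Has p ∧ s'.field p = s.field p

/-- The new column is the chain over the old boundary column that starts from the only datum on it.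
It is filled in along its whole infinite length, which is why regularity is required everywhere but
the equation only in the box. Read along a column, the cell equation has its second factor reversed,
so the chain has constant `-κ`. -/
theorem PartialSolution.right (T : StripTree V Adj) (hκ : κ ≠ 0) (hL : ∀ m n, CellEq κ L m n)
    (hd : ∀ p ∈ V, RegularAt w (d p) (L p)) (s : PartialSolution V Adj w κ L d) {y : ℤ}
    (h0 : s.box.y₀ ≤ y) (h1 : y ≤ s.box.y₁) (hx : s.box.x₀ ≤ s.box.x₁)
    (h : Adj (s.box.x₁, y) (s.box.x₁ + 1, y)) :
    ∃ s' : PartialSolution V Adj w κ L d, s.Le s' ∧ s'.box.Has (s.box.x₁ + 1, y) := by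
  obtain ⟨hs, hu⟩ := s.saturated.right T h h0 h1
  obtain ⟨z, hz0, hz, hzr⟩ := exists_chain (u := fun k => s.field (s.box.x₁, k))
    (u₀ := fun k => L (s.box.x₁, k)) (y₀ := fun k => L (s.box.x₁ + 1, k)) (neg_ne_zero.2 hκ)
    (fun k => s.regular _) (fun k => by
      have := hL s.box.x₁ k
      simp only [CellEq] at this
      linear_combination -this) y
    (hd _ (T.mem (T.symm h)))
  refine ⟨⟨{ s.box with x₁ := s.box.x₁ + 1 },
    fun p => if p.1 = s.box.x₁ + 1 then z p.2 else s.field p, hs, ?_, ?_, ?_⟩, ?_, ?_⟩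
  · rintro ⟨a, b⟩
    by_cases ha : a = s.box.x₁ + 1
    · subst ha; simpa using hzr b
    · simpa [ha] using s.regular (a, b)
  · rintro ⟨a, b⟩ hV hB
    simp only [LatticeBox.Has] at hB
    by_cases ha : a = s.box.x₁ + 1
    · subst ha
      obtain rfl := hu b hV (by omega) (by omega)
      simpa using hz0
    · simpa [ha] using s.data (a, b) hV ⟨by simp only; omega, by simp only; omega,
        by simp only; omega, by simp only; omega⟩
  · intro m n hB hB'
    simp only [LatticeBox.Has] at hB hB'
    rcases eq_or_ne m s.box.x₁ with rfl | hm
    · have := hz n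
      simp only [map_neg] at this
      simp only [CellEq, if_true]
      rw [if_neg (by omega), if_neg (by omega)]
      linear_combination -this
    · simp only [CellEq]
      rw [if_neg (by omega), if_neg (by omega), if_neg (by omega), if_neg (by omega)]
      refine s.eq m n ⟨?_, ?_, ?_, ?_⟩ ⟨?_, ?_, ?_, ?_⟩ <;> simp only <;> omega
  · rintro ⟨a, b⟩ hB
    simp only [LatticeBox.Has] at hB ⊢
    refine ⟨by omega, ?_⟩
    rw [if_neg (by omega)]
  · simp only [LatticeBox.Has]; omega

theorem PartialSolution.left (T : StripTree V Adj) (hκ : κ ≠ 0) (hL : ∀ m n, CellEq κ L m n)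
    (hd : ∀ p ∈ V, RegularAt w (d p) (L p)) (s : PartialSolution V Adj w κ L d) {y : ℤ}
    (h0 : s.box.y₀ ≤ y) (h1 : y ≤ s.box.y₁) (hx : s.box.x₀ ≤ s.box.x₁)
    (h : Adj (s.box.x₀, y) (s.box.x₀ - 1, y)) :
    ∃ s' : PartialSolution V Adj w κ L d, s.Le s' ∧ s'.box.Has (s.box.x₀ - 1, y) := by
  obtain ⟨hs, hu⟩ := s.saturated.left T h h0 h1
  obtain ⟨z, hz0, hz, hzr⟩ := exists_chain (u := fun k => s.field (s.box.x₀, k))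
    (u₀ := fun k => L (s.box.x₀, k)) (y₀ := fun k => L (s.box.x₀ - 1, k)) (neg_ne_zero.2 hκ)
    (fun k => s.regular _) (fun k => by
      have := hL (s.box.x₀ - 1) k
      simp only [CellEq, sub_add_cancel] at this
      linear_combination -this) y
    (hd _ (T.mem (T.symm h)))
  refine ⟨⟨{ s.box with x₀ := s.box.x₀ - 1 },
    fun p => if p.1 = s.box.x₀ - 1 then z p.2 else s.field p, hs, ?_, ?_, ?_⟩, ?_, ?_⟩
  · rintro ⟨a, b⟩
    by_cases ha : a = s.box.x₀ - 1
    · subst ha; simpa using hzr b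
    · simpa [ha] using s.regular (a, b)
  · rintro ⟨a, b⟩ hV hB
    simp only [LatticeBox.Has] at hB
    by_cases ha : a = s.box.x₀ - 1
    · subst ha
      obtain rfl := hu b hV (by omega) (by omega)
      simpa using hz0
    · simpa [ha] using s.data (a, b) hV ⟨by simp only; omega, by simp only; omega,
        by simp only; omega, by simp only; omega⟩
  · intro m n hB hB'
    simp only [LatticeBox.Has] at hB hB'
    rcases eq_or_ne m (s.box.x₀ - 1) with rfl | hm
    · have := hz n
      simp only [map_neg] at this
      simp only [CellEq, sub_add_cancel, if_true]
      rw [if_neg (by omega), if_neg (by omega)]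
      linear_combination -this
    · simp only [CellEq]
      rw [if_neg (by omega), if_neg (by omega), if_neg (by omega), if_neg (by omega)]
      refine s.eq m n ⟨?_, ?_, ?_, ?_⟩ ⟨?_, ?_, ?_, ?_⟩ <;> simp only <;> omega
  · rintro ⟨a, b⟩ hB
    simp only [LatticeBox.Has] at hB ⊢
    refine ⟨by omega, ?_⟩
    rw [if_neg (by omega)]
  · simp only [LatticeBox.Has]; omega

theorem PartialSolution.up (T : StripTree V Adj) (hκ : κ ≠ 0) (hL : ∀ m n, CellEq κ L m n)
    (hd : ∀ p ∈ V, RegularAt w (d p) (L p)) (s : PartialSolution V Adj w κ L d) {x : ℤ}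
    (h0 : s.box.x₀ ≤ x) (h1 : x ≤ s.box.x₁) (hy : s.box.y₀ ≤ s.box.y₁)
    (h : Adj (x, s.box.y₁) (x, s.box.y₁ + 1)) :
    ∃ s' : PartialSolution V Adj w κ L d, s.Le s' ∧ s'.box.Has (x, s.box.y₁ + 1) := by
  obtain ⟨hs, hu⟩ := s.saturated.up T h h0 h1
  obtain ⟨z, hz0, hz, hzr⟩ := exists_chain (u := fun k => s.field (k, s.box.y₁))
    (u₀ := fun k => L (k, s.box.y₁)) (y₀ := fun k => L (k, s.box.y₁ + 1)) hκ
    (fun k => s.regular _) (fun k => hL k s.box.y₁) x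
    (hd _ (T.mem (T.symm h)))
  refine ⟨⟨{ s.box with y₁ := s.box.y₁ + 1 },
    fun p => if p.2 = s.box.y₁ + 1 then z p.1 else s.field p, hs, ?_, ?_, ?_⟩, ?_, ?_⟩
  · rintro ⟨a, b⟩
    by_cases hb : b = s.box.y₁ + 1
    · subst hb; simpa using hzr a
    · simpa [hb] using s.regular (a, b)
  · rintro ⟨a, b⟩ hV hB
    simp only [LatticeBox.Has] at hB
    by_cases hb : b = s.box.y₁ + 1
    · subst hb
      obtain rfl := hu a hV (by omega) (by omega)
      simpa using hz0
    · simpa [hb] using s.data (a, b) hV ⟨by simp only; omega, by simp only; omega,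
        by simp only; omega, by simp only; omega⟩
  · intro m n hB hB'
    simp only [LatticeBox.Has] at hB hB'
    rcases eq_or_ne n s.box.y₁ with rfl | hn
    · have := hz m
      simp only [CellEq, if_true]
      rw [if_neg (by omega), if_neg (by omega)]
      exact this
    · simp only [CellEq]
      rw [if_neg (by omega), if_neg (by omega), if_neg (by omega), if_neg (by omega)]
      refine s.eq m n ⟨?_, ?_, ?_, ?_⟩ ⟨?_, ?_, ?_, ?_⟩ <;> simp only <;> omega
  · rintro ⟨a, b⟩ hB
    simp only [LatticeBox.Has] at hB ⊢
    refine ⟨by omega, ?_⟩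
    rw [if_neg (by omega)]
  · simp only [LatticeBox.Has]; omega

theorem PartialSolution.down (T : StripTree V Adj) (hκ : κ ≠ 0) (hL : ∀ m n, CellEq κ L m n)
    (hd : ∀ p ∈ V, RegularAt w (d p) (L p)) (s : PartialSolution V Adj w κ L d) {x : ℤ}
    (h0 : s.box.x₀ ≤ x) (h1 : x ≤ s.box.x₁) (hy : s.box.y₀ ≤ s.box.y₁)
    (h : Adj (x, s.box.y₀) (x, s.box.y₀ - 1)) :
    ∃ s' : PartialSolution V Adj w κ L d, s.Le s' ∧ s'.box.Has (x, s.box.y₀ - 1) := by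
  obtain ⟨hs, hu⟩ := s.saturated.down T h h0 h1
  obtain ⟨z, hz0, hz, hzr⟩ := exists_chain (u := fun k => s.field (k, s.box.y₀))
    (u₀ := fun k => L (k, s.box.y₀)) (y₀ := fun k => L (k, s.box.y₀ - 1)) hκ
    (fun k => s.regular _) (fun k => by
      have := hL k (s.box.y₀ - 1)
      simp only [CellEq, sub_add_cancel] at this
      linear_combination this) x
    (hd _ (T.mem (T.symm h)))
  refine ⟨⟨{ s.box with y₀ := s.box.y₀ - 1 },
    fun p => if p.2 = s.box.y₀ - 1 then z p.1 else s.field p, hs, ?_, ?_, ?_⟩, ?_, ?_⟩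
  · rintro ⟨a, b⟩
    by_cases hb : b = s.box.y₀ - 1
    · subst hb; simpa using hzr a
    · simpa [hb] using s.regular (a, b)
  · rintro ⟨a, b⟩ hV hB
    simp only [LatticeBox.Has] at hB
    by_cases hb : b = s.box.y₀ - 1
    · subst hb
      obtain rfl := hu a hV (by omega) (by omega)
      simpa using hz0
    · simpa [hb] using s.data (a, b) hV ⟨by simp only; omega, by simp only; omega,
        by simp only; omega, by simp only; omega⟩
  · intro m n hB hB'
    simp only [LatticeBox.Has] at hB hB'
    rcases eq_or_ne n (s.box.y₀ - 1) with rfl | hn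
    · have := hz m
      simp only [CellEq, sub_add_cancel, if_true]
      rw [if_neg (by omega), if_neg (by omega)]
      linear_combination this
    · simp only [CellEq]
      rw [if_neg (by omega), if_neg (by omega), if_neg (by omega), if_neg (by omega)]
      refine s.eq m n ⟨?_, ?_, ?_, ?_⟩ ⟨?_, ?_, ?_, ?_⟩ <;> simp only <;> omega
  · rintro ⟨a, b⟩ hB
    simp only [LatticeBox.Has] at hB ⊢
    refine ⟨by omega, ?_⟩
    rw [if_neg (by omega)]
  · simp only [LatticeBox.Has]; omega

/-- Regular data on the graph extend to a regular solution on the lattice. -/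
theorem exists_solution (T : StripTree V Adj) (hκ : κ ≠ 0) (hL : ∀ m n, CellEq κ L m n)
    (hd : ∀ p ∈ V, RegularAt w (d p) (L p)) :
    ∃ u : ℤ × ℤ → FractionRing (MvPolynomial S ℂ), (∀ p, RegularAt w (u p) (L p)) ∧
      (∀ p ∈ V, u p = d p) ∧ ∀ m n, CellEq (algebraMap ℂ _ κ) u m n := by
  classical
  obtain ⟨y, hy, -⟩ := T.horiz 0
  have hV := T.mem hy
  let s₀ : PartialSolution V Adj w κ L d :=
    { box := ⟨0, 0, y, y⟩
      -- Away from the starting point constants serve as placeholders: they are regular with the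
      -- prescribed values.
      field := fun p => if p = (0, y) then d (0, y) else algebraMap ℂ _ (L p)
      saturated := ⟨fun m h h' => by simp only at h h'; omega,
        fun m h h' => by simp only at h h'; omega⟩
      regular := fun p => by
        split_ifs with h
        · rw [h]; exact hd _ hV
        · exact RegularAt.const _
      data := fun p _ h => by
        obtain ⟨a, b⟩ := p
        simp only [LatticeBox.Has] at h
        obtain rfl : a = 0 := by omega
        obtain rfl : b = y := by omega
        simp
      eq := fun m n h h' => by simp only [LatticeBox.Has] at h h'; omega }
  have hs₀ : s₀.box.Has (0, y) := by simp [s₀, LatticeBox.Has]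
  have hrefl : ∀ s : PartialSolution V Adj w κ L d, s.Le s := fun s p hp => ⟨hp, rfl⟩
  have htrans : ∀ s s' s'' : PartialSolution V Adj w κ L d, s.Le s' → s'.Le s'' → s.Le s'' :=
    fun s s' s'' h h' p hp =>
      ⟨(h' p (h p hp).1).1, (h' p (h p hp).1).2.trans (h p hp).2⟩
  have ext : ∀ s : PartialSolution V Adj w κ L d, s.box.Has (0, y) → ∀ N : ℤ,
      ∃ s', s.Le s' ∧ ∀ p : ℤ × ℤ, (p.1.natAbs : ℤ) ≤ N → (p.2.natAbs : ℤ) ≤ N → s'.box.Has p := by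
    intro s hs N
    refine T.exhaust (fun s => s.box) (fun s s' => s.Le s') hrefl htrans
      (fun s s' h p hp => (h p hp).1) (fun s p q h hp hq => ?_) s hV hs N
    have h1 : s.box.x₀ ≤ s.box.x₁ := hp.1.trans hp.2.1
    have h2 : s.box.y₀ ≤ s.box.y₁ := hp.2.2.1.trans hp.2.2.2
    rcases T.leave h hp hq with ⟨y, a, b, c, rfl⟩ | ⟨y, a, b, c, rfl⟩ | ⟨y, a, b, c, rfl⟩ |
      ⟨y, a, b, c, rfl⟩
    · exact s.right T hκ hL hd a b h1 c
    · exact s.left T hκ hL hd a b h1 c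
    · exact s.up T hκ hL hd a b h2 c
    · exact s.down T hκ hL hd a b h2 c
  choose! next hle hcov using ext
  -- Stage `n + 1` covers the square of radius `n`, and later stages do not change values in earlier
  -- boxes, so the limit is read off at any sufficiently late stage.
  let F : ℕ → PartialSolution V Adj w κ L d := fun n => Nat.rec s₀ (fun n s => next s n) n
  have hF0 : ∀ n, (F n).box.Has (0, y) := by
    intro n
    induction n with
    | zero => exact hs₀
    | succ n ih => exact (hle (F n) ih n _ ih).1
  have hF : ∀ n k, (F n).Le (F (n + k)) := by
    intro n k
    induction k with
    | zero => exact hrefl _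
    | succ k ih => exact htrans _ _ _ ih (hle _ (hF0 _) _)
  have hFc : ∀ (n : ℕ) (p : ℤ × ℤ), p.1.natAbs ≤ n → p.2.natAbs ≤ n → (F (n + 1)).box.Has p :=
    fun n p h1 h2 => hcov (F n) (hF0 n) n p (by omega) (by omega)
  let u : ℤ × ℤ → FractionRing (MvPolynomial S ℂ) :=
    fun p => (F (p.1.natAbs + p.2.natAbs + 1)).field p
  have hu : ∀ (n : ℕ) (p : ℤ × ℤ), p.1.natAbs + p.2.natAbs ≤ n → u p = (F (n + 1)).field p := by
    intro n p h
    obtain ⟨k, rfl⟩ := Nat.exists_eq_add_of_le h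
    have := hF (p.1.natAbs + p.2.natAbs + 1) k p (hFc _ p (by omega) (by omega))
    rw [show p.1.natAbs + p.2.natAbs + k + 1 = p.1.natAbs + p.2.natAbs + 1 + k by omega]
    exact this.2.symm
  refine ⟨u, fun p => (F (p.1.natAbs + p.2.natAbs + 1)).regular p, fun p hp => (F (p.1.natAbs + p.2.natAbs + 1)).data p hp
    (hFc _ p (Nat.le_add_right _ _) (Nat.le_add_left _ _)),
    fun m n => ?_⟩
  have hc : ∀ a b : ℤ, a.natAbs ≤ m.natAbs + n.natAbs + 2 → b.natAbs ≤ m.natAbs + n.natAbs + 2 →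
      (F (m.natAbs + n.natAbs + 2 + 1)).box.Has (a, b) := fun a b => hFc _ (a, b)
  have e := (F (m.natAbs + n.natAbs + 2 + 1)).eq m n (hc _ _ (by omega) (by omega))
    (hc _ _ (by omega) (by omega))
  simp only [CellEq] at e ⊢
  rw [hu (m.natAbs + n.natAbs + 2) (m, n) (by simp only; omega),
    hu (m.natAbs + n.natAbs + 2) (m + 1, n) (by simp only; omega),
    hu (m.natAbs + n.natAbs + 2) (m, n + 1) (by simp only; omega),
    hu (m.natAbs + n.natAbs + 2) (m + 1, n + 1) (by simp only; omega)]
  exact e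

end StripTree

/-! ### Uniqueness of the solution for given data. -/

namespace CellEq

variable {F : Type*} [Field F] {κ : F} {u v : ℤ × ℤ → F} {m n : ℤ}

theorem ne (hκ : κ ≠ 0) (hu : CellEq κ u m n) (hv : CellEq κ v m n) (h0 : u (m, n) = v (m, n))
    (h1 : u (m + 1, n) = v (m + 1, n)) (h2 : u (m, n + 1) = v (m, n + 1)) :
    u (m + 1, n + 1) = v (m + 1, n + 1) := by
  have h := right_ne_zero_of_mul ((show _ = κ from hv).symm ▸ hκ)
  have e := (show _ = κ from hu).trans (show _ = κ from hv).symm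
  rw [h0, h1, h2] at e
  exact sub_left_injective (mul_right_cancel₀ h e)

theorem sw (hκ : κ ≠ 0) (hu : CellEq κ u m n) (hv : CellEq κ v m n)
    (h0 : u (m + 1, n + 1) = v (m + 1, n + 1))
    (h1 : u (m + 1, n) = v (m + 1, n)) (h2 : u (m, n + 1) = v (m, n + 1)) :
    u (m, n) = v (m, n) := by
  have h := right_ne_zero_of_mul ((show _ = κ from hv).symm ▸ hκ)
  have e := (show _ = κ from hu).trans (show _ = κ from hv).symm
  rw [h0, h1, h2] at e
  exact sub_right_injective (mul_right_cancel₀ h e)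

theorem se (hκ : κ ≠ 0) (hu : CellEq κ u m n) (hv : CellEq κ v m n)
    (h0 : u (m, n) = v (m, n))
    (h1 : u (m + 1, n + 1) = v (m + 1, n + 1)) (h2 : u (m, n + 1) = v (m, n + 1)) :
    u (m + 1, n) = v (m + 1, n) := by
  have h := left_ne_zero_of_mul ((show _ = κ from hv).symm ▸ hκ)
  have e := (show _ = κ from hu).trans (show _ = κ from hv).symm
  rw [h0, h1, h2] at e
  exact sub_left_injective (mul_left_cancel₀ h e)

theorem nw (hκ : κ ≠ 0) (hu : CellEq κ u m n) (hv : CellEq κ v m n)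
    (h0 : u (m, n) = v (m, n))
    (h1 : u (m + 1, n + 1) = v (m + 1, n + 1)) (h2 : u (m + 1, n) = v (m + 1, n)) :
    u (m, n + 1) = v (m, n + 1) := by
  have h := left_ne_zero_of_mul ((show _ = κ from hv).symm ▸ hκ)
  have e := (show _ = κ from hu).trans (show _ = κ from hv).symm
  rw [h0, h1, h2] at e
  exact sub_right_injective (mul_left_cancel₀ h e)

end CellEq

namespace StripTree

variable {V : Set (ℤ × ℤ)} {Adj : ℤ × ℤ → ℤ × ℤ → Prop}

/-- Solutions on a lower set containing the graph are determined by their values on the graph. -/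
theorem determined (T : StripTree V Adj) {F : Type*} [Field F] {κ : F} (hκ : κ ≠ 0)
    {u v : ℤ × ℤ → F} {Q : ℤ × ℤ → Prop}
    (hQ : ∀ {a b a' b' : ℤ}, Q (a, b) → a' ≤ a → b' ≤ b → Q (a', b'))
    (hV : ∀ p ∈ V, Q p) {p₀ : ℤ × ℤ} (h₀ : p₀ ∈ V) (hx : ∀ a b : ℤ, a ≤ p₀.1 → Q (a, b))
    (hy : ∀ a b : ℤ, b ≤ p₀.2 → Q (a, b))
    (hu : ∀ m n, Q (m + 1, n + 1) → CellEq κ u m n)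
    (hv : ∀ m n, Q (m + 1, n + 1) → CellEq κ v m n)
    (huv : ∀ p ∈ V, u p = v p) (p : ℤ × ℤ) (hp : Q p) : u p = v p := by
  -- The growing objects are boxes around `p₀` in which the solutions agree on `Q`. Along a new row
  -- or column agreement spreads in both directions from its graph vertex, one cell at a time.
  let σ := { B : LatticeBox // B.Has p₀ ∧ ∀ a b, B.Has (a, b) → Q (a, b) → u (a, b) = v (a, b) }
  have h₁ : (⟨p₀.1, p₀.1, p₀.2, p₀.2⟩ : LatticeBox).Has p₀ := by simp [LatticeBox.Has]
  let s₀ : σ := ⟨⟨p₀.1, p₀.1, p₀.2, p₀.2⟩, h₁, fun a b h _ => by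
    simp only [LatticeBox.Has] at h
    obtain rfl : a = p₀.1 := by omega
    obtain rfl : b = p₀.2 := by omega
    exact huv _ h₀⟩
  suffices step : ∀ (s : σ) (p q : ℤ × ℤ), Adj p q → s.1.Has p → ¬ s.1.Has q →
      ∃ s' : σ, (∀ p, s.1.Has p → s'.1.Has p) ∧ s'.1.Has q by
    obtain ⟨⟨B, hB, hBQ⟩, -, h⟩ := T.exhaust (σ := σ) (fun s => s.1)
      (fun s s' => ∀ p, s.1.Has p → s'.1.Has p) (fun _ _ h => h)
      (fun _ _ _ h h' p hp => h' p (h p hp)) (fun _ _ h => h) step s₀ h₀ h₁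
      (p.1.natAbs + p.2.natAbs)
    exact hBQ _ _ (h p (by omega) (by omega)) hp
  rintro ⟨B, hB, hBQ⟩ p q hpq hp hq
  change B.Has p at hp
  change ¬ B.Has q at hq
  have hB' := hB
  simp only [LatticeBox.Has] at hB' hBQ
  rcases T.leave hpq hp hq with ⟨y, a, b, c, rfl⟩ | ⟨y, a, b, c, rfl⟩ | ⟨y, a, b, c, rfl⟩ |
      ⟨y, a, b, c, rfl⟩
  · have q1 := T.mem (T.symm c)
    have up : ∀ k, y ≤ k → k ≤ B.y₁ → Q (B.x₁ + 1, k) → u (B.x₁ + 1, k) = v (B.x₁ + 1, k) := by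
      refine Int.leInduction (fun _ _ => huv _ q1) (fun k hk ih h hq => ?_)
      exact CellEq.ne hκ (hu _ _ hq) (hv _ _ hq)
        (hBQ _ _ ⟨by omega, by omega, by omega, by omega⟩ (hQ hq (by omega) (by omega)))
        (ih (by omega) (hQ hq (by omega) (by omega)))
        (hBQ _ _ ⟨by omega, by omega, by omega, by omega⟩ (hQ hq (by omega) (by omega)))
    have down : ∀ k, k ≤ y → B.y₀ ≤ k → u (B.x₁ + 1, k) = v (B.x₁ + 1, k) := by
      refine Int.leInductionDown (fun _ => huv _ q1) (fun k hk ih h => ?_)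
      have hq : Q (B.x₁ + 1, k) := hQ (hV _ q1) le_rfl hk
      rw [← sub_add_cancel k 1] at hq ih
      exact CellEq.se hκ (hu _ _ hq) (hv _ _ hq)
        (hBQ _ _ ⟨by omega, by omega, by omega, by omega⟩ (hQ hq (by omega) (by omega)))
        (ih (by omega))
        (hBQ _ _ ⟨by omega, by omega, by omega, by omega⟩ (hQ hq (by omega) (by omega)))
    refine ⟨⟨{ B with x₁ := B.x₁ + 1 }, ?_, fun a' b' h hq => ?_⟩, fun p h => ?_, ?_⟩
    · simp only [LatticeBox.Has]; omega
    · simp only [LatticeBox.Has] at h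
      rcases eq_or_ne a' (B.x₁ + 1) with rfl | ha
      · rcases le_total y b' with hb | hb
        · exact up _ hb (by omega) hq
        · exact down _ hb (by omega)
      · exact hBQ _ _ ⟨by omega, by omega, by omega, by omega⟩ hq
    · simp only [LatticeBox.Has] at h ⊢; omega
    · simp only [LatticeBox.Has]; omega
  · have q1 := T.mem (T.symm c)
    have up : ∀ k, y ≤ k → k ≤ B.y₁ → u (B.x₀ - 1, k) = v (B.x₀ - 1, k) := by
      refine Int.leInduction (fun _ => huv _ q1) (fun k hk ih h => ?_)
      -- The box contains `p₀`, so its left side is in the half-plane covered by `hx`. No condition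
      -- on the height is needed.
      have hq : Q (B.x₀ - 1 + 1, k + 1) := hx _ _ (by omega)
      have e1 : u (B.x₀ - 1 + 1, k + 1) = v (B.x₀ - 1 + 1, k + 1) :=
        hBQ _ _ ⟨by omega, by omega, by omega, by omega⟩ hq
      have e2 : u (B.x₀ - 1 + 1, k) = v (B.x₀ - 1 + 1, k) :=
        hBQ _ _ ⟨by omega, by omega, by omega, by omega⟩ (hx _ _ (by omega))
      exact CellEq.nw hκ (hu _ _ hq) (hv _ _ hq) (ih (by omega)) e1 e2
    have down : ∀ k, k ≤ y → B.y₀ ≤ k → u (B.x₀ - 1, k) = v (B.x₀ - 1, k) := by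
      refine Int.leInductionDown (fun _ => huv _ q1) (fun k hk ih h => ?_)
      rw [← sub_add_cancel k 1] at ih
      have hq : Q (B.x₀ - 1 + 1, k - 1 + 1) := hx _ _ (by omega)
      have e1 : u (B.x₀ - 1 + 1, k - 1 + 1) = v (B.x₀ - 1 + 1, k - 1 + 1) :=
        hBQ _ _ ⟨by omega, by omega, by omega, by omega⟩ hq
      have e2 : u (B.x₀ - 1 + 1, k - 1) = v (B.x₀ - 1 + 1, k - 1) :=
        hBQ _ _ ⟨by omega, by omega, by omega, by omega⟩ (hx _ _ (by omega))
      exact CellEq.sw hκ (hu _ _ hq) (hv _ _ hq) e1 e2 (ih (by omega))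
    refine ⟨⟨{ B with x₀ := B.x₀ - 1 }, ?_, fun a' b' h hq => ?_⟩, fun p h => ?_, ?_⟩
    · simp only [LatticeBox.Has]; omega
    · simp only [LatticeBox.Has] at h
      rcases eq_or_ne a' (B.x₀ - 1) with rfl | ha
      · rcases le_total y b' with hb | hb
        · exact up _ hb (by omega)
        · exact down _ hb (by omega)
      · exact hBQ _ _ ⟨by omega, by omega, by omega, by omega⟩ hq
    · simp only [LatticeBox.Has] at h ⊢; omega
    · simp only [LatticeBox.Has]; omega
  · have q1 := T.mem (T.symm c)
    have up : ∀ k, y ≤ k → k ≤ B.x₁ → Q (k, B.y₁ + 1) → u (k, B.y₁ + 1) = v (k, B.y₁ + 1) := by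
      refine Int.leInduction (fun _ _ => huv _ q1) (fun k hk ih h hq => ?_)
      exact CellEq.ne hκ (hu _ _ hq) (hv _ _ hq)
        (hBQ _ _ ⟨by omega, by omega, by omega, by omega⟩ (hQ hq (by omega) (by omega)))
        (hBQ _ _ ⟨by omega, by omega, by omega, by omega⟩ (hQ hq (by omega) (by omega)))
        (ih (by omega) (hQ hq (by omega) (by omega)))
    have down : ∀ k, k ≤ y → B.x₀ ≤ k → u (k, B.y₁ + 1) = v (k, B.y₁ + 1) := by
      refine Int.leInductionDown (fun _ => huv _ q1) (fun k hk ih h => ?_)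
      have hq : Q (k, B.y₁ + 1) := hQ (hV _ q1) hk le_rfl
      rw [← sub_add_cancel k 1] at hq ih
      exact CellEq.nw hκ (hu _ _ hq) (hv _ _ hq)
        (hBQ _ _ ⟨by omega, by omega, by omega, by omega⟩ (hQ hq (by omega) (by omega)))
        (ih (by omega))
        (hBQ _ _ ⟨by omega, by omega, by omega, by omega⟩ (hQ hq (by omega) (by omega)))
    refine ⟨⟨{ B with y₁ := B.y₁ + 1 }, ?_, fun a' b' h hq => ?_⟩, fun p h => ?_, ?_⟩
    · simp only [LatticeBox.Has]; omega
    · simp only [LatticeBox.Has] at h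
      rcases eq_or_ne b' (B.y₁ + 1) with rfl | hb
      · rcases le_total y a' with ha | ha
        · exact up _ ha (by omega) hq
        · exact down _ ha (by omega)
      · exact hBQ _ _ ⟨by omega, by omega, by omega, by omega⟩ hq
    · simp only [LatticeBox.Has] at h ⊢; omega
    · simp only [LatticeBox.Has]; omega
  · have q1 := T.mem (T.symm c)
    have up : ∀ k, y ≤ k → k ≤ B.x₁ → u (k, B.y₀ - 1) = v (k, B.y₀ - 1) := by
      refine Int.leInduction (fun _ => huv _ q1) (fun k hk ih h => ?_)
      have hq : Q (k + 1, B.y₀ - 1 + 1) := hy _ _ (by omega)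
      have e1 : u (k + 1, B.y₀ - 1 + 1) = v (k + 1, B.y₀ - 1 + 1) :=
        hBQ _ _ ⟨by omega, by omega, by omega, by omega⟩ hq
      have e2 : u (k, B.y₀ - 1 + 1) = v (k, B.y₀ - 1 + 1) :=
        hBQ _ _ ⟨by omega, by omega, by omega, by omega⟩ (hy _ _ (by omega))
      exact CellEq.se hκ (hu _ _ hq) (hv _ _ hq) (ih (by omega)) e1 e2
    have down : ∀ k, k ≤ y → B.x₀ ≤ k → u (k, B.y₀ - 1) = v (k, B.y₀ - 1) := by
      refine Int.leInductionDown (fun _ => huv _ q1) (fun k hk ih h => ?_)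
      rw [← sub_add_cancel k 1] at ih
      have hq : Q (k - 1 + 1, B.y₀ - 1 + 1) := hy _ _ (by omega)
      have e1 : u (k - 1 + 1, B.y₀ - 1 + 1) = v (k - 1 + 1, B.y₀ - 1 + 1) :=
        hBQ _ _ ⟨by omega, by omega, by omega, by omega⟩ hq
      have e2 : u (k - 1, B.y₀ - 1 + 1) = v (k - 1, B.y₀ - 1 + 1) :=
        hBQ _ _ ⟨by omega, by omega, by omega, by omega⟩ (hy _ _ (by omega))
      exact CellEq.sw hκ (hu _ _ hq) (hv _ _ hq) e1 (ih (by omega)) e2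
    refine ⟨⟨{ B with y₀ := B.y₀ - 1 }, ?_, fun a' b' h hq => ?_⟩, fun p h => ?_, ?_⟩
    · simp only [LatticeBox.Has]; omega
    · simp only [LatticeBox.Has] at h
      rcases eq_or_ne b' (B.y₀ - 1) with rfl | hb
      · rcases le_total y a' with ha | ha
        · exact up _ ha (by omega)
        · exact down _ ha (by omega)
      · exact hBQ _ _ ⟨by omega, by omega, by omega, by omega⟩ hq
    · simp only [LatticeBox.Has] at h ⊢; omega
    · simp only [LatticeBox.Has]; omega

end StripTree

/-! ### Bäcklund transformations near the linear solution. -/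

/-- The linear solution `a m + b n` of the dKdV equation with parameters `a ^ 2`, `b ^ 2`. -/
def linearField (a b : ℂ) (p : ℤ × ℤ) : ℂ := a * p.1 + b * p.2

theorem linearField_eq (a b : ℂ) (m n : ℤ) : CellEq (a ^ 2 - b ^ 2) (linearField a b) m n := by
  simp only [CellEq, linearField]; push_cast; ring

theorem algebraMap_fraction_injective (S : Type) :
    Function.Injective (algebraMap ℂ (FractionRing (MvPolynomial S ℂ))) :=
  (algebraMap ℂ _).injective

/-- Each solution on the lattice which is a deformation of the linear one has a Bäcklund
transformation with an arbitrary further parameter. -/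
theorem exists_backlund {S : Type} {w : S → ℂ} {r : ℂ → ℂ}
    (hr : ∀ γ δ, r γ ^ 2 - r δ ^ 2 = γ - δ) {α β δ : ℂ} (hαβ : α ≠ β) (hαδ : α ≠ δ) (hβδ : β ≠ δ)
    {u : ℤ × ℤ → FractionRing (MvPolynomial S ℂ)}
    (hu : ∀ m n, CellEq (algebraMap ℂ _ (α - β)) u m n)
    (hreg : ∀ p, RegularAt w (u p) (linearField (r α) (r β) p)) :
    ∃ y : ℤ × ℤ → FractionRing (MvPolynomial S ℂ),
      (∀ m n, (y (m + 1, n) - u (m, n)) * (u (m + 1, n) - y (m, n)) = algebraMap ℂ _ (α - δ)) ∧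
      (∀ m n, (y (m, n + 1) - u (m, n)) * (u (m, n + 1) - y (m, n)) = algebraMap ℂ _ (β - δ)) ∧
      ∀ p, RegularAt w (y p) (linearField (r α) (r β) p + r δ) := by
  have inj := algebraMap_fraction_injective S
  -- Shifting the linear solution by `r δ` is a Bäcklund transformation of it, since `(r β + r δ) *
  -- (r β - r δ) = β - δ`. This supplies the prescribed values, first on the column over `0`, then
  -- on every row started from that column.
  obtain ⟨c, -, hc, hcr⟩ := exists_chain (w := w) (u := fun k => u (0, k))
    (u₀ := fun k => linearField (r α) (r β) (0, k))
    (y₀ := fun k => linearField (r α) (r β) (0, k) + r δ) (sub_ne_zero.2 hβδ)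
    (fun k => hreg _) (fun k => by
      simp only [linearField]; push_cast; linear_combination hr β δ) 0 (RegularAt.const _)
  have row : ∀ n : ℤ, ∃ z : ℤ → FractionRing (MvPolynomial S ℂ), z 0 = c n ∧
      (∀ k, (z (k + 1) - u (k, n)) * (u (k + 1, n) - z k) = algebraMap ℂ _ (α - δ)) ∧
      ∀ k, RegularAt w (z k) (linearField (r α) (r β) (k, n) + r δ) := by
    intro n
    exact exists_chain (u := fun k => u (k, n))
      (u₀ := fun k => linearField (r α) (r β) (k, n))
      (y₀ := fun k => linearField (r α) (r β) (k, n) + r δ) (sub_ne_zero.2 hαδ)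
      (fun k => hreg _) (fun k => by
        simp only [linearField]; push_cast; linear_combination hr α δ) 0 (hcr n)
  choose z hz0 hz hzr using row
  -- Rows were constructed independently; cube consistency carries the vertical equation from the
  -- column over `0` to the others.
  have up : ∀ n m, (z (n + 1) m - u (m, n)) * (u (m, n + 1) - z n m) =
      algebraMap ℂ _ (β - δ) := by
    intro n m
    induction m using Int.induction_on with
    | zero => rw [hz0, hz0]; exact hc n
    | succ m ih =>
      have hu' := hu m n
      have h1 := hz n m
      have h2 := hz (n + 1) m
      simp only [CellEq, map_sub] at hu' h1 h2 ih ⊢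
      exact (cube_consistency (inj.ne hαβ) (inj.ne hαδ) (inj.ne hβδ) hu' h1 ih h2).1
    | pred m ih =>
      have hu' := hu (-m - 1) n
      have h1 := hz n (-m - 1)
      have h2 := hz (n + 1) (-m - 1)
      simp only [CellEq, map_sub, sub_add_cancel] at hu' h1 h2 ih ⊢
      exact (cube_consistency (inj.ne hαβ) (inj.ne hαδ) (inj.ne hβδ)
        (u := u (-m, n)) (u1 := u (-m - 1, n)) (u2 := u (-m, n + 1)) (u12 := u (-m - 1, n + 1))
        (y := z n (-m)) (y1 := z n (-m - 1)) (y2 := z (n + 1) (-m)) (y12 := z (n + 1) (-m - 1))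
        (by linear_combination hu') (by linear_combination h1) (by linear_combination ih)
        (by linear_combination h2)).1
  exact ⟨fun p => z p.2 p.1, fun m n => hz n m, fun m n => up n m, fun p => hzr p.2 p.1⟩

/-! ### Multidimensional solutions. -/

/-- The unit step in direction `γ`. -/
noncomputable def unitStep (γ : ℂ) : ℂ → ℤ := by
  classical exact Pi.single γ 1

theorem unitStep_same (γ : ℂ) : unitStep γ γ = 1 := by simp [unitStep]

theorem unitStep_ne {γ δ : ℂ} (h : δ ≠ γ) : unitStep γ δ = 0 := by simp [unitStep, h]

/-- A multidimensional solution of the dKdV equations, with lattice directions indexed by their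
parameters; only the directions in `I` are active. It is a deformation of a solution `L` which is
piecewise linear, and has Bäcklund transformations for all parameters not in `I`. -/
structure IsMultiSolution {S : Type} (w : S → ℂ) (r : ℂ → ℂ) (I : Set ℂ)
    (U : (ℂ → ℤ) → FractionRing (MvPolynomial S ℂ)) (L : (ℂ → ℤ) → ℂ) : Prop where
  eq : ∀ γ ∈ I, ∀ δ ∈ I, γ ≠ δ → ∀ p, (U (p + unitStep γ + unitStep δ) - U p) *
    (U (p + unitStep γ) - U (p + unitStep δ)) = algebraMap ℂ _ (γ - δ)
  regular : ∀ p, RegularAt w (U p) (L p)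
  inv : ∀ γ ∉ I, ∀ p, U (p + unitStep γ) = U p
  linv : ∀ γ ∉ I, ∀ p, L (p + unitStep γ) = L p
  lsq : ∀ γ ∈ I, ∀ p, (L (p + unitStep γ) - L p) ^ 2 = r γ ^ 2
  backlund : ∀ δ ∉ I, ∃ y : (ℂ → ℤ) → FractionRing (MvPolynomial S ℂ),
    (∀ γ ∈ I, ∀ p, (y (p + unitStep γ) - U p) * (U (p + unitStep γ) - y p) =
      algebraMap ℂ _ (γ - δ)) ∧
    (∀ p, RegularAt w (y p) (L p + r δ)) ∧ ∀ γ ∉ I, ∀ p, y (p + unitStep γ) = y p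

namespace IsMultiSolution

variable {S : Type} {w : S → ℂ} {r : ℂ → ℂ}

theorem base (hr : ∀ γ δ, r γ ^ 2 - r δ ^ 2 = γ - δ) {α β : ℂ} (hαβ : α ≠ β)
    {u : ℤ × ℤ → FractionRing (MvPolynomial S ℂ)}
    (hu : ∀ m n, CellEq (algebraMap ℂ _ (α - β)) u m n)
    (hreg : ∀ p, RegularAt w (u p) (linearField (r α) (r β) p)) :
    IsMultiSolution w r {α, β} (fun p => u (p α, p β))
      (fun p => linearField (r α) (r β) (p α, p β)) where
  eq := by
    rintro γ (rfl | rfl) δ (rfl | rfl) h p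
    · exact absurd rfl h
    · simpa [CellEq, unitStep_same, unitStep_ne h, unitStep_ne h.symm] using hu (p γ) (p δ)
    · have := hu (p δ) (p γ)
      simp only [CellEq, map_sub] at this
      simp [unitStep_same, unitStep_ne h, unitStep_ne h.symm]
      linear_combination -this
    · exact absurd rfl h
  regular p := hreg _
  inv γ hγ p := by
    simp only [Set.mem_insert_iff, Set.mem_singleton_iff, not_or] at hγ
    simp [unitStep_ne (Ne.symm hγ.1), unitStep_ne (Ne.symm hγ.2)]
  linv γ hγ p := by
    simp only [Set.mem_insert_iff, Set.mem_singleton_iff, not_or] at hγ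
    simp [unitStep_ne (Ne.symm hγ.1), unitStep_ne (Ne.symm hγ.2)]
  lsq := by
    rintro γ (rfl | rfl) p
    · simp [unitStep_same, unitStep_ne hαβ.symm, linearField]; ring
    · simp [unitStep_same, unitStep_ne hαβ, linearField]; ring
  backlund δ hδ := by
    simp only [Set.mem_insert_iff, Set.mem_singleton_iff, not_or] at hδ
    obtain ⟨y, h1, h2, h3⟩ := exists_backlund hr hαβ (Ne.symm hδ.1) (Ne.symm hδ.2) hu hreg
    refine ⟨fun p => y (p α, p β), ?_, fun p => h3 _, fun γ hγ p => ?_⟩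
    · rintro γ (rfl | rfl) p
      · simpa [unitStep_same, unitStep_ne hαβ.symm] using h1 (p γ) (p β)
      · simpa [unitStep_same, unitStep_ne hαβ] using h2 (p α) (p γ)
    · simp only [Set.mem_insert_iff, Set.mem_singleton_iff, not_or] at hγ
      simp [unitStep_ne (Ne.symm hγ.1), unitStep_ne (Ne.symm hγ.2)]

/-- The Bäcklund relation is symmetric in the two fields, so the new direction can be given period
2: even layers carry `U`, odd layers its transform `y` with parameter `γ`. The Bäcklund property for
a further parameter `δ` survives by nonlinear superposition of `y` with the `δ`-transform `z` of
`U`. -/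
theorem exists_insert (hr : ∀ γ δ, r γ ^ 2 - r δ ^ 2 = γ - δ) {I : Set ℂ}
    {U : (ℂ → ℤ) → FractionRing (MvPolynomial S ℂ)} {L : (ℂ → ℤ) → ℂ}
    (h : IsMultiSolution w r I U L) {γ : ℂ} (hγ : γ ∉ I) :
    ∃ U' L', IsMultiSolution w r (insert γ I) U' L' ∧ ∀ p, p γ = 0 → U' p = U p := by
  classical
  have inj := algebraMap_fraction_injective S
  obtain ⟨y, hy, hyr, hyi⟩ := h.backlund γ hγ
  have same : ∀ p : ℂ → ℤ, Even ((p + unitStep γ) γ) ↔ ¬ Even (p γ) := fun p => by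
    simp [unitStep_same]
  have other : ∀ (p : ℂ → ℤ) δ, δ ≠ γ → (p + unitStep δ) γ = p γ := fun p δ hδ => by
    simp [unitStep_ne hδ.symm]
  have nI : ∀ i ∈ I, i ≠ γ := fun i hi e => hγ (e ▸ hi)
  have comm : ∀ (p : ℂ → ℤ) i j, p + unitStep i + unitStep j = p + unitStep j + unitStep i :=
    fun p i j => add_right_comm _ _ _
  -- the Bäcklund transform is itself a solution
  have yeq : ∀ i ∈ I, ∀ j ∈ I, i ≠ j → ∀ p, (y (p + unitStep i + unitStep j) - y p) *
      (y (p + unitStep i) - y (p + unitStep j)) = algebraMap ℂ _ (i - j) := by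
    intro i hi j hj hij p
    have e := h.eq i hi j hj hij p
    have e1 := hy i hi p
    have e2 := hy j hj p
    have e3 := hy i hi (p + unitStep j)
    rw [comm p j i] at e3
    simp only [map_sub] at e e1 e2 e3 ⊢
    exact (cube_consistency (inj.ne hij) (inj.ne (nI i hi)) (inj.ne (nI j hj)) e e1 e2 e3).2
  refine ⟨fun p => if Even (p γ) then U p else y p,
    fun p => if Even (p γ) then L p else L p + r γ, ?_, fun p hp => by simp [hp]⟩
  constructor
  · rintro i (rfl | hi) j (rfl | hj) hij p
    · exact absurd rfl hij
    · have e := hy j hj p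
      have o := other (p + unitStep i) j (nI j hj)
      have o' := other p j (nI j hj)
      simp only [o, o', same, map_sub] at e ⊢
      by_cases hp : Even (p i)
      · simp only [hp, not_true, if_true, if_false]
        rw [comm, hyi i hγ, hyi i hγ]
        linear_combination -e
      · simp only [hp, not_false_iff, if_true, if_false]
        rw [comm, h.inv i hγ, h.inv i hγ]
        linear_combination -e
    · have e := hy i hi p
      have o := other p i (nI i hi)
      have s := same (p + unitStep i)
      simp only [o, s, same, map_sub] at e ⊢
      by_cases hp : Even (p j)
      · simp only [hp, not_true, if_true, if_false]
        rw [hyi j hγ, hyi j hγ]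
        linear_combination e
      · simp only [hp, not_false_iff, if_true, if_false]
        rw [h.inv j hγ, h.inv j hγ]
        linear_combination e
    · have o := other p i (nI i hi)
      have o1 := other p j (nI j hj)
      have o2 := other (p + unitStep i) j (nI j hj)
      simp only [o, o1, o2]
      by_cases hp : Even (p γ)
      · simpa only [hp, if_true] using h.eq i hi j hj hij p
      · simpa only [hp, if_false] using yeq i hi j hj hij p
  · intro p
    by_cases hp : Even (p γ)
    · simpa only [hp, if_true] using h.regular p
    · simpa only [hp, if_false] using hyr p
  · intro i hi p
    simp only [Set.mem_insert_iff, not_or] at hi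
    simp only [other p i hi.1, h.inv i hi.2, hyi i hi.2]
  · intro i hi p
    simp only [Set.mem_insert_iff, not_or] at hi
    simp only [other p i hi.1, h.linv i hi.2]
  · rintro i (rfl | hi) p
    · simp only [same, h.linv i hγ]
      by_cases hp : Even (p i) <;> simp [hp]
    · simp only [other p i (nI i hi)]
      rw [← h.lsq i hi p]
      split_ifs <;> ring
  · intro δ hδ
    simp only [Set.mem_insert_iff, not_or] at hδ
    obtain ⟨hδγ, hδ⟩ := hδ
    obtain ⟨z, hz, hzr, hzi⟩ := h.backlund δ hδ
    -- The squares of the two roots differ by `γ - δ ≠ 0`. Hence `y - z` never vanishes, and the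
    -- superposition `t` has value `L p + r γ + r δ`, because `(γ - δ) / (r γ - r δ) = r γ + r δ`.
    have nr : r γ - r δ ≠ 0 := fun e => sub_ne_zero.2 (Ne.symm hδγ)
      ((hr γ δ).symm.trans (by rw [sub_eq_zero.1 e, sub_self]))
    have hyz : ∀ p, RegularAt w (y p - z p) (r γ - r δ) := fun p => by
      simpa using (hyr p).sub (hzr p)
    have nyz : ∀ p, y p - z p ≠ 0 := fun p => (hyz p).ne_zero nr
    let t : (ℂ → ℤ) → FractionRing (MvPolynomial S ℂ) :=
      fun p => U p + algebraMap ℂ _ (γ - δ) / (y p - z p)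
    have ht : ∀ p, (t p - U p) * (y p - z p) = algebraMap ℂ _ (γ - δ) := fun p => by
      have := nyz p
      simp only [t]; field_simp; ring
    have hti : ∀ i ∉ I, ∀ p, t (p + unitStep i) = t p := fun i hi p => by
      simp only [t, h.inv i hi, hyi i hi, hzi i hi]
    have htr : ∀ p, RegularAt w (t p) (L p + r γ + r δ) := fun p => by
      have := (h.regular p).add ((RegularAt.const (γ - δ)).div (hyz p) nr)
      convert this using 1
      rw [← hr γ δ]; field_simp; ring
    refine ⟨fun p => if Even (p γ) then z p else t p, ?_, ?_, ?_⟩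
    · rintro i (rfl | hi) p
      · have e := ht p
        simp only [same, map_sub] at e ⊢
        by_cases hp : Even (p i)
        · simp only [hp, not_true, if_true, if_false, hti i hγ, hyi i hγ]
          exact e
        · simp only [hp, not_false_iff, if_true, if_false, hzi i hγ, h.inv i hγ]
          linear_combination e
      · simp only [other p i (nI i hi)]
        by_cases hp : Even (p γ)
        · simpa only [hp, if_true] using hz i hi p
        · simp only [hp, if_false]
          have e1 := hy i hi p
          have e2 := hz i hi p
          have e3 := ht p
          have e4 := ht (p + unitStep i)
          simp only [map_sub] at e1 e2 e3 e4 ⊢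
          have hiδ : i ≠ δ := fun e => hδ (e ▸ hi)
          -- The cube with directions `γ`, `i`, `δ` at `U p`; its conclusion says that `t` is a
          -- `δ`-transform of `y` along `i`.
          exact (cube_consistency (a := algebraMap ℂ (FractionRing (MvPolynomial S ℂ)) γ)
            (b := algebraMap ℂ _ i) (d := algebraMap ℂ _ δ)
            (u := U p) (u1 := y p) (u2 := U (p + unitStep i)) (u12 := y (p + unitStep i))
            (y := z p) (y1 := t p) (y2 := z (p + unitStep i)) (y12 := t (p + unitStep i))
            (inj.ne (Ne.symm (nI i hi))) (inj.ne (Ne.symm hδγ)) (inj.ne hiδ)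
            (by linear_combination -e1) (by linear_combination e3) (by linear_combination e2)
            (by linear_combination e4)).1
    · intro p
      by_cases hp : Even (p γ)
      · simpa only [hp, if_true] using hzr p
      · simpa only [hp, if_false] using htr p
    · intro i hi p
      simp only [Set.mem_insert_iff, not_or] at hi
      simp only [other p i hi.1, hzi i hi.2, hti i hi.2]

/-- A lattice solution which is a deformation of the linear one extends to any finite number of
further lattice directions. -/
theorem exists_of_finite (hr : ∀ γ δ, r γ ^ 2 - r δ ^ 2 = γ - δ) {α β : ℂ} (hαβ : α ≠ β)
    {u : ℤ × ℤ → FractionRing (MvPolynomial S ℂ)}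
    (hu : ∀ m n, CellEq (algebraMap ℂ _ (α - β)) u m n)
    (hreg : ∀ p, RegularAt w (u p) (linearField (r α) (r β) p)) (J : Finset ℂ) :
    ∃ (I : Set ℂ) (U : (ℂ → ℤ) → FractionRing (MvPolynomial S ℂ)) (L : (ℂ → ℤ) → ℂ),
      (∀ γ ∈ J, γ ∈ I) ∧ {α, β} ⊆ I ∧ IsMultiSolution w r I U L ∧
      ∀ p, (∀ γ, γ ≠ α → γ ≠ β → p γ = 0) → U p = u (p α, p β) := by
  classical
  induction J using Finset.induction_on with
  | empty => exact ⟨_, _, _, by simp, le_rfl, base hr hαβ hu hreg, fun p _ => rfl⟩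
  | insert γ J _ ih =>
    obtain ⟨I, U, L, hJ, hI, h, hU⟩ := ih
    by_cases hγ : γ ∈ I
    · refine ⟨I, U, L, fun δ hδ => ?_, hI, h, hU⟩
      rcases Finset.mem_insert.1 hδ with rfl | hδ
      exacts [hγ, hJ _ hδ]
    · obtain ⟨U', L', h', hU'⟩ := h.exists_insert hr hγ
      refine ⟨_, U', L', fun δ hδ => ?_, hI.trans (Set.subset_insert _ _), h', fun p hp => ?_⟩
      · rcases Finset.mem_insert.1 hδ with rfl | hδ
        exacts [Set.mem_insert _ _, Set.mem_insert_of_mem _ (hJ _ hδ)]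
      · rw [hU' p (hp γ (fun e => hγ (hI (by simp [e]))) (fun e => hγ (hI (by simp [e])))), hU p hp]

end IsMultiSolution

/-! ### Paths, potentials and strips on a quad-surface. -/

namespace QuadSurface

variable {R : Rect} (G : QuadSurface R)

theorem finish_glue (d : G.Dart) : G.finish (G.glue d) = G.start d := by
  rw [finish, G.glue_glue]

theorem start_glue (d : G.Dart) : G.start (G.glue d) = G.finish d := rfl

theorem finish_side (f : G.Face) (k : Fin 4) :
    G.finish (Sum.inl (f, k)) = G.corner f (k + 1) :=
  Quot.sound ⟨f, k, rfl, rfl⟩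

variable {G}

theorem IsPath.append {x y z : G.Vertex} {p q : List G.Dart} (hp : G.IsPath x y p)
    (hq : G.IsPath y z q) : G.IsPath x z (p ++ q) := by
  induction p generalizing x with
  | nil => obtain rfl : x = y := hp; exact hq
  | cons d p ih => exact ⟨hp.1, ih hp.2⟩

theorem isPath_singleton (d : G.Dart) : G.IsPath (G.start d) (G.finish d) [d] := ⟨rfl, rfl⟩

theorem IsPath.reverse {x y : G.Vertex} {p : List G.Dart} (hp : G.IsPath x y p) :
    G.IsPath y x (p.map G.glue).reverse := by
  induction p generalizing x with
  | nil => exact Eq.symm hp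
  | cons d p ih =>
    simp only [List.map_cons, List.reverse_cons]
    refine (ih hp.2).append ⟨rfl, ?_⟩
    rw [finish_glue]; exact hp.1

/-- The two hypotheses say that `θ` sums to zero over a backtracking and over the boundary of a
face, which are the elementary moves. -/
theorem sum_eq_of_homotopic {A : Type*} [AddCommGroup A] {θ : G.Dart → A}
    (hglue : ∀ d, θ (G.glue d) = -θ d)
    (hface : ∀ f, θ (Sum.inl (f, 0)) + θ (Sum.inl (f, 1)) + θ (Sum.inl (f, 2)) +
      θ (Sum.inl (f, 3)) = 0) {x y : G.Vertex} {l l' : List G.Dart}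
    (h : G.Homotopic x y l l') : (l.map θ).sum = (l'.map θ).sum := by
  induction h with
  | rel l l' h =>
    obtain ⟨-, -, h⟩ := h
    cases h with
    | backtrack p q d => simp [hglue]
    | face p q f =>
      have := hface f
      simp only [List.map_append, List.sum_append, List.map_cons, List.map_nil, List.sum_cons,
        List.sum_nil, add_zero, ← add_assoc] at this ⊢
      simp only [add_assoc] at this ⊢
      simp only [← add_assoc] at this ⊢
      rw [show (List.map θ p).sum + θ (Sum.inl (f, 0)) + θ (Sum.inl (f, 1)) + θ (Sum.inl (f, 2)) +
        θ (Sum.inl (f, 3)) = (List.map θ p).sum + (θ (Sum.inl (f, 0)) + θ (Sum.inl (f, 1)) +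
        θ (Sum.inl (f, 2)) + θ (Sum.inl (f, 3))) by abel, this, add_zero]
  | refl => rfl
  | symm _ _ _ ih => exact ih.symm
  | trans _ _ _ _ _ ih ih' => exact ih.trans ih'

/-- On a simply connected surface each cocycle is a coboundary. -/
theorem exists_potential {A : Type*} [AddCommGroup A] (hG : G.SimplyConnected) {θ : G.Dart → A}
    (hglue : ∀ d, θ (G.glue d) = -θ d)
    (hface : ∀ f, θ (Sum.inl (f, 0)) + θ (Sum.inl (f, 1)) + θ (Sum.inl (f, 2)) +
      θ (Sum.inl (f, 3)) = 0) (x₀ : G.Vertex) :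
    ∃ φ : G.Vertex → A, φ x₀ = 0 ∧ ∀ d, φ (G.finish d) = φ (G.start d) + θ d := by
  have loop : ∀ x l, G.IsPath x x l → (l.map θ).sum = 0 := fun x l hl => by
    simpa using sum_eq_of_homotopic hglue hface (hG.2 x l hl)
  have rev : ∀ l : List G.Dart, ((l.map G.glue).reverse.map θ).sum = -(l.map θ).sum := by
    intro l
    rw [← List.map_reverse, List.map_map, List.map_reverse, List.sum_reverse]
    induction l with
    | nil => simp
    | cons d l ih => simp [hglue, ih, add_comm]
  choose path hpath using hG.1 x₀
  have key : ∀ x l, G.IsPath x₀ x l → (l.map θ).sum = ((path x).map θ).sum := fun x l hl => by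
    have := loop _ _ (hl.append (hpath x).reverse)
    rw [List.map_append, List.sum_append, rev, add_neg_eq_zero] at this
    exact this
  refine ⟨fun x => ((path x).map θ).sum, (key x₀ [] rfl).symm, fun d => ?_⟩
  have := key _ _ ((hpath (G.start d)).append (isPath_singleton d))
  simpa using this.symm

variable (G)

/-- Passing to the opposite side of a face. -/
def opp : G.Dart → G.Dart
  | Sum.inl (f, k) => Sum.inl (f, k + 2)
  | Sum.inr s => Sum.inr s

theorem opp_opp (d : G.Dart) : G.opp (G.opp d) = d := by
  rcases d with ⟨f, k⟩ | s
  · simp only [opp, add_assoc]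
    congr 2
    exact (congrArg (k + ·) (by decide : (2 + 2 : Fin 4) = 0)).trans (add_zero k)
  · rfl

variable {G}

/-- A strip has at most two ends on the boundary. -/
theorem end_unique {s t t' : R.Side} (h : G.SameStrip (Sum.inr s) (Sum.inr t))
    (h' : G.SameStrip (Sum.inr s) (Sum.inr t')) (ht : t ≠ s) (ht' : t' ≠ s) : t = t' := by
  let op : Equiv.Perm G.Dart := ⟨G.opp, G.opp, G.opp_opp, G.opp_opp⟩
  let gl : Equiv.Perm G.Dart := ⟨G.glue, G.glue, G.glue_glue, G.glue_glue⟩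
  have op2 : op⁻¹ = op := rfl
  have gl2 : gl⁻¹ = gl := rfl
  -- The involutions `gl` and `op` generate a dihedral group whose orbits are the strips. As `op`
  -- fixes the boundary dart `x`, the strip of `x` is its orbit under the powers of `τ` alone, and
  -- `op` acts on it by `n ↦ -n`.
  let τ := gl * op
  let x : G.Dart := Sum.inr s
  have conj : ∀ n : ℤ, op * τ ^ n = τ ^ (-n) * op := by
    intro n
    have h1 : op * τ * op⁻¹ = τ⁻¹ := by
      simp only [τ, mul_inv_rev, op2, gl2, ← mul_assoc]
      rw [mul_assoc, show op * op = 1 from Equiv.ext G.opp_opp, mul_one]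
    have h2 := conj_zpow (a := op) (b := τ) (i := n)
    rw [h1, inv_zpow, ← zpow_neg] at h2
    rw [h2, inv_mul_cancel_right]
  have hop : ∀ n : ℤ, G.opp ((τ ^ n) x) = (τ ^ (-n)) x := fun n =>
    congrArg (fun e : Equiv.Perm G.Dart => e x) (conj n)
  have hgl : ∀ n : ℤ, G.glue ((τ ^ n) x) = (τ ^ (1 - n)) x := by
    intro n
    have e : G.glue ((τ ^ n) x) = τ (G.opp ((τ ^ n) x)) := by
      change _ = G.glue (G.opp (G.opp _))
      rw [G.opp_opp]
    rw [e, hop, sub_eq_add_neg, zpow_add, zpow_one]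
    rfl
  have orbit : ∀ d d', G.SameStrip d d' → ((∃ n : ℤ, d = (τ ^ n) x) ↔ ∃ n : ℤ, d' = (τ ^ n) x) := by
    intro d d' h
    induction h with
    | rel d d' h =>
      rcases h with rfl | ⟨f, k, rfl, rfl⟩
      · constructor
        · rintro ⟨n, rfl⟩; exact ⟨_, hgl n⟩
        · rintro ⟨n, hn⟩
          exact ⟨1 - n, by rw [← hgl, ← hn, G.glue_glue]⟩
      · constructor
        · rintro ⟨n, hn⟩; exact ⟨-n, by rw [← hop, ← hn]; rfl⟩
        · rintro ⟨n, hn⟩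
          refine ⟨-n, ?_⟩
          rw [← hop, ← hn]
          exact (G.opp_opp (Sum.inl (f, k))).symm
    | refl => exact Iff.rfl
    | symm _ _ _ ih => exact ih.symm
    | trans _ _ _ _ _ ih ih' => exact ih.trans ih'
  obtain ⟨n, hn⟩ := (orbit _ _ h).1 ⟨0, rfl⟩
  obtain ⟨k, hk⟩ := (orbit _ _ h').1 ⟨0, rfl⟩
  have period : ∀ j : ℤ, (τ ^ j) x = x ↔ (MulAction.period τ x : ℤ) ∣ j := fun j =>
    MulAction.zpow_smul_eq_iff_period_dvd (G := Equiv.Perm G.Dart) (g := τ) (a := x)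
  -- A boundary dart is fixed by `op`, so `τ ^ j` and `τ ^ (-j)` agree on `x`. Thus `j` is a
  -- half-period, and it is not a period when `t ≠ s`.
  have two : ∀ (j : ℤ) (t : R.Side), (Sum.inr t : G.Dart) = (τ ^ j) x → t ≠ s →
      (MulAction.period τ x : ℤ) ∣ 2 * j ∧ ¬ (MulAction.period τ x : ℤ) ∣ j := by
    intro j t ht hts
    constructor
    · rw [← period]
      have h1 := hop j
      rw [← ht] at h1
      change Sum.inr t = _ at h1
      rw [two_mul, zpow_add, Equiv.Perm.mul_apply, ← ht, h1, ← Equiv.Perm.mul_apply, ← zpow_add,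
        add_neg_cancel, zpow_zero, Equiv.Perm.one_apply]
    · rw [← period, ← ht]
      exact fun e => hts (Sum.inr_injective e)
  obtain ⟨⟨a, ha⟩, hn'⟩ := two n t hn ht
  obtain ⟨⟨b, hb⟩, hk'⟩ := two k t' hk ht'
  -- Twice `n` and twice `k` are odd multiples of the period, so the two half-periods differ by a
  -- whole period.
  have hdvd : (MulAction.period τ x : ℤ) ∣ n - k := by
    rcases Int.even_or_odd a with ⟨a', rfl⟩ | ⟨a', rfl⟩
    · exact absurd ⟨a', by linarith⟩ hn'
    rcases Int.even_or_odd b with ⟨b', rfl⟩ | ⟨b', rfl⟩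
    · exact absurd ⟨b', by linarith⟩ hk'
    exact ⟨a' - b', by linarith⟩
  have e := (period _).2 hdvd
  have : (τ ^ n) x = (τ ^ k) x := by
    rw [← add_sub_cancel k n, zpow_add, Equiv.Perm.mul_apply, e]
  rw [← hn, ← hk] at this
  exact Sum.inr_injective this

variable (G)

/-- Belonging to the same strip as an equivalence relation. -/
def stripSetoid : Setoid G.Dart := ⟨G.SameStrip, Relation.EqvGen.is_equivalence _⟩

/-- The strips of the surface. -/
def Strip : Type := Quotient G.stripSetoid

/-- The strip crossing a dart. -/
def strip (d : G.Dart) : G.Strip := Quotient.mk G.stripSetoid d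

theorem strip_eq {d d' : G.Dart} : G.strip d = G.strip d' ↔ G.SameStrip d d' := Quotient.eq

theorem strip_glue (d : G.Dart) : G.strip (G.glue d) = G.strip d :=
  G.strip_eq.2 (.symm _ _ (.rel _ _ (.inl rfl)))

theorem strip_opp (f : G.Face) (k : Fin 4) :
    G.strip (Sum.inl (f, k + 2)) = G.strip (Sum.inl (f, k)) :=
  G.strip_eq.2 (.symm _ _ (.rel _ _ (.inr ⟨f, k, rfl, rfl⟩)))

theorem finite_side : Finite R.Side := by
  let e : (Fin R.M ⊕ Fin R.N) ⊕ (Fin R.M ⊕ Fin R.N) → R.Side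
    | .inl (.inl i) => .bottom i
    | .inl (.inr j) => .right j
    | .inr (.inl i) => .top i
    | .inr (.inr j) => .left j
  refine Finite.of_surjective e ?_
  rintro (i | j | i | j)
  exacts [⟨.inl (.inl i), rfl⟩, ⟨.inl (.inr j), rfl⟩, ⟨.inr (.inl i), rfl⟩, ⟨.inr (.inr j), rfl⟩]

theorem finite_dart : Finite G.Dart := by
  have := G.finite_face
  have := finite_side (R := R)
  infer_instance

theorem finite_strip : Finite G.Strip := by
  have := G.finite_dart
  exact Quotient.finite _

end QuadSurface

/-! ### From sets of strips to lattice positions. -/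

section Height

variable {ι : Type} [Fintype ι]

open Classical in
/-- The number of indices in the support of `ε`, sorted by their parameters. -/
noncomputable def height (c : ι → ℂ) (ε : ι → ZMod 2) (γ : ℂ) : ℤ :=
  ∑ i, if c i = γ then ((ε i).val : ℤ) else 0

theorem height_zero (c : ι → ℂ) : height c 0 = 0 := by
  ext γ; simp [height]

open Classical in
theorem height_add_single (c : ι → ℂ) (ε : ι → ZMod 2) (i : ι) :
    height c (ε + Pi.single i 1) =
      height c ε + (if ε i = 0 then (1 : ℤ) else -1) • unitStep (c i) := by
  ext γ
  rw [Pi.add_apply, ← sub_eq_iff_eq_add', height, height, ← Finset.sum_sub_distrib,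
    Finset.sum_eq_single i]
  · have : ∀ z : ZMod 2, ((z + 1).val : ℤ) - z.val = if z = 0 then 1 else -1 := by decide
    by_cases h : c i = γ
    · simp only [h, if_true, Pi.add_apply, Pi.single_eq_same, Pi.smul_apply, unitStep_same, this,
        smul_eq_mul, mul_one]
    · simp [h, unitStep_ne (Ne.symm h)]
  · intro j _ hj
    simp [hj]
  · simp

open Classical in
-- Each step flips a bit that is still `0`, hence raises the height, because the strips crossed are
-- distinct and fresh. The second conclusion, that other bits stay unchanged, drives the induction
-- and shows that the next side also starts with fresh strips.
theorem height_walk (c : ι → ℂ) (γ : ℂ) {n : ℕ} (τ : Fin n → ι) (hτ : Function.Injective τ)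
    (hc : ∀ k, c (τ k) = γ) (ε : ℕ → ι → ZMod 2)
    (hε : ∀ k : Fin n, ε (k + 1) = ε k + Pi.single (τ k) 1) (h0 : ∀ k, ε 0 (τ k) = 0) (k : ℕ)
    (hk : k ≤ n) :
    height c (ε k) = height c (ε 0) + (k : ℤ) • unitStep γ ∧
      ∀ σ, (∀ i : Fin n, (i : ℕ) < k → σ ≠ τ i) → ε k σ = ε 0 σ := by
  induction k with
  | zero => simp
  | succ k ih =>
    obtain ⟨ih1, ih2⟩ := ih (by omega)
    have e := hε ⟨k, by omega⟩
    simp only at e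
    constructor
    · rw [e, height_add_single, ih1, hc, ih2 _ fun i hi e' => ?_, h0]
      · push_cast
        simp [add_smul, add_assoc]
      · have := hτ e'
        rw [← this] at hi
        exact lt_irrefl _ hi
    · intro σ hσ
      rw [e, Pi.add_apply, Pi.single_eq_of_ne (hσ ⟨k, by omega⟩ (by simp)), add_zero]
      exact ih2 σ fun i hi => hσ i (by omega)

end Height

/-- The equation on a lattice square does not depend on the corner taken as base. All sign patterns
are needed because crossing a strip may lower the height. -/
theorem IsMultiSolution.face {S : Type} {w : S → ℂ} {r : ℂ → ℂ} {I : Set ℂ}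
    {U : (ℂ → ℤ) → FractionRing (MvPolynomial S ℂ)} {L : (ℂ → ℤ) → ℂ}
    (h : IsMultiSolution w r I U L) {γ δ : ℂ} (hγ : γ ∈ I) (hδ : δ ∈ I) (hγδ : γ ≠ δ)
    (p : ℂ → ℤ) {s t : ℤ} (hs : s = 1 ∨ s = -1) (ht : t = 1 ∨ t = -1) :
    (U (p + s • unitStep γ + t • unitStep δ) - U p) *
      (U (p + s • unitStep γ) - U (p + t • unitStep δ)) = algebraMap ℂ _ (γ - δ) := by
  rcases hs with rfl | rfl <;> rcases ht with rfl | rfl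
  · simpa using h.eq γ hγ δ hδ hγδ p
  · have := h.eq γ hγ δ hδ hγδ (p - unitStep δ)
    simp only [one_smul, neg_smul, ← sub_eq_add_neg]
    rw [show p - unitStep δ + unitStep γ + unitStep δ = p + unitStep γ by abel,
      show p - unitStep δ + unitStep δ = p by abel,
      show p - unitStep δ + unitStep γ = p + unitStep γ - unitStep δ by abel] at this
    linear_combination this
  · have := h.eq γ hγ δ hδ hγδ (p - unitStep γ)
    simp only [one_smul, neg_smul, ← sub_eq_add_neg]
    rw [show p - unitStep γ + unitStep γ = p by abel] at this
    linear_combination this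
  · have := h.eq γ hγ δ hδ hγδ (p - unitStep γ - unitStep δ)
    simp only [neg_smul, one_smul, ← sub_eq_add_neg]
    rw [show p - unitStep γ - unitStep δ + unitStep γ + unitStep δ = p by abel,
      show p - unitStep γ - unitStep δ + unitStep δ = p - unitStep γ by abel,
      show p - unitStep γ - unitStep δ + unitStep γ = p - unitStep δ by abel] at this
    linear_combination this

/-! ### Mapping a weak defect into the multidimensional lattice. -/

namespace Rect

variable {R : Rect}

theorem Side.exists_src (s : R.Side) : ∃ t : R.Side, s.tgt = t.src := by
  have hM := R.M_pos
  have hN := R.N_pos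
  rcases s with ⟨i, hi⟩ | ⟨j, hj⟩ | ⟨i, hi⟩ | ⟨j, hj⟩
  · by_cases h : i + 1 < R.M
    · exact ⟨.bottom ⟨i + 1, h⟩, by simp [src, tgt]; ring⟩
    · exact ⟨.right ⟨0, hN⟩, by simp [src, tgt]; omega⟩
  · by_cases h : j + 1 < R.N
    · exact ⟨.right ⟨j + 1, h⟩, by simp [src, tgt]; ring⟩
    · exact ⟨.top ⟨R.M - 1, by omega⟩, by simp [src, tgt]; omega⟩
  · rcases i with _ | i
    · exact ⟨.left ⟨R.N - 1, by omega⟩, by simp [src, tgt]; omega⟩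
    · exact ⟨.top ⟨i, by omega⟩, by simp [src, tgt]; ring⟩
  · rcases j with _ | j
    · exact ⟨.bottom ⟨0, hM⟩, by simp [src, tgt]⟩
    · exact ⟨.left ⟨j, by omega⟩, by simp [src, tgt]; ring⟩

theorem Side.exists_tgt (t : R.Side) : ∃ s : R.Side, s.tgt = t.src := by
  have hM := R.M_pos
  have hN := R.N_pos
  rcases t with ⟨i, hi⟩ | ⟨j, hj⟩ | ⟨i, hi⟩ | ⟨j, hj⟩
  · rcases i with _ | i
    · exact ⟨.left ⟨0, hN⟩, by simp [src, tgt]⟩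
    · exact ⟨.bottom ⟨i, by omega⟩, by simp [src, tgt]; ring⟩
  · rcases j with _ | j
    · exact ⟨.bottom ⟨R.M - 1, by omega⟩, by simp [src, tgt]; omega⟩
    · exact ⟨.right ⟨j, by omega⟩, by simp [src, tgt]; ring⟩
  · by_cases h : i + 1 < R.M
    · exact ⟨.top ⟨i + 1, h⟩, by simp [src, tgt]; ring⟩
    · exact ⟨.right ⟨R.N - 1, by omega⟩, by simp [src, tgt]; omega⟩
  · by_cases h : j + 1 < R.N
    · exact ⟨.left ⟨j + 1, h⟩, by simp [src, tgt]; ring⟩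
    · exact ⟨.top ⟨0, hM⟩, by simp [src, tgt]; omega⟩

end Rect

namespace Defect

variable {R : Rect} (D : Defect R)

/-- The boundary vertices of a defect are indexed by the lattice points on the boundary of the
rectangle. -/
theorem exists_boundary_vertex : ∃ b : ℤ × ℤ → D.Vertex, ∀ s : R.Side,
    D.start (Sum.inr s) = b s.tgt ∧ D.finish (Sum.inr s) = b s.src := by
  classical
  let b : ℤ × ℤ → D.Vertex := fun p =>
    if h : ∃ s : R.Side, s.tgt = p then D.start (Sum.inr h.choose)
    else D.start (Sum.inr (.bottom ⟨0, R.M_pos⟩))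
  have h1 : ∀ s : R.Side, D.start (Sum.inr s) = b s.tgt := by
    intro s
    have hs : ∃ s' : R.Side, s'.tgt = s.tgt := ⟨s, rfl⟩
    obtain ⟨t, ht⟩ := s.exists_src
    simp only [b, dif_pos hs]
    exact ((D.boundary s t).2 ht).trans ((D.boundary _ t).2 (hs.choose_spec.trans ht)).symm
  refine ⟨b, fun s => ⟨h1 s, ?_⟩⟩
  obtain ⟨t, ht⟩ := s.exists_tgt
  rw [← ht, ← h1 t]
  exact ((D.boundary t s).2 ht).symm

variable {D}

/-- Different boundary edges of the same side belong to different strips of a weak defect. -/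
theorem IsWeak.strip_ne (hD : D.IsWeak) {s s' : R.Side} (hs : s ≠ s')
    (h : ∀ t, s.Opposite t → t ≠ s ∧ t ≠ s') :
    D.strip (Sum.inr s) ≠ D.strip (Sum.inr s') := by
  intro e
  obtain ⟨t, ht, hst⟩ := hD s
  exact (h t ht).2 (QuadSurface.end_unique hst (D.strip_eq.1 e) (h t ht).1 hs.symm)

/-- The parameter as a function on strips. -/
theorem IsParameter.exists_strip {α β : ℂ} {c : D.Dart → ℂ} (hc : D.IsParameter α β c) :
    ∃ cs : D.Strip → ℂ, ∀ d, cs (D.strip d) = c d := by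
  have h : ∀ d d', D.SameStrip d d' → c d = c d' := by
    intro d d' h
    induction h with
    | rel d d' h =>
      rcases h with rfl | ⟨f, k, rfl, rfl⟩
      · exact (hc.glue d).symm
      · exact (hc.opposite f k).symm
    | refl => rfl
    | symm _ _ _ ih => exact ih.symm
    | trans _ _ _ _ _ ih ih' => exact ih.trans ih'
  exact ⟨Quotient.lift c h, fun d => rfl⟩

open Classical in
/-- Labelling of the vertices of a weak defect by subsets of the set of strips. -/
theorem exists_labelling (D : Defect R) (b : ℤ × ℤ → D.Vertex)
    (hb : ∀ s : R.Side, D.start (Sum.inr s) = b s.tgt ∧ D.finish (Sum.inr s) = b s.src) :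
    ∃ φ : D.Vertex → D.Strip → ZMod 2, φ (b (R.a, R.b)) = 0 ∧
      (∀ d, φ (D.finish d) = φ (D.start d) + Pi.single (D.strip d) 1) ∧
      ∀ s : R.Side, φ (b s.src) = φ (b s.tgt) + Pi.single (D.strip (Sum.inr s)) 1 := by
  have two : ∀ z : D.Strip → ZMod 2, z + z = 0 := fun z => by
    ext i; exact CharTwo.add_self_eq_zero _
  -- The cocycle is the basis vector of the strip crossed. Opposite sides of a face lie on the same
  -- strip, so it cancels around a face modulo 2, and the direction of a dart plays no role.
  obtain ⟨φ, h0, h⟩ := QuadSurface.exists_potential D.simplyConnected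
    (θ := fun d => (Pi.single (D.strip d) 1 : D.Strip → ZMod 2))
    (fun d => by rw [D.strip_glue, eq_neg_iff_add_eq_zero]; exact two _)
    (fun f => by
      have h2 := D.strip_opp f 0
      have h3 := D.strip_opp f 1
      rw [show (0 + 2 : Fin 4) = 2 by rfl] at h2
      rw [show (1 + 2 : Fin 4) = 3 by rfl] at h3
      simp only [h2, h3]
      rw [add_assoc, add_add_add_comm, two, two, add_zero]) (b (R.a, R.b))
  exact ⟨φ, h0, h, fun s => by rw [← (hb s).1, ← (hb s).2]; exact h _⟩

open Classical in
/-- The heights of the boundary vertices are their lattice coordinates. -/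
theorem IsWeak.height_boundary [Fintype D.Strip] (hD : D.IsWeak) {α β : ℂ} (hαβ : α ≠ β)
    {c : D.Dart → ℂ} (hc : D.IsParameter α β c) {cs : D.Strip → ℂ}
    (hcs : ∀ d, cs (D.strip d) = c d) {b : ℤ × ℤ → D.Vertex} {φ : D.Vertex → D.Strip → ZMod 2}
    (h0 : φ (b (R.a, R.b)) = 0)
    (h : ∀ s : R.Side, φ (b s.src) = φ (b s.tgt) + Pi.single (D.strip (Sum.inr s)) 1)
    (s : R.Side) :
    height cs (φ (b s.tgt)) = (s.tgt.1 - R.a) • unitStep α + (s.tgt.2 - R.b) • unitStep β := by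
  have two : ∀ z : D.Strip → ZMod 2, z + z = 0 := fun z => by
    ext i; exact CharTwo.add_self_eq_zero _
  have h' : ∀ s : R.Side, φ (b s.tgt) = φ (b s.src) + Pi.single (D.strip (Sum.inr s)) 1 :=
    fun s => by rw [h s, add_assoc, two, add_zero]
  -- The corner `(R.a, R.b)` is joined to the boundary points in two ways: along bottom and right,
  -- and along left and top. On each side the strips are distinct by weakness.
  have hbottom := height_walk cs α (n := R.M) (fun k => D.strip (Sum.inr (.bottom k)))
    (fun k k' e => by
      by_contra hk
      refine hD.strip_ne (s := .bottom k) (s' := .bottom k') (fun e => hk (by cases e; rfl))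
        (fun t ht => ⟨?_, ?_⟩) e <;> (rintro rfl; exact ht))
    (fun k => (hcs _).trans (hc.bottom k)) (fun k => φ (b (R.a + k, R.b)))
    (fun k => by
      have := h' (.bottom k)
      simp only [Rect.Side.tgt, Rect.Side.src] at this
      push_cast
      rw [← add_assoc]; exact this)
    (fun k => by simp [h0])
  have hright := height_walk cs β (n := R.N) (fun k => D.strip (Sum.inr (.right k)))
    (fun k k' e => by
      by_contra hk
      refine hD.strip_ne (s := .right k) (s' := .right k') (fun e => hk (by cases e; rfl))
        (fun t ht => ⟨?_, ?_⟩) e <;> (rintro rfl; exact ht))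
    (fun k => (hcs _).trans (hc.right k)) (fun k => φ (b (R.a + R.M, R.b + k)))
    (fun k => by
      have := h' (.right k)
      simp only [Rect.Side.tgt, Rect.Side.src] at this
      push_cast
      rw [← add_assoc]; exact this)
    (fun k => by
      -- The strips of the right side carry `β ≠ α`, so none of them was crossed on the bottom and
      -- their bits are still `0` at this corner.
      have := (hbottom R.M le_rfl).2 (D.strip (Sum.inr (.right k))) (fun i _ e => hαβ ?_)
      · simpa [h0] using this
      · rw [← hc.bottom i, ← hc.right k, ← hcs, ← hcs, e])
  have hleft := height_walk cs β (n := R.N) (fun k => D.strip (Sum.inr (.left k)))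
    (fun k k' e => by
      by_contra hk
      refine hD.strip_ne (s := .left k) (s' := .left k') (fun e => hk (by cases e; rfl))
        (fun t ht => ⟨?_, ?_⟩) e <;> (rintro rfl; exact ht))
    (fun k => (hcs _).trans (hc.left k)) (fun k => φ (b (R.a, R.b + k)))
    (fun k => by
      have := h (.left k)
      simp only [Rect.Side.tgt, Rect.Side.src] at this
      push_cast
      rw [← add_assoc]; exact this)
    (fun k => by simp [h0])
  have htop := height_walk cs α (n := R.M) (fun k => D.strip (Sum.inr (.top k)))
    (fun k k' e => by
      by_contra hk
      refine hD.strip_ne (s := .top k) (s' := .top k') (fun e => hk (by cases e; rfl))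
        (fun t ht => ⟨?_, ?_⟩) e <;> (rintro rfl; exact ht))
    (fun k => (hcs _).trans (hc.top k)) (fun k => φ (b (R.a + k, R.b + R.N)))
    (fun k => by
      have := h (.top k)
      simp only [Rect.Side.tgt, Rect.Side.src] at this
      push_cast
      rw [← add_assoc]; exact this)
    (fun k => by
      have := (hleft R.N le_rfl).2 (D.strip (Sum.inr (.top k))) (fun i _ e => hαβ ?_)
      · simpa [h0] using this
      · rw [← hc.left i, ← hc.top k, ← hcs, ← hcs, e])
  rcases s with i | j | i | j
  · have := (hbottom (i + 1) (by omega)).1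
    simp only [Nat.cast_zero, add_zero, h0, height_zero, zero_add] at this
    push_cast at this
    simp only [Rect.Side.tgt]
    rw [add_assoc, this]; simp
  · have e := (hbottom R.M le_rfl).1
    have := (hright (j + 1) (by omega)).1
    simp only [Nat.cast_zero, add_zero, h0, height_zero, zero_add] at this e
    rw [e] at this
    push_cast at this
    simp only [Rect.Side.tgt]
    rw [add_assoc R.b, this]; simp
  · have e := (hleft R.N le_rfl).1
    have := (htop i (by omega)).1
    simp only [Nat.cast_zero, add_zero, h0, height_zero, zero_add] at this e
    rw [e] at this
    simp only [Rect.Side.tgt]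
    rw [this]; simp [add_comm]
  · have := (hleft j (by omega)).1
    simp only [Nat.cast_zero, add_zero, h0, height_zero, zero_add] at this
    simp only [Rect.Side.tgt]
    rw [this]; simp

open Classical in
/-- A lattice solution which is a deformation of the linear one extends to a solution on a weak
defect. -/
theorem IsWeak.exists_field (hD : D.IsWeak) {α β : ℂ} (hαβ : α ≠ β) {c : D.Dart → ℂ}
    (hc : D.IsParameter α β c) {S : Type} {w : S → ℂ} {r : ℂ → ℂ}
    (hr : ∀ γ δ, r γ ^ 2 - r δ ^ 2 = γ - δ) {u : ℤ × ℤ → FractionRing (MvPolynomial S ℂ)}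
    (hu : ∀ m n, CellEq (algebraMap ℂ _ (α - β)) u m n)
    (hreg : ∀ p, RegularAt w (u p) (linearField (r α) (r β) p)) :
    ∃ h : D.Vertex → FractionRing (MvPolynomial S ℂ),
      (∀ f : D.Face, (h (D.corner f 2) - h (D.corner f 0)) * (h (D.corner f 1) - h (D.corner f 3)) =
        algebraMap ℂ _ (c (Sum.inl (f, 0)) - c (Sum.inl (f, 1)))) ∧
      ∀ s : R.Side, h (D.start (Sum.inr s)) = u s.tgt := by
  have := D.finite_strip
  have := D.finite_dart
  have := Fintype.ofFinite D.Strip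
  have := Fintype.ofFinite D.Dart
  obtain ⟨b, hb⟩ := D.exists_boundary_vertex
  obtain ⟨φ, h0, hφ, hφb⟩ := D.exists_labelling b hb
  obtain ⟨cs, hcs⟩ := hc.exists_strip
  obtain ⟨I, U, L, hJ, hI, hU, hUu⟩ :=
    IsMultiSolution.exists_of_finite hr hαβ hu hreg (Finset.univ.image c)
  have hcI : ∀ d, c d ∈ I := fun d => hJ _ (Finset.mem_image_of_mem _ (Finset.mem_univ _))
  -- The position of the corner with label `0`; heights are measured from there.
  let q : ℂ → ℤ := R.a • unitStep α + R.b • unitStep β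
  refine ⟨fun x => U (q + height cs (φ x)), fun f => ?_, fun s => ?_⟩
  · have two : ∀ z : D.Strip → ZMod 2, z + z = 0 := fun z => by
      ext i; exact CharTwo.add_self_eq_zero _
    have h1 := hφ (Sum.inl (f, 0))
    have h2 := hφ (Sum.inl (f, 1))
    have h3 := hφ (Sum.inl (f, 3))
    have s3 := D.strip_opp f 1
    rw [show (1 + 2 : Fin 4) = 3 by rfl] at s3
    rw [D.finish_side, s3] at h3
    rw [D.finish_side] at h1 h2
    change φ (D.corner f 1) = φ (D.corner f 0) + _ at h1
    change φ (D.corner f 2) = φ (D.corner f 1) + _ at h2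
    change φ (D.corner f 0) = φ (D.corner f 3) + _ at h3
    replace h3 : φ (D.corner f 3) = φ (D.corner f 0) + Pi.single (D.strip (Sum.inl (f, 1))) 1 := by
      rw [h3, add_assoc, two, add_zero]
    rw [← hcs, ← hcs]
    have i0 : cs (D.strip (Sum.inl (f, 0))) ∈ I := by rw [hcs]; exact hcI _
    have i1 : cs (D.strip (Sum.inl (f, 1))) ∈ I := by rw [hcs]; exact hcI _
    generalize D.strip (Sum.inl (f, 0)) = i at *
    generalize D.strip (Sum.inl (f, 1)) = j at *
    beta_reduce
    rw [h2, h3, h1]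
    -- If a strip crosses the face in both directions, corners 1 and 3 have the same label and both
    -- sides of the equation vanish.
    by_cases hij : i = j
    · subst hij; simp
    simp only [height_add_single, Pi.add_apply, Pi.single_eq_of_ne (Ne.symm hij), add_zero,
      ← add_assoc]
    have sgn : ∀ z : ZMod 2, (if z = 0 then (1 : ℤ) else -1) = 1 ∨
        (if z = 0 then (1 : ℤ) else -1) = -1 := by decide
    -- Two strips with the same parameter: the right hand side is zero, and so is the left. Equal
    -- signs identify the positions of corners 1 and 3, opposite signs those of corners 0 and 2.
    by_cases hcij : cs i = cs j
    · rw [hcij, sub_self, map_zero, mul_eq_zero, sub_eq_zero, sub_eq_zero]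
      rcases sgn (φ (D.corner f 0) i) with e | e <;> rcases sgn (φ (D.corner f 0) j) with e' | e'
      · right; rw [e, e']
      · left; rw [e, e']; congr 1; simp [add_assoc]
      · left; rw [e, e']; congr 1; simp [add_assoc]
      · right; rw [e, e']
    · exact hU.face i0 i1 hcij _ (sgn _) (sgn _)
  · simp only [(hb s).1]
    rw [hD.height_boundary hαβ hc hcs h0 hφb s, hUu]
    · simp [q, unitStep_same, unitStep_ne hαβ, unitStep_ne hαβ.symm]
    · intro γ h1 h2
      simp [q, unitStep_ne h1, unitStep_ne h2]

end Defect

/-! ### Zero curvature representation and proportional matrices. -/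

open Polynomial in
/-- The zero curvature representation of the dKdV equation. -/
noncomputable def lax (x y γ : ℂ) : Matrix (Fin 2) (Fin 2) ℂ[X] :=
  !![-C x, C (x * y + γ) - X; -1, C y]

open Polynomial in
-- Traversing an edge back and forth gives a scalar polynomial, not the identity; this is why
-- transition matrices are compared only up to `Proportional`.
theorem lax_mul_rev (x y γ : ℂ) : lax y x γ * lax x y γ = (X - C γ) • 1 := by
  refine Matrix.ext fun i j => ?_
  fin_cases i <;> fin_cases j <;> simp [lax, Matrix.mul_apply, Fin.sum_univ_two] <;> ring

open Polynomial in
theorem det_lax (x y γ : ℂ) : (lax x y γ).det = C γ - X := by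
  simp [lax, Matrix.det_fin_two]; ring

open Polynomial in
theorem lax_face {x x1 x2 x12 γ δ : ℂ} (h : (x12 - x) * (x1 - x2) = γ - δ) :
    lax x1 x12 δ * lax x x1 γ = lax x2 x12 γ * lax x x2 δ := by
  have h' : (C x12 - C x) * (C x1 - C x2) = C γ - C δ := by
    rw [← C_sub, ← C_sub, ← C_mul, h, C_sub]
  refine Matrix.ext fun i j => ?_
  fin_cases i <;> fin_cases j <;> simp [lax, Matrix.mul_apply, Fin.sum_univ_two]
  · linear_combination -h'
  · linear_combination (C x1 + C x2) * h'
  · linear_combination h'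

/-- Proportionality of polynomial matrices. -/
def Proportional (A B : Matrix (Fin 2) (Fin 2) (Polynomial ℂ)) : Prop :=
  ∃ r s : Polynomial ℂ, r ≠ 0 ∧ s ≠ 0 ∧ r • A = s • B

namespace Proportional

variable {A B D : Matrix (Fin 2) (Fin 2) (Polynomial ℂ)}

theorem refl (A : Matrix (Fin 2) (Fin 2) (Polynomial ℂ)) : Proportional A A :=
  ⟨1, 1, one_ne_zero, one_ne_zero, rfl⟩

theorem symm (h : Proportional A B) : Proportional B A := by
  obtain ⟨r, s, hr, hs, h⟩ := h
  exact ⟨s, r, hs, hr, h.symm⟩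

theorem trans (h : Proportional A B) (h' : Proportional B D) : Proportional A D := by
  obtain ⟨r, s, hr, hs, h⟩ := h
  obtain ⟨r', s', hr', hs', h'⟩ := h'
  exact ⟨r' * r, s * s', mul_ne_zero hr' hr, mul_ne_zero hs hs', by
    rw [mul_smul, h, smul_comm, h', mul_smul]⟩

theorem mul_left (h : Proportional A B) (K : Matrix (Fin 2) (Fin 2) (Polynomial ℂ)) :
    Proportional (K * A) (K * B) := by
  obtain ⟨r, s, hr, hs, h⟩ := h
  exact ⟨r, s, hr, hs, by rw [← Matrix.mul_smul, h, Matrix.mul_smul]⟩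

theorem mul_right (h : Proportional A B) (K : Matrix (Fin 2) (Fin 2) (Polynomial ℂ)) :
    Proportional (A * K) (B * K) := by
  obtain ⟨r, s, hr, hs, h⟩ := h
  exact ⟨r, s, hr, hs, by rw [← Matrix.smul_mul, h, Matrix.smul_mul]⟩

theorem smul_self {r : Polynomial ℂ} (hr : r ≠ 0)
    (A : Matrix (Fin 2) (Fin 2) (Polynomial ℂ)) : Proportional (r • A) A :=
  ⟨1, r, one_ne_zero, hr, one_smul _ _⟩

theorem cancel_left {K : Matrix (Fin 2) (Fin 2) (Polynomial ℂ)} (hK : K.det ≠ 0)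
    (h : Proportional (K * A) (K * B)) : Proportional A B := by
  have := h.mul_left K.adjugate
  simp only [← mul_assoc, Matrix.adjugate_mul, Matrix.smul_mul, one_mul] at this
  exact (smul_self hK A).symm.trans (this.trans (smul_self hK B))

theorem cancel_right {K : Matrix (Fin 2) (Fin 2) (Polynomial ℂ)} (hK : K.det ≠ 0)
    (h : Proportional (A * K) (B * K)) : Proportional A B := by
  have := h.mul_right K.adjugate
  simp only [mul_assoc, Matrix.mul_adjugate, Matrix.mul_smul, mul_one] at this
  exact (smul_self hK A).symm.trans (this.trans (smul_self hK B))

/-- Conjugation by `B`: the base point of a closed path can be moved along the path. -/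
theorem rotate (hB : B.det ≠ 0) (h : Proportional (A * B) 1) : Proportional (B * A) 1 := by
  refine cancel_right hB ?_
  have := h.mul_left B
  rw [← mul_assoc, mul_one] at this
  rwa [one_mul]

/-- Proportional matrices with the same determinant agree up to sign. -/
theorem eq_or_neg (h : Proportional A B) (hd : A.det = B.det) (h0 : A.det ≠ 0) :
    A = B ∨ A = -B := by
  obtain ⟨r, s, hr, hs, h⟩ := h
  have e := congrArg Matrix.det h
  rw [Matrix.det_smul, Matrix.det_smul, ← hd] at e
  have e' : r ^ 2 = s ^ 2 := by simpa using mul_right_cancel₀ h0 e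
  have inj := smul_right_injective (Matrix (Fin 2) (Fin 2) (Polynomial ℂ)) hr
  rcases sq_eq_sq_iff_eq_or_eq_neg.1 e' with rfl | rfl
  · exact .inl (inj h)
  · refine .inr (smul_right_injective (Matrix (Fin 2) (Fin 2) (Polynomial ℂ)) hs ?_)
    simp only [neg_smul, smul_neg] at h ⊢
    rw [← h, neg_neg]

end Proportional

/-! ### Transition matrices along a side and their factorization. -/

/-- The transition matrix along a sequence of edges with the same parameter. -/
noncomputable def chainLax (f : ℕ → ℂ) (γ : ℂ) : ℕ → Matrix (Fin 2) (Fin 2) (Polynomial ℂ)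
  | 0 => 1
  | n + 1 => lax (f n) (f (n + 1)) γ * chainLax f γ n

theorem chainLax_succ (f : ℕ → ℂ) (γ : ℂ) (n : ℕ) :
    chainLax f γ (n + 1) = chainLax (fun k => f (k + 1)) γ n * lax (f 0) (f 1) γ := by
  induction n with
  | zero => simp [chainLax]
  | succ n ih =>
    rw [chainLax, ih, ← mul_assoc]
    rfl

theorem chainLax_congr {f g : ℕ → ℂ} (γ : ℂ) {n : ℕ} (h : ∀ k ≤ n, f k = g k) :
    chainLax f γ n = chainLax g γ n := by
  induction n with
  | zero => rfl
  | succ n ih =>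
    rw [chainLax, chainLax, ih fun k hk => h k (by omega), h n (by omega), h (n + 1) le_rfl]

open Polynomial in
theorem det_chainLax (f : ℕ → ℂ) (γ : ℂ) (n : ℕ) : (chainLax f γ n).det = (C γ - X) ^ n := by
  induction n with
  | zero => simp [chainLax]
  | succ n ih => rw [chainLax, Matrix.det_mul, ih, det_lax, pow_succ']

open Polynomial in
theorem C_sub_X_ne_zero (γ : ℂ) : (C γ - X : ℂ[X]) ≠ 0 := by
  rw [← neg_ne_zero, neg_sub]; exact X_sub_C_ne_zero γ

theorem det_chainLax_ne_zero (f : ℕ → ℂ) (γ : ℂ) (n : ℕ) : (chainLax f γ n).det ≠ 0 := by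
  rw [det_chainLax]; exact pow_ne_zero _ (C_sub_X_ne_zero γ)

section Factorization

open Polynomial Matrix

/-- Evaluation of a polynomial matrix. -/
noncomputable def evalMatrix (μ : ℂ) :
    Matrix (Fin 2) (Fin 2) ℂ[X] →+* Matrix (Fin 2) (Fin 2) ℂ :=
  (evalRingHom μ).mapMatrix

/-- At its own spectral parameter the matrix has rank one: it is the column `(x, 1)` times the row
`(-1, y)`. It maps `(g, 1)` to `(y - g)` times `(x, 1)`, so it reveals the values at the ends of the
edge. -/
theorem evalMatrix_lax (x y γ : ℂ) : evalMatrix γ (lax x y γ) = !![-x, x * y; -1, y] := by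
  ext i j
  fin_cases i <;> fin_cases j <;> simp [evalMatrix, lax]

theorem det_evalMatrix (μ : ℂ) (A : Matrix (Fin 2) (Fin 2) ℂ[X]) :
    (evalMatrix μ A).det = A.det.eval μ :=
  ((evalRingHom μ).map_det A).symm

/-- After the edge from `f i` to `f (i + 1)` the vector is a multiple of `(f i, 1)`, and the kernel
of the next factor is spanned by `(f (i + 2), 1)`. Nothing is annihilated when second neighbours
differ. -/
theorem evalMatrix_chainLax_mulVec_ne_zero (γ : ℂ) {n : ℕ} {f : ℕ → ℂ} {g : ℂ}
    (hg : 1 ≤ n → g ≠ f 1) (hf : ∀ i, i + 2 ≤ n → f i ≠ f (i + 2)) :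
    evalMatrix γ (chainLax f γ n) *ᵥ ![g, 1] ≠ 0 := by
  induction n generalizing f g with
  | zero =>
    intro h
    have := congrFun h 1
    simp [chainLax] at this
  | succ n ih =>
    have e : evalMatrix γ (lax (f 0) (f 1) γ) *ᵥ ![g, 1] = (f 1 - g) • ![f 0, 1] := by
      rw [evalMatrix_lax]
      ext i
      fin_cases i <;> simp [mulVec, dotProduct, Fin.sum_univ_two] <;> ring
    rw [chainLax_succ, map_mul, ← mulVec_mulVec, e, mulVec_smul]
    refine smul_ne_zero (sub_ne_zero.2 (hg (by omega)).symm) ?_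
    exact ih (fun h => hf 0 (by omega)) (fun i hi => hf (i + 1) (by omega))

/-- Uniqueness of the factorization of the transition matrix along a generic sequence. -/
theorem chainLax_unique {B B' : Matrix (Fin 2) (Fin 2) ℂ[X]} {γ : ℂ} (hB : B.det.eval γ ≠ 0)
    {n : ℕ} {f f' : ℕ → ℂ} (h0 : f 0 = f' 0) (hf : ∀ i, i + 2 ≤ n → f i ≠ f (i + 2))
    (h : B * chainLax f γ n = B' * chainLax f' γ n) : (∀ i ≤ n, f i = f' i) ∧ B = B' := by
  induction n generalizing f f' with
  | zero =>
    refine ⟨fun i hi => ?_, by simpa [chainLax] using h⟩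
    obtain rfl : i = 0 := by omega
    exact h0
  | succ n ih =>
    rw [chainLax_succ, chainLax_succ, ← mul_assoc, ← mul_assoc] at h
    set A := B * chainLax (fun k => f (k + 1)) γ n with hA
    set A' := B' * chainLax (fun k => f' (k + 1)) γ n with hA'
    -- At `γ` the two columns of the product are `-W` and `y • W`, with `W` the image of `(x, 1)`.
    -- When `W ≠ 0` their ratio recovers `y`; only the sequence `f` has to be generic for this.
    have key : ∀ (A : Matrix (Fin 2) (Fin 2) ℂ[X]) (x y : ℂ),
        evalMatrix γ (A * lax x y γ) *ᵥ ![1, 0] = -(evalMatrix γ A *ᵥ ![x, 1]) ∧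
        evalMatrix γ (A * lax x y γ) *ᵥ ![0, 1] = y • (evalMatrix γ A *ᵥ ![x, 1]) := by
      intro A x y
      rw [map_mul, ← mulVec_mulVec, ← mulVec_mulVec, evalMatrix_lax, ← mulVec_neg, ← mulVec_smul]
      constructor <;> congr 1 <;> ext i <;> fin_cases i <;>
        simp [mulVec, dotProduct, Fin.sum_univ_two, mul_comm]
    have e1 := (key A (f 0) (f 1)).1
    have e2 := (key A (f 0) (f 1)).2
    rw [h, (key A' (f' 0) (f' 1)).1, neg_inj, ← h0] at e1
    rw [h, (key A' (f' 0) (f' 1)).2, ← h0, e1] at e2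
    have hW : evalMatrix γ A *ᵥ ![f 0, 1] ≠ 0 := by
      rw [hA, map_mul, ← mulVec_mulVec]
      intro hz
      refine evalMatrix_chainLax_mulVec_ne_zero γ (n := n) (f := fun k => f (k + 1)) (g := f 0)
        (fun hn => hf 0 (by omega)) (fun i hi => hf (i + 1) (by omega)) ?_
      exact eq_zero_of_mulVec_eq_zero (by rwa [det_evalMatrix]) hz
    have h1 : f 1 = f' 1 := (smul_left_injective ℂ hW e2).symm
    have hcancel : A = A' := by
      rw [← h0, ← h1] at h
      have := congrArg (· * (lax (f 0) (f 1) γ).adjugate) h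
      simp only [mul_assoc, mul_adjugate, Matrix.mul_smul, mul_one, det_lax] at this
      exact smul_right_injective _ (C_sub_X_ne_zero γ) this
    obtain ⟨i1, i2⟩ := ih (f := fun k => f (k + 1)) (f' := fun k => f' (k + 1)) h1
      (fun i hi => hf (i + 1) (by omega)) hcancel
    refine ⟨fun i hi => ?_, i2⟩
    rcases i with _ | i
    · exact h0
    · exact i1 i (by omega)

/-- The values along two consecutive sequences of edges with different parameters are determined
by the transition matrix up to proportionality. -/
theorem chainLax_mul_unique {γ δ : ℂ} (hγδ : γ ≠ δ) {m n : ℕ} {p p' q q' : ℕ → ℂ}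
    {K K' : Matrix (Fin 2) (Fin 2) ℂ[X]} (hK : K.det ≠ 0) (hK' : K'.det ≠ 0)
    (h0 : p 0 = p' 0) (hq : q 0 = p n) (hq' : q' 0 = p' n)
    (hp2 : ∀ i, i + 2 ≤ n → p i ≠ p (i + 2)) (hq2 : ∀ i, i + 2 ≤ m → q i ≠ q (i + 2))
    (h : Proportional (K * (chainLax q γ m * chainLax p δ n) * K') 1)
    (h' : Proportional (K * (chainLax q' γ m * chainLax p' δ n) * K') 1) :
    (∀ i ≤ n, p i = p' i) ∧ ∀ i ≤ m, q i = q' i := by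
  have e := ((h.trans h'.symm).cancel_right hK').cancel_left hK
  have hd : (chainLax q γ m).det.eval δ ≠ 0 := by
    rw [det_chainLax, eval_pow, eval_sub, eval_C, eval_X]
    exact pow_ne_zero _ (sub_ne_zero.2 hγδ)
  -- The determinants agree, so the proportionality factor is a sign, which is absorbed into the
  -- left factor. Evaluation at `δ` determines the right factor, since the left one is invertible
  -- there; the left one is then treated at `γ`.
  have sgn : ∃ ε : ℂ[X], (ε = 1 ∨ ε = -1) ∧
      chainLax q γ m * chainLax p δ n = (ε • chainLax q' γ m) * chainLax p' δ n := by
    rcases e.eq_or_neg (by simp only [det_mul, det_chainLax])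
      (by rw [det_mul]; exact mul_ne_zero (det_chainLax_ne_zero _ _ _) (det_chainLax_ne_zero _ _ _))
      with e | e
    · exact ⟨1, .inl rfl, by rw [one_smul, e]⟩
    · exact ⟨-1, .inr rfl, by rw [neg_smul, one_smul, neg_mul, e]⟩
  obtain ⟨ε, -, hε⟩ := sgn
  obtain ⟨r1, r2⟩ := chainLax_unique hd h0 hp2 hε
  refine ⟨r1, (chainLax_unique (B := 1) (B' := ε • 1) (γ := γ) (by simp) ?_ hq2 ?_).1⟩
  · rw [hq, hq', r1 n le_rfl]
  · rw [one_mul, Matrix.smul_mul, one_mul, r2]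

end Factorization

/-! ### Monodromy around the defect. -/

namespace QuadSurface

variable {R : Rect} {G : QuadSurface R}

/-- The transition matrix along an edge path. -/
noncomputable def monodromy (h : G.Vertex → ℂ) (c : G.Dart → ℂ) :
    List G.Dart → Matrix (Fin 2) (Fin 2) (Polynomial ℂ)
  | [] => 1
  | d :: l => monodromy h c l * lax (h (G.start d)) (h (G.finish d)) (c d)

theorem monodromy_append (h : G.Vertex → ℂ) (c : G.Dart → ℂ) (p q : List G.Dart) :
    monodromy h c (p ++ q) = monodromy h c q * monodromy h c p := by
  induction p with
  | nil => simp [monodromy]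
  | cons d p ih => simp [monodromy, ih, mul_assoc]

open Polynomial in
/-- The monodromy of a solution along a closed path is trivial. -/
theorem monodromy_closed (hG : G.SimplyConnected) {h : G.Vertex → ℂ} {c : G.Dart → ℂ}
    (hglue : ∀ d, c (G.glue d) = c d)
    (hopp : ∀ (f : G.Face) (k : Fin 4), c (Sum.inl (f, k + 2)) = c (Sum.inl (f, k)))
    (hface : ∀ f, (h (G.corner f 2) - h (G.corner f 0)) * (h (G.corner f 1) - h (G.corner f 3)) =
      c (Sum.inl (f, 0)) - c (Sum.inl (f, 1))) {x : G.Vertex} {l : List G.Dart}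
    (hl : G.IsPath x x l) : Proportional (monodromy h c l) 1 := by
  suffices H : ∀ l l', G.Homotopic x x l l' →
      Proportional (monodromy h c l) (monodromy h c l') from H l [] (hG.2 x l hl)
  have core : ∀ (p q l : List G.Dart), Proportional (monodromy h c l) 1 →
      Proportional (monodromy h c (p ++ l ++ q)) (monodromy h c (p ++ q)) := by
    intro p q l hl
    simp only [monodromy_append]
    simpa using (hl.mul_right (monodromy h c p)).mul_left (monodromy h c q)
  intro l l' hll
  induction hll with
  | rel l l' hm =>
    obtain ⟨-, -, hm⟩ := hm
    cases hm with
    | backtrack p q d =>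
      refine core p q _ ?_
      simp only [monodromy, one_mul, G.start_glue, G.finish_glue, hglue, lax_mul_rev]
      exact Proportional.smul_self (X_sub_C_ne_zero _) _
    | face p q f =>
      refine core p q _ ?_
      have h2 := hopp f 0
      have h3 := hopp f 1
      rw [show (0 + 2 : Fin 4) = 2 by rfl] at h2
      rw [show (1 + 2 : Fin 4) = 3 by rfl] at h3
      have e0 : G.finish (Sum.inl (f, 0)) = G.corner f 1 := G.finish_side f 0
      have e1 : G.finish (Sum.inl (f, 1)) = G.corner f 2 := G.finish_side f 1
      have e2 : G.finish (Sum.inl (f, 2)) = G.corner f 3 := G.finish_side f 2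
      have e3 : G.finish (Sum.inl (f, 3)) = G.corner f 0 := G.finish_side f 3
      have s : ∀ k, G.start (Sum.inl (f, k)) = G.corner f k := fun k => rfl
      simp only [monodromy, one_mul, e0, e1, e2, e3, s, h2, h3]
      -- Replacing the path through corner 1 by the path through corner 3 turns the boundary of the
      -- face into two nested backtrackings.
      rw [mul_assoc _ (lax _ _ _) (lax _ _ _), lax_face (hface f), mul_assoc,
        ← mul_assoc _ (lax (h (G.corner f 3)) _ _), lax_mul_rev, Matrix.smul_mul, one_mul,
        Matrix.mul_smul, lax_mul_rev]
      exact (Proportional.smul_self (X_sub_C_ne_zero _) _).trans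
        (Proportional.smul_self (X_sub_C_ne_zero _) _)
  | refl => exact Proportional.refl _
  | symm _ _ _ ih => exact ih.symm
  | trans _ _ _ _ _ ih ih' => exact ih.trans ih'

theorem exists_path (h : G.Vertex → ℂ) (c : G.Dart → ℂ) {γ : ℂ} {xs : ℕ → G.Vertex} {n : ℕ}
    (H : ∀ i < n, ∃ d, G.start d = xs i ∧ G.finish d = xs (i + 1) ∧ c d = γ) :
    ∃ l, G.IsPath (xs 0) (xs n) l ∧ monodromy h c l = chainLax (fun k => h (xs k)) γ n := by
  induction n with
  | zero => exact ⟨[], rfl, rfl⟩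
  | succ n ih =>
    obtain ⟨l, hl, hm⟩ := ih fun i hi => H i (by omega)
    obtain ⟨d, h1, h2, h3⟩ := H n (by omega)
    refine ⟨l ++ [d], hl.append ⟨h1, h2⟩, ?_⟩
    rw [monodromy_append, hm, chainLax]
    simp [monodromy, h1, h2, h3]

end QuadSurface

/-- The transition matrix along the boundary of a rectangle, traversed counterclockwise. -/
def Rect.HasTrivialMonodromy (R : Rect) (α β : ℂ) (v : ℤ × ℤ → ℂ) : Prop :=
  Proportional
    (chainLax (fun k => v (R.a, R.b + R.N - k)) β R.N *
      (chainLax (fun k => v (R.a + R.M - k, R.b + R.N)) α R.M *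
        (chainLax (fun k => v (R.a + R.M, R.b + k)) β R.N *
          chainLax (fun k => v (R.a + k, R.b)) α R.M))) 1

/-- The boundary of the rectangle is a closed path on a simply connected surface. The conclusion
involves only boundary values and the parameters `α`, `β`, so it can be compared between solutions
with unrelated interior values. -/
theorem Defect.hasTrivialMonodromy {R : Rect} (D : Defect R) {α β : ℂ} {c : D.Dart → ℂ}
    (hc : D.IsParameter α β c) {v : ℤ × ℤ → ℂ} {h : D.Vertex → ℂ}
    (hface : ∀ f : D.Face, (h (D.corner f 2) - h (D.corner f 0)) *
      (h (D.corner f 1) - h (D.corner f 3)) = c (Sum.inl (f, 0)) - c (Sum.inl (f, 1)))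
    (hv : ∀ s : R.Side, h (D.start (Sum.inr s)) = v s.tgt) : R.HasTrivialMonodromy α β v := by
  obtain ⟨b, hb⟩ := D.exists_boundary_vertex
  have step : ∀ (s : R.Side) (p q : ℤ × ℤ) (γ : ℂ), s.src = p → s.tgt = q → c (Sum.inr s) = γ →
      ∃ d, D.start d = b p ∧ D.finish d = b q ∧ c d = γ := by
    rintro s p q γ rfl rfl rfl
    exact ⟨D.glue (Sum.inr s), (hb s).2, (D.finish_glue _).trans (hb s).1, hc.glue _⟩
  have hbv : ∀ s : R.Side, h (b s.tgt) = v s.tgt := fun s => by rw [← (hb s).1, hv]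
  have hbv' : ∀ s : R.Side, h (b s.src) = v s.src := fun s => by
    obtain ⟨t, ht⟩ := s.exists_tgt
    rw [← ht, hbv]
  obtain ⟨l1, p1, m1⟩ := QuadSurface.exists_path h c (γ := α) (n := R.M)
    (xs := fun k => b (R.a + k, R.b)) (fun i hi => step (.bottom ⟨i, hi⟩) _ _ _ rfl
      (by simp only [Rect.Side.tgt]; push_cast; ring_nf) (hc.bottom _))
  obtain ⟨l2, p2, m2⟩ := QuadSurface.exists_path h c (γ := β) (n := R.N)
    (xs := fun k => b (R.a + R.M, R.b + k)) (fun i hi => step (.right ⟨i, hi⟩) _ _ _ rfl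
      (by simp only [Rect.Side.tgt]; push_cast; ring_nf) (hc.right _))
  obtain ⟨l3, p3, m3⟩ := QuadSurface.exists_path h c (γ := α) (n := R.M)
    (xs := fun k => b (R.a + R.M - k, R.b + R.N)) (fun i hi => step (.top ⟨R.M - 1 - i, by omega⟩)
      _ _ _ (by simp only [Rect.Side.src]; congr 1; omega)
      (by simp only [Rect.Side.tgt]; congr 1; omega) (hc.top _))
  obtain ⟨l4, p4, m4⟩ := QuadSurface.exists_path h c (γ := β) (n := R.N)
    (xs := fun k => b (R.a, R.b + R.N - k)) (fun i hi => step (.left ⟨R.N - 1 - i, by omega⟩)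
      _ _ _ (by simp only [Rect.Side.src]; congr 1; omega)
      (by simp only [Rect.Side.tgt]; congr 1; omega) (hc.left _))
  simp only [Nat.cast_zero, add_zero, sub_zero, add_sub_cancel_right] at p1 p2 p3 p4
  have closed := QuadSurface.monodromy_closed D.simplyConnected hc.glue hc.opposite hface
    (((p1.append p2).append p3).append p4)
  simp only [QuadSurface.monodromy_append, m1, m2, m3, m4] at closed
  -- The vertex `b p` is meaningful only for boundary points `p`, so the comparison is made for the
  -- indices on the side.
  have c1 : ∀ k ≤ R.M, h (b (R.a + k, R.b)) = v (R.a + k, R.b) := by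
    intro k hk
    rcases k with _ | k
    · exact hbv' (.bottom ⟨0, R.M_pos⟩)
    · have := hbv (.bottom ⟨k, by omega⟩)
      simpa only [Rect.Side.tgt, add_assoc, Nat.cast_add, Nat.cast_one] using this
  have c2 : ∀ k ≤ R.N, h (b (R.a + R.M, R.b + k)) = v (R.a + R.M, R.b + k) := by
    intro k hk
    rcases k with _ | k
    · exact hbv' (.right ⟨0, R.N_pos⟩)
    · have := hbv (.right ⟨k, by omega⟩)
      simpa only [Rect.Side.tgt, add_assoc, Nat.cast_add, Nat.cast_one] using this
  have c3 : ∀ k ≤ R.M, h (b (R.a + R.M - k, R.b + R.N)) = v (R.a + R.M - k, R.b + R.N) := by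
    intro k hk
    rcases k with _ | k
    · have := hbv (.right ⟨R.N - 1, by have := R.N_pos; omega⟩)
      simp only [Rect.Side.tgt] at this
      rw [show R.b + ((R.N - 1 : ℕ) : ℤ) + 1 = R.b + R.N by have := R.N_pos; omega] at this
      simpa using this
    · have := hbv (.top ⟨R.M - (k + 1), by omega⟩)
      simp only [Rect.Side.tgt] at this
      rwa [show R.a + ((R.M - (k + 1) : ℕ) : ℤ) = R.a + R.M - (k + 1 : ℕ) by omega] at this
  have c4 : ∀ k ≤ R.N, h (b (R.a, R.b + R.N - k)) = v (R.a, R.b + R.N - k) := by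
    intro k hk
    rcases k with _ | k
    · have := hbv (.top ⟨0, R.M_pos⟩)
      simp only [Rect.Side.tgt] at this
      simpa using this
    · have := hbv (.left ⟨R.N - (k + 1), by omega⟩)
      simp only [Rect.Side.tgt] at this
      rwa [show R.b + ((R.N - (k + 1) : ℕ) : ℤ) = R.b + R.N - (k + 1 : ℕ) by omega] at this
  rw [chainLax_congr α c1, chainLax_congr β c2, chainLax_congr α c3, chainLax_congr β c4] at closed
  exact closed

namespace Rect.HasTrivialMonodromy

variable {R : Rect} {α β : ℂ} {u v : ℤ × ℤ → ℂ}

/-- The values on the right and top sides of a rectangle are determined by those on the left and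
bottom ones. -/
theorem right_top (hαβ : α ≠ β) (hu : R.HasTrivialMonodromy α β u)
    (hv : R.HasTrivialMonodromy α β v) (hu1 : ∀ m n, u (m, n) ≠ u (m + 2, n))
    (hu2 : ∀ m n, u (m, n) ≠ u (m, n + 2))
    (hb : ∀ x, R.a ≤ x → x ≤ R.a + R.M → v (x, R.b) = u (x, R.b))
    (hl : ∀ y, R.b ≤ y → y ≤ R.b + R.N → v (R.a, y) = u (R.a, y)) :
    (∀ x, R.a ≤ x → x ≤ R.a + R.M → v (x, R.b + R.N) = u (x, R.b + R.N)) ∧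
      ∀ y, R.b ≤ y → y ≤ R.b + R.N → v (R.a + R.M, y) = u (R.a + R.M, y) := by
  simp only [HasTrivialMonodromy] at hu hv
  rw [chainLax_congr (n := R.M) α (fun k hk => hb (R.a + k) (by omega) (by omega)),
    chainLax_congr (n := R.N) β (fun k hk => hl (R.b + R.N - k) (by omega) (by omega))] at hv
  -- Bracketed so that the two unknown sides, right and then top, form the middle factor between the
  -- known ones.
  rw [← mul_assoc (chainLax _ α _), ← mul_assoc] at hu hv
  refine (chainLax_mul_unique hαβ (det_chainLax_ne_zero _ _ _)
    (det_chainLax_ne_zero _ _ _) ?_ (by simp) (by simp)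
    (fun i _ => ?_) (fun i _ => ?_) hu hv).elim fun h1 h2 => ?_
  rotate_left 3
  · refine ⟨fun x h h' => ?_, fun y h h' => ?_⟩
    · have := h2 (R.a + R.M - x).toNat (by omega)
      rw [show R.a + R.M - ((R.a + R.M - x).toNat : ℤ) = x by omega] at this
      exact this.symm
    · have := h1 (y - R.b).toNat (by omega)
      rw [show R.b + ((y - R.b).toNat : ℤ) = y by omega] at this
      exact this.symm
  · simpa using (hb (R.a + R.M) (by omega) (by omega)).symm
  · have := hu2 (R.a + R.M) (R.b + i)
    simpa [add_assoc] using this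
  · have := hu1 (R.a + R.M - (i + 2)) (R.b + R.N)
    rw [sub_add_eq_sub_sub, sub_add_cancel] at this
    simpa [sub_sub] using this.symm

/-- The values on the left and top sides of a rectangle are determined by those on the right and
bottom ones. -/
theorem left_top (hαβ : α ≠ β) (hu : R.HasTrivialMonodromy α β u)
    (hv : R.HasTrivialMonodromy α β v) (hu1 : ∀ m n, u (m, n) ≠ u (m + 2, n))
    (hu2 : ∀ m n, u (m, n) ≠ u (m, n + 2))
    (hb : ∀ x, R.a ≤ x → x ≤ R.a + R.M → v (x, R.b) = u (x, R.b))
    (hr : ∀ y, R.b ≤ y → y ≤ R.b + R.N → v (R.a + R.M, y) = u (R.a + R.M, y)) :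
    (∀ x, R.a ≤ x → x ≤ R.a + R.M → v (x, R.b + R.N) = u (x, R.b + R.N)) ∧
      ∀ y, R.b ≤ y → y ≤ R.b + R.N → v (R.a, y) = u (R.a, y) := by
  simp only [HasTrivialMonodromy] at hu hv
  rw [chainLax_congr (n := R.M) α (fun k hk => hb (R.a + k) (by omega) (by omega)),
    chainLax_congr (n := R.N) β (fun k hk => hr (R.b + k) (by omega) (by omega))] at hv
  rw [← mul_assoc, ← one_mul (_ * chainLax _ α _)] at hu hv
  refine (chainLax_mul_unique hαβ.symm (by simp)
    (by rw [Matrix.det_mul]; exact mul_ne_zero (det_chainLax_ne_zero _ _ _)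
          (det_chainLax_ne_zero _ _ _)) ?_ (by simp) (by simp)
    (fun i _ => ?_) (fun i _ => ?_) hu hv).elim fun h1 h2 => ?_
  rotate_left 3
  · refine ⟨fun x h h' => ?_, fun y h h' => ?_⟩
    · have := h1 (R.a + R.M - x).toNat (by omega)
      rw [show R.a + R.M - ((R.a + R.M - x).toNat : ℤ) = x by omega] at this
      exact this.symm
    · have := h2 (R.b + R.N - y).toNat (by omega)
      rw [show R.b + R.N - ((R.b + R.N - y).toNat : ℤ) = y by omega] at this
      exact this.symm
  · simpa using (hr (R.b + R.N) (by omega) (by omega)).symm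
  · have := hu1 (R.a + R.M - (i + 2)) (R.b + R.N)
    rw [sub_add_eq_sub_sub, sub_add_cancel] at this
    simpa [sub_sub] using this.symm
  · have := hu2 R.a (R.b + R.N - (i + 2))
    rw [sub_add_eq_sub_sub, sub_add_cancel] at this
    simpa [sub_sub] using this.symm

/-- The values on the right and bottom sides of a rectangle are determined by those on the left and
top ones. -/
theorem right_bottom (hαβ : α ≠ β) (hu : R.HasTrivialMonodromy α β u)
    (hv : R.HasTrivialMonodromy α β v) (hu1 : ∀ m n, u (m, n) ≠ u (m + 2, n))
    (hu2 : ∀ m n, u (m, n) ≠ u (m, n + 2))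
    (ht : ∀ x, R.a ≤ x → x ≤ R.a + R.M → v (x, R.b + R.N) = u (x, R.b + R.N))
    (hl : ∀ y, R.b ≤ y → y ≤ R.b + R.N → v (R.a, y) = u (R.a, y)) :
    (∀ x, R.a ≤ x → x ≤ R.a + R.M → v (x, R.b) = u (x, R.b)) ∧
      ∀ y, R.b ≤ y → y ≤ R.b + R.N → v (R.a + R.M, y) = u (R.a + R.M, y) := by
  simp only [HasTrivialMonodromy] at hu hv
  rw [chainLax_congr (n := R.M) α (fun k hk => ht (R.a + R.M - k) (by omega) (by omega)),
    chainLax_congr (n := R.N) β (fun k hk => hl (R.b + R.N - k) (by omega) (by omega))] at hv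
  rw [← mul_assoc, ← mul_one (_ * (_ * chainLax _ α _))] at hu hv
  refine (chainLax_mul_unique hαβ.symm
    (by rw [Matrix.det_mul]; exact mul_ne_zero (det_chainLax_ne_zero _ _ _)
          (det_chainLax_ne_zero _ _ _)) (by simp) ?_ (by simp) (by simp)
    (fun i _ => ?_) (fun i _ => ?_) hu hv).elim fun h1 h2 => ?_
  rotate_left 3
  · refine ⟨fun x h h' => ?_, fun y h h' => ?_⟩
    · have := h1 (x - R.a).toNat (by omega)
      rw [show R.a + ((x - R.a).toNat : ℤ) = x by omega] at this
      exact this.symm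
    · have := h2 (y - R.b).toNat (by omega)
      rw [show R.b + ((y - R.b).toNat : ℤ) = y by omega] at this
      exact this.symm
  · simpa using (hl R.b (by omega) (by omega)).symm
  · have := hu1 (R.a + i) R.b
    simpa [add_assoc] using this
  · have := hu2 (R.a + R.M) (R.b + i)
    simpa [add_assoc] using this

/-- The values on the left and bottom sides of a rectangle are determined by those on the right and
top ones. -/
theorem left_bottom (hαβ : α ≠ β) (hu : R.HasTrivialMonodromy α β u)
    (hv : R.HasTrivialMonodromy α β v) (hu1 : ∀ m n, u (m, n) ≠ u (m + 2, n))
    (hu2 : ∀ m n, u (m, n) ≠ u (m, n + 2))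
    (ht : ∀ x, R.a ≤ x → x ≤ R.a + R.M → v (x, R.b + R.N) = u (x, R.b + R.N))
    (hr : ∀ y, R.b ≤ y → y ≤ R.b + R.N → v (R.a + R.M, y) = u (R.a + R.M, y)) :
    (∀ x, R.a ≤ x → x ≤ R.a + R.M → v (x, R.b) = u (x, R.b)) ∧
      ∀ y, R.b ≤ y → y ≤ R.b + R.N → v (R.a, y) = u (R.a, y) := by
  simp only [HasTrivialMonodromy] at hu hv
  rw [chainLax_congr (n := R.M) α (fun k hk => ht (R.a + R.M - k) (by omega) (by omega)),
    chainLax_congr (n := R.N) β (fun k hk => hr (R.b + k) (by omega) (by omega))] at hv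
  rw [← mul_assoc (chainLax _ α _), ← mul_assoc] at hu hv
  -- The unknown sides, left and then bottom, are consecutive only cyclically. Moving the base point
  -- makes them adjacent in the product.
  replace hu := hu.rotate (det_chainLax_ne_zero _ _ _)
  replace hv := hv.rotate (det_chainLax_ne_zero _ _ _)
  rw [← mul_assoc, ← one_mul (chainLax _ α _ * _)] at hu hv
  refine (chainLax_mul_unique hαβ (by simp)
    (by rw [Matrix.det_mul]; exact mul_ne_zero (det_chainLax_ne_zero _ _ _)
          (det_chainLax_ne_zero _ _ _)) ?_ (by simp) (by simp)
    (fun i _ => ?_) (fun i _ => ?_) hu hv).elim fun h1 h2 => ?_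
  rotate_left 3
  · refine ⟨fun x h h' => ?_, fun y h h' => ?_⟩
    · have := h2 (x - R.a).toNat (by omega)
      rw [show R.a + ((x - R.a).toNat : ℤ) = x by omega] at this
      exact this.symm
    · have := h1 (R.b + R.N - y).toNat (by omega)
      rw [show R.b + R.N - ((R.b + R.N - y).toNat : ℤ) = y by omega] at this
      exact this.symm
  · simpa using (ht R.a (by omega) (by omega)).symm
  · have := hu2 R.a (R.b + R.N - (i + 2))
    rw [sub_add_eq_sub_sub, sub_add_cancel] at this
    simpa [sub_sub] using this.symm
  · have := hu1 (R.a + i) R.b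
    simpa [add_assoc] using this

end Rect.HasTrivialMonodromy

/-! ### Propagation around the rectangle. -/

namespace StripTree

variable {V : Set (ℤ × ℤ)} {Adj : ℤ × ℤ → ℤ × ℤ → Prop} {F : Type*} [Field F] {κ : F}
  {u v : ℤ × ℤ → F} {a a' b b' : ℤ}

/-- Propagation around a rectangle that lies to the upper right of the graph. -/
theorem outside_ne (T : StripTree V Adj) (hκ : κ ≠ 0) (haa : a < a') (hbb : b < b')
    (hV : ∀ p ∈ V, ¬ (a < p.1 ∧ b < p.2)) {p₀ : ℤ × ℤ} (h₀ : p₀ ∈ V) (hp1 : p₀.1 ≤ a)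
    (hp2 : p₀.2 ≤ b) (hu : ∀ m n, CellEq κ u m n)
    (hv : ∀ m n, ¬ (a ≤ m ∧ m < a' ∧ b ≤ n ∧ n < b') → CellEq κ v m n)
    (huv : ∀ p ∈ V, v p = u p)
    (hside : (∀ x, a ≤ x → x ≤ a' → v (x, b) = u (x, b)) →
      (∀ y, b ≤ y → y ≤ b' → v (a, y) = u (a, y)) →
      (∀ x, a ≤ x → x ≤ a' → v (x, b') = u (x, b')) ∧
        ∀ y, b ≤ y → y ≤ b' → v (a', y) = u (a', y))
    (p : ℤ × ℤ) (hp : ¬ (a < p.1 ∧ p.1 < a' ∧ b < p.2 ∧ p.2 < b')) : v p = u p := by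
  -- The complement of the forbidden quadrant is a lower set containing the graph, and no removed
  -- cell has its upper right corner in it. It includes the left and bottom sides of the rectangle.
  have hQ : ∀ p : ℤ × ℤ, p.1 ≤ a ∨ p.2 ≤ b → v p = u p := by
    refine T.determined hκ (Q := fun p => p.1 ≤ a ∨ p.2 ≤ b) ?_ ?_ h₀ ?_ ?_ ?_ ?_ huv
    · intro a b a' b' h h1 h2; simp only at h ⊢; omega
    · intro p hp
      have := hV p hp; omega
    · intro x y h; simp only; omega
    · intro x y h; simp only; omega
    · intro m n h; simp only at h; exact hv m n (by omega)
    · intro m n _; exact hu m n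
  obtain ⟨ht, hr⟩ := hside (fun x _ _ => hQ (x, b) (.inr le_rfl)) fun y _ _ => hQ (a, y) (.inl le_rfl)
  -- Induction along the diagonal direction, each point being the upper right corner of a cell. If
  -- that cell has been removed, the point lies on the right or top side, where `hside` has settled
  -- it.
  have key : ∀ (k : ℕ) (x y : ℤ), x - a + (y - b) ≤ k →
      ¬ (a < x ∧ x < a' ∧ b < y ∧ y < b') → v (x, y) = u (x, y) := by
    intro k
    induction k with
    | zero =>
      intro x y h _
      exact hQ _ (by simp only; omega)
    | succ k ih =>
      intro x y h hi
      by_cases hq : x ≤ a ∨ y ≤ b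
      · exact hQ _ hq
      by_cases hc : a ≤ x - 1 ∧ x - 1 < a' ∧ b ≤ y - 1 ∧ y - 1 < b'
      · rcases eq_or_ne x a' with rfl | hx
        · exact hr y (by omega) (by omega)
        · obtain rfl : y = b' := by omega
          exact ht x (by omega) (by omega)
      · have e := CellEq.ne hκ (hv _ _ hc) (hu (x - 1) (y - 1))
        simp only [sub_add_cancel] at e
        exact e (ih _ _ (by omega) (by omega)) (ih _ _ (by omega) (by omega))
          (ih _ _ (by omega) (by omega))
  exact key (p.1 - a + (p.2 - b)).toNat p.1 p.2 (by omega) hp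

/-- Reflections reduce the other three quadrants to `outside_ne`. They exchange the two diagonals of
a cell and so preserve the cell equation. -/
theorem reflect_x (T : StripTree V Adj) :
    StripTree {p : ℤ × ℤ | (-p.1, p.2) ∈ V} fun p q => Adj (-p.1, p.2) (-q.1, q.2) where
  symm h := T.symm h
  mem h := T.mem h
  unit := by
    rintro ⟨x, y⟩ ⟨x', y'⟩ h
    have := T.unit h
    simp only [Prod.mk.injEq] at this ⊢
    omega
  conn := by
    intro p q hp hq
    have := (T.conn hp hq).lift (fun p : ℤ × ℤ => (-p.1, p.2))
      (p := fun p q => Adj (-p.1, p.2) (-q.1, q.2)) (fun p q h => by simpa [Function.onFun] using h)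
    simpa [Function.onFun] using this
  horiz m := by
    obtain ⟨n, hn, huniq⟩ := T.horiz (-m - 1)
    simp only [sub_add_cancel] at hn huniq
    refine ⟨n, ?_, fun n' hn' => huniq n' ?_⟩
    · have := T.symm hn
      simpa only [neg_add'] using this
    · have := T.symm hn'
      simpa only [neg_add'] using this
  vert n := by
    obtain ⟨m, hm, huniq⟩ := T.vert n
    refine ⟨-m, by simpa using hm, fun m' hm' => ?_⟩
    have := huniq (-m') hm'
    omega

theorem reflect_y (T : StripTree V Adj) :
    StripTree {p : ℤ × ℤ | (p.1, -p.2) ∈ V} fun p q => Adj (p.1, -p.2) (q.1, -q.2) where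
  symm h := T.symm h
  mem h := T.mem h
  unit := by
    rintro ⟨x, y⟩ ⟨x', y'⟩ h
    have := T.unit h
    simp only [Prod.mk.injEq] at this ⊢
    omega
  conn := by
    intro p q hp hq
    have := (T.conn hp hq).lift (fun p : ℤ × ℤ => (p.1, -p.2))
      (p := fun p q => Adj (p.1, -p.2) (q.1, -q.2)) (fun p q h => by simpa [Function.onFun] using h)
    simpa [Function.onFun] using this
  vert m := by
    obtain ⟨n, hn, huniq⟩ := T.vert (-m - 1)
    simp only [sub_add_cancel] at hn huniq
    refine ⟨n, ?_, fun n' hn' => huniq n' ?_⟩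
    · have := T.symm hn
      simpa only [neg_add'] using this
    · have := T.symm hn'
      simpa only [neg_add'] using this
  horiz n := by
    obtain ⟨m, hm, huniq⟩ := T.horiz n
    refine ⟨-m, by simpa using hm, fun m' hm' => ?_⟩
    have := huniq (-m') hm'
    omega

theorem _root_.CellEq.reflect_x {m n : ℤ} (h : CellEq κ u (-m - 1) n) :
    CellEq κ (fun p => u (-p.1, p.2)) m n := by
  simp only [CellEq, sub_add_cancel, neg_add'] at h ⊢
  linear_combination h

theorem _root_.CellEq.reflect_y {m n : ℤ} (h : CellEq κ u m (-n - 1)) :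
    CellEq κ (fun p => u (p.1, -p.2)) m n := by
  simp only [CellEq, sub_add_cancel, neg_add'] at h ⊢
  linear_combination h

/-- Propagation around a rectangle that lies to the upper left of the graph. -/
theorem outside_nw (T : StripTree V Adj) (hκ : κ ≠ 0) (haa : a < a') (hbb : b < b')
    (hV : ∀ p ∈ V, ¬ (p.1 < a' ∧ b < p.2)) {p₀ : ℤ × ℤ} (h₀ : p₀ ∈ V) (hp1 : a' ≤ p₀.1)
    (hp2 : p₀.2 ≤ b) (hu : ∀ m n, CellEq κ u m n)
    (hv : ∀ m n, ¬ (a ≤ m ∧ m < a' ∧ b ≤ n ∧ n < b') → CellEq κ v m n)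
    (huv : ∀ p ∈ V, v p = u p)
    (hside : (∀ x, a ≤ x → x ≤ a' → v (x, b) = u (x, b)) →
      (∀ y, b ≤ y → y ≤ b' → v (a', y) = u (a', y)) →
      (∀ x, a ≤ x → x ≤ a' → v (x, b') = u (x, b')) ∧
        ∀ y, b ≤ y → y ≤ b' → v (a, y) = u (a, y))
    (p : ℤ × ℤ) (hp : ¬ (a < p.1 ∧ p.1 < a' ∧ b < p.2 ∧ p.2 < b')) : v p = u p := by
  have := T.reflect_x.outside_ne hκ (a := -a') (a' := -a) (by omega) hbb
    (u := fun p => u (-p.1, p.2)) (v := fun p => v (-p.1, p.2)) (p₀ := (-p₀.1, p₀.2))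
    (fun p hp => by have := hV _ hp; simp only at this; omega) (by simpa using h₀)
    (by simp only; omega) hp2 (fun m n => (hu _ _).reflect_x)
    (fun m n h => (hv _ _ (by omega)).reflect_x) (fun p hp => huv _ hp) (fun hb hl => ?_)
    (-p.1, p.2) (by simp only; omega)
  · simpa using this
  · obtain ⟨h1, h2⟩ := hside
      (fun x _ _ => by simpa using hb (-x) (by omega) (by omega))
      (fun y _ _ => by simpa using hl y (by omega) (by omega))
    exact ⟨fun x _ _ => h1 (-x) (by omega) (by omega), fun y h h' => by simpa using h2 y h h'⟩

/-- Propagation around a rectangle that lies to the lower right of the graph. -/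
theorem outside_se (T : StripTree V Adj) (hκ : κ ≠ 0) (haa : a < a') (hbb : b < b')
    (hV : ∀ p ∈ V, ¬ (a < p.1 ∧ p.2 < b')) {p₀ : ℤ × ℤ} (h₀ : p₀ ∈ V) (hp1 : p₀.1 ≤ a)
    (hp2 : b' ≤ p₀.2) (hu : ∀ m n, CellEq κ u m n)
    (hv : ∀ m n, ¬ (a ≤ m ∧ m < a' ∧ b ≤ n ∧ n < b') → CellEq κ v m n)
    (huv : ∀ p ∈ V, v p = u p)
    (hside : (∀ x, a ≤ x → x ≤ a' → v (x, b') = u (x, b')) →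
      (∀ y, b ≤ y → y ≤ b' → v (a, y) = u (a, y)) →
      (∀ x, a ≤ x → x ≤ a' → v (x, b) = u (x, b)) ∧
        ∀ y, b ≤ y → y ≤ b' → v (a', y) = u (a', y))
    (p : ℤ × ℤ) (hp : ¬ (a < p.1 ∧ p.1 < a' ∧ b < p.2 ∧ p.2 < b')) : v p = u p := by
  have := T.reflect_y.outside_ne hκ (b := -b') (b' := -b) haa (by omega)
    (u := fun p => u (p.1, -p.2)) (v := fun p => v (p.1, -p.2)) (p₀ := (p₀.1, -p₀.2))
    (fun p hp => by have := hV _ hp; simp only at this; omega) (by simpa using h₀)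
    hp1 (by simp only; omega) (fun m n => (hu _ _).reflect_y)
    (fun m n h => (hv _ _ (by omega)).reflect_y) (fun p hp => huv _ hp) (fun hb hl => ?_)
    (p.1, -p.2) (by simp only; omega)
  · simpa using this
  · obtain ⟨h1, h2⟩ := hside
      (fun x _ _ => by simpa using hb x (by omega) (by omega))
      (fun y _ _ => by simpa using hl (-y) (by omega) (by omega))
    exact ⟨fun x h h' => by simpa using h1 x h h', fun y _ _ => h2 (-y) (by omega) (by omega)⟩

/-- Propagation around a rectangle that lies to the lower left of the graph. -/
theorem outside_sw (T : StripTree V Adj) (hκ : κ ≠ 0) (haa : a < a') (hbb : b < b')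
    (hV : ∀ p ∈ V, ¬ (p.1 < a' ∧ p.2 < b')) {p₀ : ℤ × ℤ} (h₀ : p₀ ∈ V) (hp1 : a' ≤ p₀.1)
    (hp2 : b' ≤ p₀.2) (hu : ∀ m n, CellEq κ u m n)
    (hv : ∀ m n, ¬ (a ≤ m ∧ m < a' ∧ b ≤ n ∧ n < b') → CellEq κ v m n)
    (huv : ∀ p ∈ V, v p = u p)
    (hside : (∀ x, a ≤ x → x ≤ a' → v (x, b') = u (x, b')) →
      (∀ y, b ≤ y → y ≤ b' → v (a', y) = u (a', y)) →
      (∀ x, a ≤ x → x ≤ a' → v (x, b) = u (x, b)) ∧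
        ∀ y, b ≤ y → y ≤ b' → v (a, y) = u (a, y))
    (p : ℤ × ℤ) (hp : ¬ (a < p.1 ∧ p.1 < a' ∧ b < p.2 ∧ p.2 < b')) : v p = u p := by
  have := T.reflect_y.outside_nw hκ (b := -b') (b' := -b) haa (by omega)
    (u := fun p => u (p.1, -p.2)) (v := fun p => v (p.1, -p.2)) (p₀ := (p₀.1, -p₀.2))
    (fun p hp => by have := hV _ hp; simp only at this; omega) (by simpa using h₀)
    hp1 (by simp only; omega) (fun m n => (hu _ _).reflect_y)
    (fun m n h => (hv _ _ (by omega)).reflect_y) (fun p hp => huv _ hp) (fun hb hl => ?_)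
    (p.1, -p.2) (by simp only; omega)
  · simpa using this
  · obtain ⟨h1, h2⟩ := hside
      (fun x _ _ => by simpa using hb x (by omega) (by omega))
      (fun y _ _ => by simpa using hl (-y) (by omega) (by omega))
    exact ⟨fun x h h' => by simpa using h1 x h h', fun y _ _ => h2 (-y) (by omega) (by omega)⟩

/-- A solution outside a rectangle, such that the values on two adjacent sides of the rectangle
determine those on the other two, is determined outside the rectangle by its values on the graph. -/
theorem outside (T : StripTree V Adj) (hκ : κ ≠ 0) (haa : a < a') (hbb : b < b')
    (hVh : ∀ m n, a ≤ m → m < a' → Adj (m, n) (m + 1, n) → n ≤ b ∨ b' ≤ n)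
    (hVv : ∀ m n, b ≤ n → n < b' → Adj (m, n) (m, n + 1) → m ≤ a ∨ a' ≤ m)
    (hu : ∀ m n, CellEq κ u m n)
    (hv : ∀ m n, ¬ (a ≤ m ∧ m < a' ∧ b ≤ n ∧ n < b') → CellEq κ v m n)
    (huv : ∀ p ∈ V, v p = u p)
    (hne : (∀ x, a ≤ x → x ≤ a' → v (x, b) = u (x, b)) →
      (∀ y, b ≤ y → y ≤ b' → v (a, y) = u (a, y)) →
      (∀ x, a ≤ x → x ≤ a' → v (x, b') = u (x, b')) ∧
        ∀ y, b ≤ y → y ≤ b' → v (a', y) = u (a', y))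
    (hnw : (∀ x, a ≤ x → x ≤ a' → v (x, b) = u (x, b)) →
      (∀ y, b ≤ y → y ≤ b' → v (a', y) = u (a', y)) →
      (∀ x, a ≤ x → x ≤ a' → v (x, b') = u (x, b')) ∧
        ∀ y, b ≤ y → y ≤ b' → v (a, y) = u (a, y))
    (hse : (∀ x, a ≤ x → x ≤ a' → v (x, b') = u (x, b')) →
      (∀ y, b ≤ y → y ≤ b' → v (a, y) = u (a, y)) →
      (∀ x, a ≤ x → x ≤ a' → v (x, b) = u (x, b)) ∧
        ∀ y, b ≤ y → y ≤ b' → v (a', y) = u (a', y))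
    (hsw : (∀ x, a ≤ x → x ≤ a' → v (x, b') = u (x, b')) →
      (∀ y, b ≤ y → y ≤ b' → v (a', y) = u (a', y)) →
      (∀ x, a ≤ x → x ≤ a' → v (x, b) = u (x, b)) ∧
        ∀ y, b ≤ y → y ≤ b' → v (a, y) = u (a, y)) :
    ∀ p : ℤ × ℤ, ¬ (a < p.1 ∧ p.1 < a' ∧ b < p.2 ∧ p.2 < b') → v p = u p := by
  obtain ⟨y₁, hy₁, -⟩ := T.horiz a
  obtain ⟨y₂, hy₂, -⟩ := T.horiz (a' - 1)
  obtain ⟨x₁, hx₁, -⟩ := T.vert b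
  obtain ⟨x₂, hx₂, -⟩ := T.vert (b' - 1)
  have m₂ := T.mem (T.symm hy₂)
  have m₂' := T.mem (T.symm hx₂)
  rw [sub_add_cancel] at m₂ m₂'
  have NE : y₁ ≤ b → x₁ ≤ a → _ := fun h h' =>
    T.outside_ne hκ haa hbb (fun p hp => T.not_mem_ne hy₁ hx₁ h h' hp) (T.mem hy₁) le_rfl h
      hu hv huv hne
  have NW : y₂ ≤ b → a' ≤ x₁ → _ := fun h h' =>
    T.outside_nw hκ haa hbb (fun p hp hc => T.not_mem_nw hy₂ hx₁ h (by omega) hp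
      ⟨by omega, hc.2⟩) m₂ le_rfl h hu hv huv hnw
  have SE : b' ≤ y₁ → x₂ ≤ a → _ := fun h h' =>
    T.outside_se hκ haa hbb (fun p hp hc => T.not_mem_se hy₁ hx₂ (by omega) h' hp
      ⟨hc.1, by omega⟩) (T.mem hy₁) le_rfl h hu hv huv hse
  have SW : b' ≤ y₂ → a' ≤ x₂ → _ := fun h h' =>
    T.outside_sw hκ haa hbb (fun p hp hc => T.not_mem_sw hy₂ hx₂ (by omega) (by omega) hp
      ⟨by omega, by omega⟩) m₂ le_rfl h hu hv huv hsw
  -- The graph edges in the first and last strips through the rectangle each lie on one side of it.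
  -- Either two of them exclude the quadrant at some corner, or all four wind around the rectangle
  -- like a pinwheel, which the quadrant lemmas rule out in both orientations.
  rcases hVh _ _ le_rfl haa hy₁ with h1 | h1 <;>
  rcases hVh _ _ (by omega) (by omega) hy₂ with h2 | h2 <;>
  rcases hVv _ _ le_rfl hbb hx₁ with h3 | h3 <;>
  rcases hVv _ _ (by omega) (by omega) hx₂ with h4 | h4 <;>
  first
    | exact NE h1 h3
    | exact NW h2 h3
    | exact SE h1 h4
    | exact SW h2 h4
    | exact absurd ⟨h4, hbb⟩ (T.not_mem_nw hy₁ hx₁ h1 (by omega) m₂')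
    | exact absurd ⟨h3, show b ≤ b' - 1 by omega⟩
        (T.not_mem_sw hy₁ hx₂ (by omega) (by omega) (T.mem hx₁))

end StripTree

/-! ### Specialization to generic data. -/

theorem RegularAt.cell {S : Type} {w : S → ℂ} {x₁ x₂ x₃ x₄ : FractionRing (MvPolynomial S ℂ)}
    {y₁ y₂ y₃ y₄ κ : ℂ} (h₁ : RegularAt w x₁ y₁) (h₂ : RegularAt w x₂ y₂)
    (h₃ : RegularAt w x₃ y₃) (h₄ : RegularAt w x₄ y₄)
    (h : (x₁ - x₂) * (x₃ - x₄) = algebraMap ℂ _ κ) : (y₁ - y₂) * (y₃ - y₄) = κ :=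
  (((h₁.sub h₂).mul (h₃.sub h₄)).unique (h ▸ RegularAt.const κ))

/-- Expresses nonvanishing as regularity: adjoining `x⁻¹` to the functions required to be regular at
`w` guarantees that `x` does not vanish there. -/
theorem RegularAt.ne_zero_of_inv {S : Type} {w : S → ℂ} {x : FractionRing (MvPolynomial S ℂ)}
    {y z : ℂ} (hx : x ≠ 0) (h : RegularAt w x y) (h' : RegularAt w x⁻¹ z) : y ≠ 0 := by
  have e := (h.mul h').unique (y' := 1) (by
    rw [mul_inv_cancel₀ hx]; simpa using RegularAt.const (w := w) 1)
  exact left_ne_zero_of_mul (e ▸ one_ne_zero)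

theorem Rect.outerGraph_adj {R : Rect} {p q : ℤ × ℤ} (h : R.outerGraph.Adj p q) :
    q = (p.1 + 1, p.2) ∨ q = (p.1 - 1, p.2) ∨ q = (p.1, p.2 + 1) ∨ q = (p.1, p.2 - 1) := by
  obtain ⟨x, y⟩ := p
  obtain ⟨x', y'⟩ := q
  simp only [Rect.outerGraph, SimpleGraph.fromRel_adj, Prod.mk.injEq] at h ⊢
  omega

theorem Rect.outerGraph_adj_horizontal {R : Rect} {m n : ℤ}
    (h : R.outerGraph.Adj (m, n) (m + 1, n)) (h1 : R.a ≤ m) (h2 : m < R.a + R.M) :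
    n ≤ R.b ∨ R.b + R.N ≤ n := by
  simp only [Rect.outerGraph, SimpleGraph.fromRel_adj, Rect.HasCell, Prod.mk.injEq] at h
  omega

theorem Rect.outerGraph_adj_vertical {R : Rect} {m n : ℤ}
    (h : R.outerGraph.Adj (m, n) (m, n + 1)) (h1 : R.b ≤ n) (h2 : n < R.b + R.N) :
    m ≤ R.a ∨ R.a + R.M ≤ m := by
  simp only [Rect.outerGraph, SimpleGraph.fromRel_adj, Rect.HasCell, Prod.mk.injEq] at h
  omega

theorem IsCauchySubgraph.stripTree {R : Rect} {P : R.outerGraph.Subgraph}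
    (hP : IsCauchySubgraph R P) : StripTree P.verts P.Adj where
  symm h := P.adj_symm h
  mem h := P.edge_vert h
  unit h := Rect.outerGraph_adj (P.adj_sub h)
  conn := by
    intro p q hp hq
    have h := hP.connected.coe.preconnected ⟨p, hp⟩ ⟨q, hq⟩
    rw [SimpleGraph.reachable_iff_reflTransGen] at h
    exact h.lift Subtype.val fun _ _ h => h
  horiz := hP.vertical_strip
  vert := hP.horizontal_strip

/-- Square roots of the shifted parameters, such that the roots for two given parameters do not
vanish. -/
theorem exists_roots (α β : ℂ) :
    ∃ r : ℂ → ℂ, (∀ γ δ, r γ ^ 2 - r δ ^ 2 = γ - δ) ∧ r α ≠ 0 ∧ r β ≠ 0 := by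
  classical
  -- A common shift of the parameters leaves differences unchanged; avoiding `-α` and `-β` makes
  -- both roots nonzero.
  obtain ⟨κ, hκ⟩ := Infinite.exists_notMem_finset ({-α, -β} : Finset ℂ)
  simp only [Finset.mem_insert, Finset.mem_singleton, not_or] at hκ
  have h : ∀ z : ℂ, ∃ x : ℂ, x ^ 2 = z + κ := fun z => IsAlgClosed.exists_pow_nat_eq _ two_pos
  choose r hr using h
  have key : ∀ γ, κ ≠ -γ → r γ ≠ 0 := by
    intro γ hγ h0
    have := hr γ
    rw [h0] at this
    exact hγ (by linear_combination -this)
  exact ⟨r, fun γ δ => by rw [hr, hr]; ring, key α hκ.1, key β hκ.2⟩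

theorem theorem3 (α β : ℂ) (hαβ : α ≠ β) (R : Rect) (D : Defect R) (hD : D.IsWeak)
    (c : D.Dart → ℂ) (hc : D.IsParameter α β c)
    (P : R.outerGraph.Subgraph) (hP : IsCauchySubgraph R P) :
    Generically fun w : P.verts → ℂ =>
      ∃ u : ℤ × ℤ → ℂ,
        (IsLatticeSolution α β u ∧ ∀ p : P.verts, u p = w p) ∧
        (∀ u' : ℤ × ℤ → ℂ,
          IsLatticeSolution α β u' → (∀ p : P.verts, u' p = w p) → u' = u) ∧
        (∃ (v : ℤ × ℤ → ℂ) (h : D.Vertex → ℂ),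
          D.IsSolution α β c v h ∧ ∀ p : P.verts, v p = w p) ∧
        (∀ (v : ℤ × ℤ → ℂ) (h : D.Vertex → ℂ),
          D.IsSolution α β c v h → (∀ p : P.verts, v p = w p) →
            ∀ p : ℤ × ℤ, ¬ R.Inside p → v p = u p) := by
  classical
  have T := hP.stripTree
  have hκ : α - β ≠ 0 := sub_ne_zero.2 hαβ
  obtain ⟨r, hr, hrα, hrβ⟩ := exists_roots α β
  -- The data of the linear solution, used only as a witness that the denominators and second
  -- differences are nonzero rational functions.
  let w₀ : P.verts → ℂ := fun p => linearField (r α) (r β) p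
  obtain ⟨u, hur, hud, hu⟩ := T.exists_solution (w := w₀) (L := linearField (r α) (r β)) hκ
    (fun m n => by rw [← hr α β]; exact linearField_eq _ _ m n)
    (d := fun p => if h : p ∈ P.verts then
      algebraMap (MvPolynomial P.verts ℂ) _ (MvPolynomial.X ⟨p, h⟩) else 0)
    (fun p hp => by
      have := RegularAt.of_poly (w := w₀) (MvPolynomial.X ⟨p, hp⟩)
      rw [MvPolynomial.eval_X] at this
      simpa only [dif_pos hp] using this)
  obtain ⟨h, hface, hbd⟩ := hD.exists_field hαβ hc hr hu hur
  have ne1 : ∀ p : ℤ × ℤ, u (p.1 + 2, p.2) - u p ≠ 0 := fun p =>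
    ((hur (p.1 + 2, p.2)).sub (hur p)).ne_zero (by
      have : linearField (r α) (r β) (p.1 + 2, p.2) - linearField (r α) (r β) p = 2 * r α := by
        simp only [linearField]; push_cast; ring
      rw [this]; exact mul_ne_zero two_ne_zero hrα)
  have ne2 : ∀ p : ℤ × ℤ, u (p.1, p.2 + 2) - u p ≠ 0 := fun p =>
    ((hur (p.1, p.2 + 2)).sub (hur p)).ne_zero (by
      have : linearField (r α) (r β) (p.1, p.2 + 2) - linearField (r α) (r β) p = 2 * r β := by
        simp only [linearField]; push_cast; ring
      rw [this]; exact mul_ne_zero two_ne_zero hrβ)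
  have : Countable D.Vertex := by
    have := D.finite_dart
    exact (Quot.mk_surjective (r := D.CornerRel)).countable
  -- The countably many functions that must be regular at `w`: the solution on the lattice, the
  -- field on the defect, and the inverses of the second differences needed for unique
  -- factorization.
  refine (generically_regularAt (ι := (ℤ × ℤ) ⊕ D.Vertex ⊕ (ℤ × ℤ) ⊕ (ℤ × ℤ))
    (Sum.elim u (Sum.elim h (Sum.elim (fun p => (u (p.1 + 2, p.2) - u p)⁻¹)
      fun p => (u (p.1, p.2 + 2) - u p)⁻¹)))).mono fun w ⟨y, hy⟩ => ?_
  let uC : ℤ × ℤ → ℂ := fun p => y (.inl p)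
  let hC : D.Vertex → ℂ := fun x => y (.inr (.inl x))
  have huC : ∀ p, RegularAt w (u p) (uC p) := fun p => hy (.inl p)
  have hhC : ∀ x, RegularAt w (h x) (hC x) := fun x => hy (.inr (.inl x))
  have sol : IsLatticeSolution α β uC := fun m n =>
    (huC _).cell (huC _) (huC _) (huC _) (hu m n)
  have data : ∀ p : P.verts, uC p = w p := fun p => by
    have := huC p
    rw [hud p p.2, dif_pos p.2] at this
    exact this.unique (by simpa using RegularAt.of_poly (w := w) (MvPolynomial.X p))
  have solD : D.IsSolution α β c uC hC :=
    { outside := fun m n _ => sol m n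
      face := fun f => (hhC _).cell (hhC _) (hhC _) (hhC _) (hface f)
      boundary := fun s => (hhC _).unique (by rw [hbd]; exact huC _) }
  have gen1 : ∀ m n, uC (m, n) ≠ uC (m + 2, n) := fun m n e =>
    RegularAt.ne_zero_of_inv (ne1 (m, n)) ((huC (m + 2, n)).sub (huC (m, n)))
      (hy (.inr (.inr (.inl (m, n))))) (sub_eq_zero.2 e.symm)
  have gen2 : ∀ m n, uC (m, n) ≠ uC (m, n + 2) := fun m n e =>
    RegularAt.ne_zero_of_inv (ne2 (m, n)) ((huC (m, n + 2)).sub (huC (m, n)))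
      (hy (.inr (.inr (.inr (m, n))))) (sub_eq_zero.2 e.symm)
  have triv := D.hasTrivialMonodromy hc solD.face solD.boundary
  refine ⟨uC, ⟨sol, data⟩, fun u' hu' hd' => ?_, ⟨uC, hC, solD, data⟩, fun v h' hv hvd => ?_⟩
  · obtain ⟨n, hn, -⟩ := T.horiz 0
    funext p
    exact T.determined hκ (Q := fun _ => True) (fun _ _ _ => trivial) (fun _ _ => trivial)
      (T.mem hn) (fun _ _ _ => trivial) (fun _ _ _ => trivial) (fun m n _ => hu' m n)
      (fun m n _ => sol m n) (fun p hp => (hd' ⟨p, hp⟩).trans (data ⟨p, hp⟩).symm) p trivial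
  · have triv' := D.hasTrivialMonodromy hc hv.face hv.boundary
    have hM := R.M_pos
    have hN := R.N_pos
    exact T.outside hκ (by omega) (by omega)
      (fun m n h1 h2 h => Rect.outerGraph_adj_horizontal (P.adj_sub h) h1 h2)
      (fun m n h1 h2 h => Rect.outerGraph_adj_vertical (P.adj_sub h) h1 h2) sol hv.outside
      (fun p hp => (hvd ⟨p, hp⟩).trans (data ⟨p, hp⟩).symm)
      (triv.right_top hαβ triv' gen1 gen2) (triv.left_top hαβ triv' gen1 gen2)
      (triv.right_bottom hαβ triv' gen1 gen2) (triv.left_bottom hαβ triv' gen1 gen2)
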